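/- **Setting.** Let $m\ge 1$ and let $\mathbf g:\mathbb R\to\mathbb R^2$ be a $C^{m+1}$, $(\xi_e-\xi_s)$-periodic map with $\mathbf g'\neq 0$ everywhere that is injective on $[\xi_s,\xi_e)$, so that $\Gamma=\mathbf g(\mathbb R)$ is a Jordan curve. Put $\boldsymbol\tau=\mathbf g'/\|\mathbf g'\|$, $\mathbf n=(\tau_2,-\tau_1)$, $\kappa=\det(\mathbf g',\mathbf g'')/\|\mathbf g'\|^{3}$, $P(\eta,\xi)=\mathbf g(\xi)+\eta\,\mathbf n(\xi)$ and $J=\|\mathbf g'\|(1+\eta\kappa)$, and let $$\mathscr L p=p_{\eta\eta}+\frac{\kappa}{1+\eta\kappa}\,p_\eta+\frac1J\,\partial_\xi\Big(\frac1J\,p_\xi\Big)$$ be the Laplacian in the coordinates $(\eta,\xi)$, i.e. $\mathscr L(u\circ P)=(\Delta u)\circ P$. Let $\Omega\supset\Gamma$ be an open rectangle that $\Gamma$ splits into two subdomains $\Omega^+$, $\Omega^-$ with $\partial\Omega^+\cap\partial\Omega^-=\Gamma$, $\mathbf n$ pointing from $\Omega^-$ towards $\Omega^+$, and let $\beta=\beta^\pm$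 on $\Omega^\pm$ with constants $\beta^+\ge\beta^->0$. Let $\mathcal T_h$ be a uniform mesh of $\overline\Omega$ by closed axis-parallel rectangles of diameter $h$ whose aspect ratio is at most $\sigma$. An element $K$ is an *interface element* if its interior meets $\Gamma$; write $K^\pm=K\cap\Omega^\pm$. For an interface element $K$ (and $h$ small) let $R=P^{-1}:K\to[-h,h]\times\mathbb R$, $x\mapsto(\eta,\xi)$, be a continuous branch of the inverse of $P$, and let $[\xi_0,\xi_1]$ be the set of $\xi$-coordinates of the points of $R(K)$. Let $Q^m$ be the space of polynomials in two variables of degree at most $m$ in each of them. The local Frenet IFE space $\mathcal V^m_\beta(K)$ consists of the functions $\phi$ with $\phi=\hat\phi^{\pm}\circ R$ on $K^\pm$, where $\hat\phi^+,\hat\phi^-\in Q^m$ satisfy, for all $\xi\in[\xi_0,\xi_1]$, $$\hat\phi^+(0,\xi)=\hat\phi^-(0,\xi),\qquad \beta^+\hat\phi^+_\eta(0,\xi)=\beta^-\hat\phi^-_\eta(0,\xi),$$ and, for all integers $0\le j\le m-2$ and all univariate polynomials $v$ of degree at most $m$, $$\int_{\xi_0}^{\xi_1}\big(\beta^+\partial_\eta^j\mathscr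 L\hat\phi^+-\beta^-\partial_\eta^j\mathscr L\hat\phi^-\big)(0,\xi)\,v(\xi)\,d\xi=0.$$ The global space $\mathcal V^m_\beta(\mathcal T_h)$ consists of the (discontinuous) functions $\phi$ with $\phi|_K\in\mathcal V^m_\beta(K)$ on interface elements and $\phi|_K\in Q^m$ (in $x,y$) on all other elements. **Theorem.** For given $m$, $\mathbf g$ and $\sigma$ there are constants $C>0$ and $h_0>0$ such that for all $\Omega,\Omega^\pm,\beta^\pm$ and $\mathcal T_h$ as above with $h<h_0$ (in particular, $C$ and $h_0$ are independent of $h$, of the position of the interface relative to the mesh, and of $\beta^\pm$): 1. for every interface element $K\in\mathcal T_h$ and every $\phi\in\mathcal V^m_\beta(K)$, $$\|\beta\nabla\phi\|_{L^2(\partial K)}\le C\,\frac{\beta^+}{\sqrt{\beta^-}}\,h^{-1/2}\,\|\sqrt\beta\,\nabla\phi\|_{L^2(K)};$$ 2. the same inequality holds for every $\phi\in\mathcal V^m_\beta(\mathcal T_h)$ and every $K\in\mathcal T_h$. Here $\nabla\phi$ is taken piecewise on $K^+$ and $K^-$, and $\beta\nabla\phi$ on $\partial K$ denotes its traces from $K^\pm$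 on $\partial K\cap\overline{K^\pm}$. -/

import Mathlib

open Set Filter Topology MeasureTheory
open scoped ENNReal

noncomputable section

/-- The Euclidean plane. -/
abbrev Plane : Type := EuclideanSpace ℝ (Fin 2)

namespace FrenetIFE

/-! ### The interface curve and the Frenet transformation -/

/-- `g` is a regular `C^{m+1}` parametrization of a Jordan curve on `[ξs, ξe]`, extended
periodically to the whole line. -/
structure IsJordanParam (m : ℕ) (ξs ξe : ℝ) (g : ℝ → Plane) : Prop where
  lt : ξs < ξe
  periodic : Function.Periodic g (ξe - ξs)
  injOn : InjOn g (Ico ξs ξe)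
  contDiff : ContDiff ℝ ((m + 1 : ℕ) : WithTop ℕ∞) g
  regular : ∀ ξ, deriv g ξ ≠ 0

/-- Unit tangent vector. -/
def tangent (g : ℝ → Plane) (ξ : ℝ) : Plane := ‖deriv g ξ‖⁻¹ • deriv g ξ

/-- Unit normal vector `n = (0 1; -1 0) τ`. -/
def normal (g : ℝ → Plane) (ξ : ℝ) : Plane := !₂[tangent g ξ 1, -tangent g ξ 0]

/-- Signed curvature `‖g'‖⁻³ det (g', g'')`. -/
def curvature (g : ℝ → Plane) (ξ : ℝ) : ℝ :=
  (deriv g ξ 0 * deriv (deriv g) ξ 1 - deriv g ξ 1 * deriv (deriv g) ξ 0) / ‖deriv g ξ‖ ^ 3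

/-- The Frenet transformation `P(η, ξ) = g(ξ) + η n(ξ)`. -/
def frenetMap (g : ℝ → Plane) (η ξ : ℝ) : Plane := g ξ + η • normal g ξ

/-- The Jacobian determinant `‖g'(ξ)‖ (1 + η κ(ξ))` of the Frenet transformation. -/
def frenetJac (g : ℝ → Plane) (η ξ : ℝ) : ℝ := ‖deriv g ξ‖ * (1 + η * curvature g ξ)

/-- The Laplacian in Frenet coordinates: the operator `ℒ` with `ℒ(u ∘ P) = (Δ u) ∘ P`.
The metric in the coordinates `(η, ξ)` is `dη² + J² dξ²` with `J = ‖g'‖ (1 + η κ)`, hence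
`ℒ p = p_ηη + κ / (1 + η κ) p_η + J⁻¹ ∂_ξ (J⁻¹ p_ξ)`. -/
def frenetLaplacian (g : ℝ → Plane) (p : ℝ → ℝ → ℝ) (η ξ : ℝ) : ℝ :=
  iteratedDeriv 2 (fun e => p e ξ) η
    + curvature g ξ / (1 + η * curvature g ξ) * deriv (fun e => p e ξ) η
    + (frenetJac g η ξ)⁻¹ * deriv (fun x => (frenetJac g η x)⁻¹ * deriv (fun y => p η y) x) ξ

/-! ### The domain and its two subdomains -/

/-- The open rectangle `(a₀, b₀) × (a₁, b₁)`. -/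
def openRect (a b : Fin 2 → ℝ) : Set Plane := {x | ∀ j, a j < x j ∧ x j < b j}

/-- The curve `Γ = range g` lies in `Ω` and splits it into the subdomains `Ω⁺` and `Ω⁻` with
`∂Ω⁺ ∩ ∂Ω⁻ = Γ`; the normal `n` points from `Ω⁻` towards `Ω⁺`. -/
structure IsSplitting (g : ℝ → Plane) (Ω Ωp Ωm : Set Plane) : Prop where
  curve_subset : range g ⊆ Ω
  isOpen_pos : IsOpen Ωp
  isOpen_neg : IsOpen Ωm
  isConnected_pos : IsConnected Ωp
  isConnected_neg : IsConnected Ωm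
  disjoint : Disjoint Ωp Ωm
  union_eq : Ωp ∪ Ωm = Ω \ range g
  frontier_inter : frontier Ωp ∩ frontier Ωm = range g
  normal_dir : ∀ ξ, ∀ᶠ η in 𝓝[>] (0 : ℝ), frenetMap g η ξ ∈ Ωp ∧ frenetMap g (-η) ξ ∈ Ωm

/-! ### Uniform rectangular meshes -/

/-- Side length in direction `j` of the elements of the `N₀ × N₁` uniform mesh. -/
def meshStep (a b : Fin 2 → ℝ) (N : Fin 2 → ℕ) (j : Fin 2) : ℝ := (b j - a j) / N j

/-- The mesh size `h`: the diameter of every element. -/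
def meshSize (a b : Fin 2 → ℝ) (N : Fin 2 → ℕ) : ℝ :=
  √(meshStep a b N 0 ^ 2 + meshStep a b N 1 ^ 2)

/-- The (closed, rectangular) element with index `i`. -/
def meshElement (a b : Fin 2 → ℝ) (N i : Fin 2 → ℕ) : Set Plane :=
  {x | ∀ j, a j + i j * meshStep a b N j ≤ x j ∧ x j ≤ a j + (i j + 1) * meshStep a b N j}

/-- Shape regularity: the aspect ratio of the elements is at most `σ`. -/
def ShapeRegular (a b : Fin 2 → ℝ) (N : Fin 2 → ℕ) (σ : ℝ) : Prop :=
  meshStep a b N 0 ≤ σ * meshStep a b N 1 ∧ meshStep a b N 1 ≤ σ * meshStep a b N 0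

/-- An interface element: its interior meets the interface. -/
def IsInterfaceElement (g : ℝ → Plane) (K : Set Plane) : Prop := (interior K ∩ range g).Nonempty

/-! ### Finite element spaces -/

/-- Tensor-product polynomials of degree at most `m` in each of the two variables. -/
def IsTensorPoly (m : ℕ) (p : ℝ → ℝ → ℝ) : Prop :=
  ∃ c : Fin (m + 1) → Fin (m + 1) → ℝ, ∀ s t, p s t = ∑ i, ∑ j, c i j * s ^ (i : ℕ) * t ^ (j : ℕ)

/-- `R : x ↦ (η, ξ)` is the inverse of the Frenet transformation on `K`, where `|η| ≤ h`.
The curve being closed, `ξ` is determined up to a multiple of the period; continuity on `K`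
selects a branch for which `R(K)` is connected. -/
structure IsFrenetInverse (g : ℝ → Plane) (h : ℝ) (K : Set Plane) (R : Plane → ℝ × ℝ) : Prop where
  continuousOn : ContinuousOn R K
  right_inv : ∀ x ∈ K, frenetMap g (R x).1 (R x).2 = x
  abs_le : ∀ x ∈ K, |(R x).1| ≤ h

/-- The left endpoint `ξ₀` of the interval of all `ξ`-coordinates of points of `R(K)`. -/
def xiLeft (K : Set Plane) (R : Plane → ℝ × ℝ) : ℝ := sInf ((fun x => (R x).2) '' K)

/-- The right endpoint `ξ₁` of the interval of all `ξ`-coordinates of points of `R(K)`. -/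
def xiRight (K : Set Plane) (R : Plane → ℝ × ℝ) : ℝ := sSup ((fun x => (R x).2) '' K)

/-- `(pp, pm)` are the two polynomial pieces (for `η > 0` and for `η < 0`) of a function in the
Frenet IFE space in Frenet coordinates: they satisfy the jump conditions on the
segment `{0} × [ξ₀, ξ₁]`, where `[[w]] = w⁺ - w⁻`. -/
structure IsIFEPair (g : ℝ → Plane) (m : ℕ) (βp βm ξ₀ ξ₁ : ℝ) (pp pm : ℝ → ℝ → ℝ) : Prop where
  poly_pos : IsTensorPoly m pp
  poly_neg : IsTensorPoly m pm
  jump_value : ∀ ξ ∈ Icc ξ₀ ξ₁, pp 0 ξ - pm 0 ξ = 0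
  jump_flux : ∀ ξ ∈ Icc ξ₀ ξ₁,
    βp * deriv (fun η => pp η ξ) 0 - βm * deriv (fun η => pm η ξ) 0 = 0
  jump_laplacian : ∀ j : ℕ, j + 2 ≤ m → ∀ v : Polynomial ℝ, v.natDegree ≤ m →
    ∫ ξ in ξ₀..ξ₁,
      (βp * iteratedDeriv j (fun η => frenetLaplacian g pp η ξ) 0
        - βm * iteratedDeriv j (fun η => frenetLaplacian g pm η ξ) 0) * v.eval ξ = 0

/-- The local Frenet IFE space on an interface element `K` of diameter `h`: the functions
`φ = φ̂ ∘ R` with `φ̂` in the Frenet IFE space in Frenet coordinates. Functions on elements are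
prescribed in the interior only, since functions on a mesh are in general two-valued on edges. -/
def localSpace (g : ℝ → Plane) (m : ℕ) (βp βm : ℝ) (Ωp Ωm : Set Plane) (h : ℝ) (K : Set Plane) :
    Set (Plane → ℝ) :=
  {φ | ∃ R : Plane → ℝ × ℝ, IsFrenetInverse g h K R ∧
    ∃ pp pm : ℝ → ℝ → ℝ, IsIFEPair g m βp βm (xiLeft K R) (xiRight K R) pp pm ∧
      (∀ x ∈ interior K ∩ (Ωp ∪ range g), φ x = pp (R x).1 (R x).2) ∧
      (∀ x ∈ interior K ∩ (Ωm ∪ range g), φ x = pm (R x).1 (R x).2)}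

/-- The space `Q^m(K)`. -/
def polySpace (m : ℕ) (K : Set Plane) : Set (Plane → ℝ) :=
  {φ | ∃ q : ℝ → ℝ → ℝ, IsTensorPoly m q ∧ ∀ x ∈ interior K, φ x = q (x 0) (x 1)}

/-- The global discontinuous Frenet IFE space on the uniform mesh. -/
def globalSpace (g : ℝ → Plane) (m : ℕ) (βp βm : ℝ) (Ωp Ωm : Set Plane)
    (a b : Fin 2 → ℝ) (N : Fin 2 → ℕ) : Set (Plane → ℝ) :=
  {φ | ∀ i : Fin 2 → ℕ, (∀ j, i j < N j) →
    (IsInterfaceElement g (meshElement a b N i) →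
      φ ∈ localSpace g m βp βm Ωp Ωm (meshSize a b N) (meshElement a b N i)) ∧
    (¬ IsInterfaceElement g (meshElement a b N i) →
      φ ∈ polySpace m (meshElement a b N i))}

/-! ### Norms -/

/-- The contribution of the part `U` of an element `K` to `‖∇φ‖²_{L²(∂K)}`: the trace of `∇φ`
on `∂K ∩ closure U` is its extension by continuity from `U`; arc length is `μH[1]`. -/
def boundaryGradSq (U K : Set Plane) (φ : Plane → ℝ) : ℝ≥0∞ :=
  ∫⁻ x in frontier K ∩ closure U, ‖extendFrom U (gradient φ) x‖ₑ ^ 2 ∂(Measure.hausdorffMeasure 1)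

/-- `‖β ∇φ‖_{L²(∂K)}` for `β = β^±` on `Ω^±`. -/
def fluxBoundaryNorm (βp βm : ℝ) (Ωp Ωm K : Set Plane) (φ : Plane → ℝ) : ℝ≥0∞ :=
  (ENNReal.ofReal βp ^ 2 * boundaryGradSq (interior K ∩ Ωp) K φ
    + ENNReal.ofReal βm ^ 2 * boundaryGradSq (interior K ∩ Ωm) K φ) ^ (1 / 2 : ℝ)

/-- `‖√β ∇φ‖_{L²(K)}` for `β = β^±` on `Ω^±`. -/
def energyNorm (βp βm : ℝ) (Ωp Ωm K : Set Plane) (φ : Plane → ℝ) : ℝ≥0∞ :=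
  (ENNReal.ofReal βp * (∫⁻ x in interior K ∩ Ωp, ‖gradient φ x‖ₑ ^ 2)
    + ENNReal.ofReal βm * (∫⁻ x in interior K ∩ Ωm, ‖gradient φ x‖ₑ ^ 2)) ^ (1 / 2 : ℝ)

/-- `‖β ∇φ‖_{L²(∂K)} ≤ C (β⁺ / √β⁻) h^{-1/2} ‖√β ∇φ‖_{L²(K)}`. -/
def TraceInequality (C βp βm : ℝ) (Ωp Ωm : Set Plane) (h : ℝ) (K : Set Plane)
    (φ : Plane → ℝ) : Prop :=
  fluxBoundaryNorm βp βm Ωp Ωm K φ ≤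
    ENNReal.ofReal (C * (βp / √βm) * h ^ (-(1 / 2) : ℝ)) * energyNorm βp βm Ωp Ωm K φ

end FrenetIFE

end

noncomputable section

namespace FrenetIFE

/-! The difficulty is that Γ may cut a sliver off K that is arbitrarily thin, and on such a sliver
no inverse inequality holds with a uniform constant. Two facts repair this: at least one of the two
sides contains a square of size comparable to h, and the jump conditions make the polynomial piece
on either side control the other one, stably and uniformly in β^±.

Geometry (`IsJordanParam.exists_frenet_square`). Near K the Frenet map and its inverse R are
Lipschitz with constants depending only on g, so R(K) contains a square of size ~h about the image
of the centre of K. Moving away from the line η = 0 leaves a square that misses Γ and, being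
connected, lies in one subdomain U. Equivalence of norms for polynomials of bounded degree
(`exists_gradient_sup_bound`) then bounds the maximum S over [-h, h] × [ξ₀, ξ₁] of the partial
derivatives of the piece belonging to U: h S ≲ ‖∇φ‖ in L²(K ∩ U).

Extension (`IsJordanParam.exists_extension_bound`). Write the pieces as ∑ P_i(ξ) η^i and ∑ Q_i(ξ)
η^i. Continuity gives P_0 = Q_0 and the flux condition relates P_1 to Q_1. At η = 0, ∂_η^j ℒ of the
first piece is (j+2)! P_{j+2} plus terms in P_0, ..., P_{j+1} with bounded coefficients
(`IsJordanParam.exists_laplacian_expansion`). Hence the weak condition of order j, tested with the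
difference of the principal parts, controls the coefficient of order j+2 by those of lower order,
and induction on the order (`exists_coeffBound_extension`) gives all of them. Each coefficient
carries the power of h that it has in the gradient. The factors β^± are absorbed into the
coefficients, so no constant depends on them, and β|∇φ| ≲ β⁺ S on both sides.

Conclusion (`traceInequality_of_bounds`). Since ∂K has length at most 4h, the squared flux norm is ≲
(β⁺ S)² h, while the squared energy is ≳ β⁻ h² S². Their quotient is (β⁺)² / (β⁻ h). On an element
that does not meet Γ the same argument works in Cartesian coordinates, with a single polynomial and
no extension. -/

/-! ### Norm equivalences for univariate polynomials of bounded degree -/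

open Polynomial in
/-- The coefficients of a polynomial of bounded degree are controlled by its values on `[-1, 1]`. -/
theorem exists_coeff_bound (m : ℕ) : ∃ C : ℝ, 1 ≤ C ∧ ∀ q : ℝ[X], q.natDegree ≤ m → ∀ S : ℝ,
    (∀ y, |y| ≤ 1 → |q.eval y| ≤ S) → ∀ k, |q.coeff k| ≤ C * S := by
  -- Interpolation at m + 1 equispaced nodes in [0, 1) expresses each coefficient linearly in values
  -- of q on [-1, 1].
  let v : ℕ → ℝ := fun i => i / (m + 1)
  let s : Finset ℕ := Finset.range (m + 1)
  have hm : (0 : ℝ) < m + 1 := by positivity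
  have hv : Set.InjOn v s := by
    intro i _ j _ hij
    have : (i : ℝ) / (m + 1) = j / (m + 1) := hij
    rw [div_left_inj' hm.ne'] at this
    exact_mod_cast this
  let D : ℕ → ℝ := fun k => ∑ i ∈ s, |(Lagrange.basis s v i).coeff k|
  -- Summing over k makes the constant uniform in k; the 1 ensures 1 ≤ C, which later products of
  -- constants rely on.
  refine ⟨1 + ∑ k ∈ s, D k, ?_, ?_⟩
  · have : 0 ≤ ∑ k ∈ s, D k := Finset.sum_nonneg fun k _ => Finset.sum_nonneg fun i _ => abs_nonneg _
    linarith
  intro q hq S hS k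
  have hS0 : 0 ≤ S := (abs_nonneg _).trans (hS 0 (by simp))
  have hDk : ∀ k, 0 ≤ D k := fun k => Finset.sum_nonneg fun i _ => abs_nonneg _
  by_cases hk : k ∈ s
  · have hdeg : q.degree < s.card := by
      rw [Finset.card_range]
      exact (Polynomial.degree_le_natDegree).trans_lt (by exact_mod_cast Nat.lt_succ_of_le hq)
    have h1 := Lagrange.eq_interpolate hv hdeg
    rw [Lagrange.interpolate_apply] at h1
    have h2 : |q.coeff k| ≤ D k * S := by
      rw [h1, Polynomial.finsetSum_coeff, Finset.sum_mul]
      refine (Finset.abs_sum_le_sum_abs _ _).trans (Finset.sum_le_sum fun i hi => ?_)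
      rw [Polynomial.coeff_C_mul, abs_mul, mul_comm]
      refine mul_le_mul_of_nonneg_left (hS _ ?_) (abs_nonneg _)
      have hi' : (i : ℝ) < m + 1 := by exact_mod_cast Finset.mem_range.1 hi
      rw [abs_of_nonneg (by positivity)]
      exact (div_le_one hm).2 hi'.le
    refine h2.trans (mul_le_mul_of_nonneg_right ?_ hS0)
    have := Finset.single_le_sum (f := D) (fun k _ => hDk k) hk
    linarith
  · rw [Polynomial.coeff_eq_zero_of_natDegree_lt, abs_zero]
    · have : 0 ≤ ∑ k ∈ s, D k := Finset.sum_nonneg fun k _ => hDk k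
      positivity
    · simp only [s, Finset.mem_range] at hk
      omega

open Polynomial in
/-- Bound of the coefficients of a polynomial by its values on `[-ρ, ρ]`. -/
theorem exists_scaled_coeff_bound (m : ℕ) : ∃ C : ℝ, 1 ≤ C ∧ ∀ q : ℝ[X], q.natDegree ≤ m →
    ∀ ρ S : ℝ, 0 < ρ → (∀ y, |y| ≤ ρ → |q.eval y| ≤ S) → ∀ k, |q.coeff k| * ρ ^ k ≤ C * S := by
  obtain ⟨C, hC, H⟩ := exists_coeff_bound m
  refine ⟨C, hC, fun q hq ρ S hρ hS k => ?_⟩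
  have := H (q.comp (Polynomial.C ρ * X)) ?_ S ?_ k
  · rwa [Polynomial.comp_C_mul_X_coeff, abs_mul, abs_of_pos (pow_pos hρ k)] at this
  · refine natDegree_comp_le.trans ?_
    have : (Polynomial.C ρ * X).natDegree ≤ 1 := by simpa using natDegree_C_mul_X_pow_le ρ 1
    nlinarith
  · intro y hy
    simp only [eval_comp, eval_mul, eval_C, eval_X]
    refine hS _ ?_
    rw [abs_mul, abs_of_pos hρ]
    nlinarith

open Polynomial in
theorem abs_eval_le_of_coeff_le {m : ℕ} {q : ℝ[X]} (hq : q.natDegree ≤ m) {A M : ℝ}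
    (hM : 1 ≤ M) (hA : ∀ k, |q.coeff k| ≤ A) {y : ℝ} (hy : |y| ≤ M) :
    |q.eval y| ≤ (m + 1) * M ^ m * A := by
  have hA0 : 0 ≤ A := (abs_nonneg _).trans (hA 0)
  rw [Polynomial.eval_eq_sum_range' (Nat.lt_succ_of_le hq)]
  refine (Finset.abs_sum_le_sum_abs _ _).trans ?_
  have : ∀ i ∈ Finset.range (m + 1), |q.coeff i * y ^ i| ≤ M ^ m * A := by
    intro i hi
    rw [abs_mul, abs_pow, mul_comm]
    refine mul_le_mul ?_ (hA i) (abs_nonneg _) (by positivity)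
    exact (pow_le_pow_left₀ (abs_nonneg _) hy i).trans
      (pow_le_pow_right₀ hM (by have := Finset.mem_range.1 hi; omega))
  refine (Finset.sum_le_sum this).trans ?_
  simp [mul_assoc]

open Polynomial in
/-- Polynomials of bounded degree and their derivatives on an enlarged interval are controlled by
the values on the interval. -/
theorem exists_eval_bound (m : ℕ) {M : ℝ} (hM : 1 ≤ M) : ∃ C : ℝ, 1 ≤ C ∧ ∀ q : ℝ[X],
    q.natDegree ≤ m → ∀ x₀ ρ S : ℝ, 0 < ρ → (∀ y, |y - x₀| ≤ ρ → |q.eval y| ≤ S) →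
    ∀ x, |x - x₀| ≤ M * ρ → |q.eval x| ≤ C * S ∧ |q.derivative.eval x| ≤ C * S / ρ := by
  obtain ⟨C, hC, H⟩ := exists_coeff_bound m
  have hMm : 1 ≤ M ^ m := one_le_pow₀ hM
  have hm1 : (1 : ℝ) ≤ m + 1 := by simp
  have hDpos : 1 ≤ (m + 1) * M ^ m := one_le_mul_of_one_le_of_one_le hm1 hMm
  -- The factor (m + 1) M^m is the cost of evaluating at points of size at most M; (m + 1) C bounds
  -- the coefficients of the derivative, hence also those of the polynomial.
  refine ⟨(m + 1) * M ^ m * ((m + 1) * C), ?_, ?_⟩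
  · exact one_le_mul_of_one_le_of_one_le hDpos (one_le_mul_of_one_le_of_one_le hm1 hC)
  intro q hq x₀ ρ S hρ hS x hx
  have hS0 : 0 ≤ S := (abs_nonneg _).trans (hS x₀ (by simpa using hρ.le))
  -- Rescaling to the reference interval [-1, 1]; the chain rule factor ρ is the source of the 1/ρ
  -- in the derivative bound.
  set r : ℝ[X] := q.comp (Polynomial.C ρ * X + Polynomial.C x₀) with hr
  have hrdeg : r.natDegree ≤ m := by
    refine natDegree_comp_le.trans ?_
    have : (Polynomial.C ρ * X + Polynomial.C x₀).natDegree ≤ 1 := natDegree_linear_le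
    nlinarith
  have hrev : ∀ y, r.eval y = q.eval (ρ * y + x₀) := by intro y; simp [hr]
  have hrder : ∀ y, r.derivative.eval y = ρ * q.derivative.eval (ρ * y + x₀) := by
    intro y; simp [hr, derivative_comp]
  have hcoef := H r hrdeg S (by
    intro y hy
    rw [hrev]
    refine hS _ ?_
    rw [add_sub_cancel_right, abs_mul, abs_of_pos hρ]
    nlinarith)
  have hxy : ρ * ((x - x₀) / ρ) + x₀ = x := by field_simp; ring
  have hy : |(x - x₀) / ρ| ≤ M := by
    rw [abs_div, abs_of_pos hρ, div_le_iff₀ hρ]; exact hx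
  constructor
  · have := abs_eval_le_of_coeff_le hrdeg hM hcoef hy
    rw [hrev, hxy] at this
    refine this.trans ?_
    have h1 : C * S ≤ (m + 1) * C * S := by
      have : 0 ≤ C * S := by positivity
      nlinarith
    calc _ ≤ (m + 1) * M ^ m * ((m + 1) * C * S) := by gcongr
      _ = _ := by ring
  · have hdeg' : r.derivative.natDegree ≤ m := (natDegree_derivative_le r).trans (by omega)
    have hcoef' : ∀ k, |r.derivative.coeff k| ≤ (m + 1) * (C * S) := by
      intro k
      rw [coeff_derivative, abs_mul]
      by_cases hk : k ≤ m
      · have hk' : |((k : ℝ) + 1)| ≤ m + 1 := by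
          rw [abs_of_nonneg (by positivity)]
          have : (k : ℝ) ≤ m := by exact_mod_cast hk
          linarith
        rw [mul_comm]
        exact mul_le_mul hk' (hcoef _) (abs_nonneg _) (by positivity)
      · rw [coeff_eq_zero_of_natDegree_lt (by omega)]
        simp only [abs_zero, zero_mul]
        positivity
    have := abs_eval_le_of_coeff_le hdeg' hM hcoef' hy
    rw [hrder, hxy, abs_mul, abs_of_pos hρ] at this
    rw [le_div_iff₀ hρ, mul_comm]
    refine this.trans (le_of_eq ?_)
    ring

open Polynomial in
theorem abs_eval_sub_le {q : ℝ[X]} {x₀ ρ D : ℝ}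
    (hD : ∀ x, |x - x₀| ≤ ρ → |q.derivative.eval x| ≤ D) {x y : ℝ} (hx : |x - x₀| ≤ ρ)
    (hy : |y - x₀| ≤ ρ) : |q.eval x - q.eval y| ≤ D * |x - y| := by
  have hconv : Convex ℝ (Metric.closedBall x₀ ρ) := convex_closedBall x₀ ρ
  have := hconv.norm_image_sub_le_of_norm_deriv_le (f := fun x => q.eval x) (C := D)
    (fun z _ => q.differentiable z) (fun z hz => by
      rw [Polynomial.deriv]
      exact hD z (by simpa [Metric.mem_closedBall, Real.dist_eq] using hz))
    (x := y) (y := x) (by simpa [Metric.mem_closedBall, Real.dist_eq] using hy)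
    (by simpa [Metric.mem_closedBall, Real.dist_eq] using hx)
  simpa using this

open Polynomial in
/-- The mean square of a polynomial of bounded degree over an interval controls its maximum. -/
theorem exists_sq_le_integral (m : ℕ) : ∃ C : ℝ, 1 ≤ C ∧ ∀ q : ℝ[X], q.natDegree ≤ m →
    ∀ a b : ℝ, a < b → ∀ x ∈ Icc a b, q.eval x ^ 2 * (b - a) ≤ C * ∫ y in a..b, q.eval y ^ 2 := by
  obtain ⟨C, hC, H⟩ := exists_eval_bound m le_rfl
  -- The square of the polynomial is at least S²/4 on a subinterval of length ℓ/(4C), whence 16 C.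
  refine ⟨16 * C, by linarith, fun q hq a b hab => ?_⟩
  have hq_cont : Continuous fun x => q.eval x := q.continuous
  obtain ⟨z, hz, hmax⟩ := isCompact_Icc.exists_isMaxOn (nonempty_Icc.2 hab.le)
    (f := fun x => |q.eval x|) (hq_cont.abs.continuousOn)
  set S := |q.eval z| with hSdef
  have hS0 : 0 ≤ S := abs_nonneg _
  set ℓ := b - a with hℓ
  have hℓ0 : 0 < ℓ := sub_pos.2 hab
  have hmem : ∀ y, |y - (a + b) / 2| ≤ ℓ / 2 ↔ y ∈ Icc a b := by
    intro y
    rw [abs_le, mem_Icc]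
    constructor <;> rintro ⟨h1, h2⟩ <;> constructor <;> linarith
  have hder : ∀ x, |x - (a + b) / 2| ≤ ℓ / 2 → |q.derivative.eval x| ≤ C * S / (ℓ / 2) := by
    intro x hx
    refine (H q hq ((a + b) / 2) (ℓ / 2) S (by positivity) (fun y hy => ?_) x (by simpa using hx)).2
    exact hmax ((hmem y).1 hy)
  -- a subinterval of length `ℓ / (4 C)` around the maximum point on which `S / 2 ≤ |q|`
  obtain ⟨c, hac, hcb, hcz, hzc⟩ : ∃ c, a ≤ c ∧ c + ℓ / (4 * C) ≤ b ∧ c ≤ z ∧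
      z ≤ c + ℓ / (4 * C) := by
    have hd : ℓ / (4 * C) ≤ ℓ := div_le_self hℓ0.le (by linarith)
    have hd0 : 0 < ℓ / (4 * C) := by positivity
    rcases le_total (z + ℓ / (4 * C)) b with h | h
    · exact ⟨z, hz.1, h, le_rfl, by linarith⟩
    · exact ⟨b - ℓ / (4 * C), by linarith, by linarith, by linarith [hz.2], by linarith [hz.2]⟩
  set d := ℓ / (4 * C) with hd
  have hd0 : 0 < d := by positivity
  have hlow : ∀ y ∈ Icc c (c + d), S ^ 2 / 4 ≤ q.eval y ^ 2 := by
    intro y hy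
    have h1 := abs_eval_sub_le hder ((hmem z).2 hz)
      ((hmem y).2 ⟨hac.trans hy.1, hy.2.trans hcb⟩)
    have h2 : |z - y| ≤ d := by
      rw [abs_le]; constructor <;> linarith [hy.1, hy.2]
    have h3 : C * S / (ℓ / 2) * |z - y| ≤ S / 2 := by
      calc _ ≤ C * S / (ℓ / 2) * d := by gcongr
        _ = S / 2 := by rw [hd]; field_simp; ring
    have h4 : S - |q.eval y| ≤ |q.eval z - q.eval y| := abs_sub_abs_le_abs_sub _ _
    have h5 : S / 2 ≤ |q.eval y| := by linarith
    rw [← sq_abs (q.eval y)]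
    nlinarith
  have hinterior : S ^ 2 / 4 * d ≤ ∫ y in a..b, q.eval y ^ 2 := by
    have hcont2 : Continuous fun y => q.eval y ^ 2 := hq_cont.pow 2
    calc S ^ 2 / 4 * d = ∫ _ in c..(c + d), S ^ 2 / 4 := by
          rw [intervalIntegral.integral_const, add_sub_cancel_left, smul_eq_mul, mul_comm]
      _ ≤ ∫ y in c..(c + d), q.eval y ^ 2 := by
        refine intervalIntegral.integral_mono_on (by linarith) (by simp)
          (hcont2.intervalIntegrable _ _) hlow
      _ ≤ ∫ y in a..b, q.eval y ^ 2 :=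
        intervalIntegral.integral_mono_interval hac (by linarith) hcb
          (Eventually.of_forall fun y => sq_nonneg _) (hcont2.intervalIntegrable _ _)
  intro x hx
  have h1 : q.eval x ^ 2 ≤ S ^ 2 := by
    rw [← sq_abs (q.eval x)]
    exact pow_le_pow_left₀ (abs_nonneg _) (hmax hx) 2
  calc q.eval x ^ 2 * ℓ ≤ S ^ 2 * ℓ := by gcongr
    _ = 16 * C * (S ^ 2 / 4 * d) := by rw [hd]; field_simp; ring
    _ ≤ _ := by gcongr

/-! ### Tensor-product polynomials as polynomials in `η` with coefficients polynomial in `ξ` -/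

/-- The function `(η, ξ) ↦ ∑ᵢ Pᵢ(ξ) ηⁱ`, the sum running over `i ≤ m`. -/
def tens (m : ℕ) (P : ℕ → Polynomial ℝ) (η ξ : ℝ) : ℝ :=
  ∑ i ∈ Finset.range (m + 1), (P i).eval ξ * η ^ i

open Polynomial in
theorem tens_eq_eval_left (m : ℕ) (P : ℕ → ℝ[X]) (ξ : ℝ) : ∃ q : ℝ[X], q.natDegree ≤ m ∧
    (∀ η, tens m P η ξ = q.eval η) ∧ ∀ k ≤ m, q.coeff k = (P k).eval ξ := by
  refine ⟨∑ i ∈ Finset.range (m + 1), Polynomial.C ((P i).eval ξ) * X ^ i, ?_, ?_, ?_⟩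
  · refine natDegree_sum_le_of_forall_le _ _ fun i hi => (natDegree_C_mul_X_pow_le _ _).trans ?_
    have := Finset.mem_range.1 hi; omega
  · intro η; simp [tens, eval_finsetSum]
  · intro k hk
    simp [finsetSum_coeff, coeff_C_mul, coeff_X_pow]
    intro h; omega

open Polynomial in
theorem tens_eq_eval_right {m n : ℕ} {P : ℕ → ℝ[X]} (hP : ∀ i, (P i).natDegree ≤ n) (η : ℝ) :
    ∃ q : ℝ[X], q.natDegree ≤ n ∧ ∀ ξ, tens m P η ξ = q.eval ξ := by
  refine ⟨∑ i ∈ Finset.range (m + 1), Polynomial.C (η ^ i) * P i, ?_, ?_⟩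
  · exact natDegree_sum_le_of_forall_le _ _ fun i _ => (natDegree_C_mul_le _ _).trans (hP i)
  · intro ξ; simp [tens, eval_finsetSum, mul_comm]

theorem continuous_tens (m : ℕ) (P : ℕ → Polynomial ℝ) :
    Continuous fun z : ℝ × ℝ => tens m P z.1 z.2 := by
  unfold tens
  refine continuous_finsetSum _ fun i _ => ?_
  exact ((P i).continuous.comp continuous_snd).mul (continuous_fst.pow i)

/-- Tensor-product polynomials on an enlarged square are controlled by the values on the
square. -/
theorem exists_tens_bound (m : ℕ) {M : ℝ} (hM : 1 ≤ M) : ∃ C : ℝ, 1 ≤ C ∧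
    ∀ P : ℕ → Polynomial ℝ, (∀ i, (P i).natDegree ≤ m) → ∀ η₀ ξ₀ ρ S : ℝ, 0 < ρ →
    (∀ η ξ, |η - η₀| ≤ ρ → |ξ - ξ₀| ≤ ρ → |tens m P η ξ| ≤ S) →
    (∀ η ξ, |η - η₀| ≤ M * ρ → |ξ - ξ₀| ≤ M * ρ → |tens m P η ξ| ≤ C * S) ∧
    ∀ η ξ η' ξ', |η - η₀| ≤ M * ρ → |ξ - ξ₀| ≤ M * ρ → |η' - η₀| ≤ M * ρ → |ξ' - ξ₀| ≤ M * ρ →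
      |tens m P η ξ - tens m P η' ξ'| ≤ C * S / ρ * (|η - η'| + |ξ - ξ'|) := by
  obtain ⟨C, hC, H⟩ := exists_eval_bound m hM
  -- One factor `C` per variable: the square is enlarged in one variable, then in the other.
  refine ⟨C * C, one_le_mul_of_one_le_of_one_le hC hC, fun P hP η₀ ξ₀ ρ S hρ hS => ?_⟩
  have hS0 : 0 ≤ S := (abs_nonneg _).trans (hS η₀ ξ₀ (by simpa using hρ.le) (by simpa using hρ.le))
  have hρM : ∀ t, |t| ≤ ρ → |t| ≤ M * ρ := fun t ht => ht.trans (by nlinarith)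
  have hone : ∀ η ξ, |η - η₀| ≤ M * ρ → |ξ - ξ₀| ≤ ρ → |tens m P η ξ| ≤ C * S := by
    intro η ξ hη hξ
    obtain ⟨q, hq, hqe, -⟩ := tens_eq_eval_left m P ξ
    rw [hqe]
    exact (H q hq η₀ ρ S hρ (fun y hy => by rw [← hqe]; exact hS y ξ hy hξ) η hη).1
  have hone' : ∀ η ξ, |η - η₀| ≤ ρ → |ξ - ξ₀| ≤ M * ρ → |tens m P η ξ| ≤ C * S := by
    intro η ξ hη hξ
    obtain ⟨q, hq, hqe⟩ := tens_eq_eval_right hP η (m := m)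
    rw [hqe]
    exact (H q hq ξ₀ ρ S hρ (fun y hy => by rw [← hqe]; exact hS η y hη hy) ξ hξ).1
  constructor
  · intro η ξ hη hξ
    obtain ⟨q, hq, hqe⟩ := tens_eq_eval_right hP η (m := m)
    rw [hqe, mul_assoc]
    exact (H q hq ξ₀ ρ (C * S) hρ (fun y hy => by rw [← hqe]; exact hone η y hη hy) ξ hξ).1
  · intro η ξ η' ξ' hη hξ hη' hξ'
    have h1 : |tens m P η ξ - tens m P η' ξ| ≤ C * C * S / ρ * |η - η'| := by
      obtain ⟨q, hq, hqe, -⟩ := tens_eq_eval_left m P ξ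
      rw [hqe, hqe]
      refine abs_eval_sub_le (fun x hx => ?_) hη hη'
      rw [mul_assoc]
      exact (H q hq η₀ ρ (C * S) hρ (fun y hy => by rw [← hqe]; exact hone' y ξ hy hξ) x hx).2
    have h2 : |tens m P η' ξ - tens m P η' ξ'| ≤ C * C * S / ρ * |ξ - ξ'| := by
      obtain ⟨q, hq, hqe⟩ := tens_eq_eval_right hP η' (m := m)
      rw [hqe, hqe]
      refine abs_eval_sub_le (fun x hx => ?_) hξ hξ'
      rw [mul_assoc]
      exact (H q hq ξ₀ ρ (C * S) hρ (fun y hy => by rw [← hqe]; exact hone η' y hη' hy) x hx).2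
    calc _ ≤ _ := abs_sub_le _ (tens m P η' ξ) _
      _ ≤ _ := add_le_add h1 h2
      _ = _ := by ring

open Polynomial in
theorem IsTensorPoly.exists_eq_tens {m : ℕ} {p : ℝ → ℝ → ℝ} (hp : IsTensorPoly m p) :
    ∃ P : ℕ → ℝ[X], (∀ i, (P i).natDegree ≤ m) ∧ (∀ i, m < i → P i = 0) ∧
      ∀ η ξ, p η ξ = tens m P η ξ := by
  obtain ⟨c, hc⟩ := hp
  refine ⟨fun i => if h : i < m + 1 then ∑ j, Polynomial.C (c ⟨i, h⟩ j) * X ^ (j : ℕ) else 0,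
    fun i => ?_, fun i hi => dif_neg (by omega), fun η ξ => ?_⟩
  · dsimp only
    split_ifs with h
    · exact natDegree_sum_le_of_forall_le _ _ fun j _ =>
        (natDegree_C_mul_X_pow_le _ _).trans (by omega)
    · simp
  · rw [hc, tens, Finset.sum_range]
    refine Finset.sum_congr rfl fun i _ => ?_
    rw [dif_pos i.2, eval_finsetSum, Finset.sum_mul]
    refine Finset.sum_congr rfl fun j _ => ?_
    simp only [eval_mul, eval_C, eval_pow, eval_X]
    ring

/-- Coefficients of the `η`-derivative. -/
def etaCoeff (P : ℕ → Polynomial ℝ) (i : ℕ) : Polynomial ℝ := (i + 1 : ℝ) • P (i + 1)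

/-- Coefficients of the `ξ`-derivative. -/
def xiCoeff (P : ℕ → Polynomial ℝ) (i : ℕ) : Polynomial ℝ := (P i).derivative

theorem natDegree_etaCoeff_le {m : ℕ} {P : ℕ → Polynomial ℝ} (hP : ∀ i, (P i).natDegree ≤ m)
    (i : ℕ) : (etaCoeff P i).natDegree ≤ m :=
  (Polynomial.natDegree_smul_le _ _).trans (hP _)

theorem natDegree_xiCoeff_le {m : ℕ} {P : ℕ → Polynomial ℝ} (hP : ∀ i, (P i).natDegree ≤ m)
    (i : ℕ) : (xiCoeff P i).natDegree ≤ m :=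
  (Polynomial.natDegree_derivative_le _).trans ((Nat.sub_le _ _).trans (hP _))

/-- Differentiation shifts the coefficients down by one, so the top one is (m + 1) P_{m+1}; it
vanishes because families are taken to be zero beyond m. -/
theorem tens_etaCoeff {m : ℕ} {P : ℕ → Polynomial ℝ} (hP : ∀ i, m < i → P i = 0) (η ξ : ℝ) :
    tens m (etaCoeff P) η ξ = ∑ i ∈ Finset.range (m + 1), (P i).eval ξ * (i * η ^ (i - 1)) := by
  rw [tens, Finset.sum_range_succ, Finset.sum_range_succ']
  simp only [etaCoeff, hP (m + 1) (Nat.lt_succ_self m), smul_zero, Polynomial.eval_zero, zero_mul,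
    add_zero, Polynomial.eval_smul, smul_eq_mul, Nat.cast_zero, mul_zero]
  refine Finset.sum_congr rfl fun i _ => ?_
  rw [Nat.add_sub_cancel]
  push_cast
  ring

theorem hasFDerivAt_tens {m : ℕ} {P : ℕ → Polynomial ℝ} (hP : ∀ i, m < i → P i = 0)
    (z : ℝ × ℝ) : HasFDerivAt (fun z : ℝ × ℝ => tens m P z.1 z.2)
      (tens m (etaCoeff P) z.1 z.2 • ContinuousLinearMap.fst ℝ ℝ ℝ
        + tens m (xiCoeff P) z.1 z.2 • ContinuousLinearMap.snd ℝ ℝ ℝ) z := by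
  have h : ∀ i ∈ Finset.range (m + 1), HasFDerivAt
      (fun z : ℝ × ℝ => (P i).eval z.2 * z.1 ^ i)
      (((P i).eval z.2 * (i * z.1 ^ (i - 1))) • ContinuousLinearMap.fst ℝ ℝ ℝ
        + ((P i).derivative.eval z.2 * z.1 ^ i) • ContinuousLinearMap.snd ℝ ℝ ℝ) z := by
    intro i _
    have h1 := ((P i).hasDerivAt z.2).comp_hasFDerivAt z
      (hasFDerivAt_snd (𝕜 := ℝ) (E := ℝ) (F := ℝ) (p := z))
    have h2 := (hasDerivAt_pow i z.1).comp_hasFDerivAt z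
      (hasFDerivAt_fst (𝕜 := ℝ) (E := ℝ) (F := ℝ) (p := z))
    refine (h1.mul h2).congr_fderiv ?_
    simp only [Function.comp_apply, smul_smul]
    rw [mul_comm (z.1 ^ i)]
  refine (HasFDerivAt.fun_sum h).congr_fderiv ?_
  rw [tens_etaCoeff hP, Finset.sum_add_distrib, ← Finset.sum_smul, ← Finset.sum_smul]
  rfl

/-! ### Bounds for the curve and the Frenet transformation -/

theorem inner_plane (x y : Plane) : inner ℝ x y = x 0 * y 0 + x 1 * y 1 := by
  simp [PiLp.inner_apply, Fin.sum_univ_two, mul_comm]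

theorem norm_sq_plane (x : Plane) : ‖x‖ ^ 2 = x 0 ^ 2 + x 1 ^ 2 := by
  simp [EuclideanSpace.norm_sq_eq, Fin.sum_univ_two]

/-- `g` is a regular `C²` curve whose speed, inverse speed, curvature and second derivative are
bounded by `B`. -/
structure IsBoundedCurve (g : ℝ → Plane) (B : ℝ) : Prop where
  one_le : 1 ≤ B
  hasDerivAt : ∀ ξ, HasDerivAt g (deriv g ξ) ξ
  hasDerivAt_deriv : ∀ ξ, HasDerivAt (deriv g) (deriv (deriv g) ξ) ξ
  speed_ge : ∀ ξ, B⁻¹ ≤ ‖deriv g ξ‖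
  speed_le : ∀ ξ, ‖deriv g ξ‖ ≤ B
  curvature_le : ∀ ξ, |curvature g ξ| ≤ B
  second_le : ∀ ξ, ‖deriv (deriv g) ξ‖ ≤ B

theorem periodic_deriv {E : Type*} [NormedAddCommGroup E] [NormedSpace ℝ E] {f : ℝ → E} {T : ℝ}
    (hf : Function.Periodic f T) : Function.Periodic (deriv f) T := by
  intro x
  have : (fun y => f (y + T)) = f := funext hf
  rw [← deriv_comp_add_const f T x, this]

theorem exists_bound_of_periodic {E : Type*} [NormedAddCommGroup E] {f : ℝ → E} {T : ℝ}
    (hf : Function.Periodic f T) (hT : T ≠ 0) (hc : Continuous f) : ∃ C : ℝ, ∀ x, ‖f x‖ ≤ C := by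
  obtain ⟨C, hC⟩ := (hf.isBounded_of_continuous hT hc).exists_norm_le
  exact ⟨C, fun x => hC _ (mem_range_self x)⟩

theorem continuous_coord {f : ℝ → Plane} (hf : Continuous f) (j : Fin 2) :
    Continuous fun ξ => f ξ j := by
  fun_prop

theorem IsJordanParam.period_ne {m : ℕ} {ξs ξe : ℝ} {g : ℝ → Plane}
    (hg : IsJordanParam m ξs ξe g) : ξe - ξs ≠ 0 := (sub_pos.2 hg.lt).ne'

theorem IsJordanParam.contDiff_deriv {m : ℕ} {ξs ξe : ℝ} {g : ℝ → Plane}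
    (hg : IsJordanParam m ξs ξe g) : ContDiff ℝ (m : WithTop ℕ∞) (deriv g) := by
  have h := hg.contDiff
  push_cast at h
  exact (contDiff_succ_iff_deriv.1 h).2.2

theorem IsJordanParam.continuous_deriv_deriv {m : ℕ} (hm : 1 ≤ m) {ξs ξe : ℝ} {g : ℝ → Plane}
    (hg : IsJordanParam m ξs ξe g) : Continuous (deriv (deriv g)) := by
  have h : ContDiff ℝ 1 (deriv g) := hg.contDiff_deriv.of_le (by exact_mod_cast hm)
  exact h.continuous_deriv le_rfl

theorem IsJordanParam.periodic_curvature {m : ℕ} {ξs ξe : ℝ} {g : ℝ → Plane}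
    (hg : IsJordanParam m ξs ξe g) : Function.Periodic (curvature g) (ξe - ξs) := by
  intro ξ
  simp only [curvature, periodic_deriv hg.periodic ξ, periodic_deriv (periodic_deriv hg.periodic) ξ]

theorem IsJordanParam.continuous_curvature {m : ℕ} (hm : 1 ≤ m) {ξs ξe : ℝ} {g : ℝ → Plane}
    (hg : IsJordanParam m ξs ξe g) : Continuous (curvature g) := by
  have h1 := hg.contDiff_deriv.continuous
  have h2 := hg.continuous_deriv_deriv hm
  unfold curvature
  refine Continuous.div ?_ (h1.norm.pow 3) fun ξ => pow_ne_zero _ (norm_ne_zero_iff.2 (hg.regular ξ))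
  exact ((continuous_coord h1 0).mul (continuous_coord h2 1)).sub
    ((continuous_coord h1 1).mul (continuous_coord h2 0))

/-- A continuous periodic function is bounded, and m ≥ 1 makes `g` of class C². All geometric
constants below depend on the curve through `B` and the separation of its points only. -/
theorem IsJordanParam.exists_isBoundedCurve {m : ℕ} (hm : 1 ≤ m) {ξs ξe : ℝ} {g : ℝ → Plane}
    (hg : IsJordanParam m ξs ξe g) : ∃ B, IsBoundedCurve g B := by
  have h1 := hg.contDiff_deriv.continuous
  have h2 := hg.continuous_deriv_deriv hm
  have p1 := periodic_deriv hg.periodic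
  have p2 := periodic_deriv p1
  have hne : ∀ ξ, ‖deriv g ξ‖ ≠ 0 := fun ξ => norm_ne_zero_iff.2 (hg.regular ξ)
  obtain ⟨C₁, hC₁⟩ := exists_bound_of_periodic p1 hg.period_ne h1
  obtain ⟨C₂, hC₂⟩ := exists_bound_of_periodic p2 hg.period_ne h2
  obtain ⟨C₃, hC₃⟩ := exists_bound_of_periodic hg.periodic_curvature hg.period_ne
    (hg.continuous_curvature hm)
  obtain ⟨C₄, hC₄⟩ := exists_bound_of_periodic (f := fun ξ => ‖deriv g ξ‖⁻¹)
    (fun ξ => by simp only [p1 ξ]) hg.period_ne (h1.norm.inv₀ hne)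
  set B := max 1 (max (max C₁ C₂) (max C₃ C₄)) with hB
  have hB1 : 1 ≤ B := le_max_left _ _
  have e1 : C₁ ≤ B := (le_max_left _ _).trans ((le_max_left _ _).trans (le_max_right _ _))
  have e2 : C₂ ≤ B := (le_max_right _ _).trans ((le_max_left _ _).trans (le_max_right _ _))
  have e3 : C₃ ≤ B := (le_max_left _ _).trans ((le_max_right _ _).trans (le_max_right _ _))
  have e4 : C₄ ≤ B := (le_max_right _ _).trans ((le_max_right _ _).trans (le_max_right _ _))
  refine ⟨B, hB1, fun ξ => ?_, fun ξ => ?_, fun ξ => ?_, fun ξ => (hC₁ ξ).trans e1,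
    fun ξ => (hC₃ ξ).trans e3, fun ξ => (hC₂ ξ).trans e2⟩
  · exact ((hg.contDiff.differentiable (by simp)) ξ).hasDerivAt
  · refine ((hg.contDiff_deriv.differentiable ?_) ξ).hasDerivAt
    exact_mod_cast (by omega : m ≠ 0)
  · have := (hC₄ ξ).trans e4
    rw [norm_inv, norm_norm] at this
    exact inv_le_of_inv_le₀ (lt_of_le_of_ne (norm_nonneg _) (hne ξ).symm) this

namespace IsBoundedCurve

variable {g : ℝ → Plane} {B : ℝ}

theorem pos (hB : IsBoundedCurve g B) : 0 < B := zero_lt_one.trans_le hB.one_le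

theorem speed_pos (hB : IsBoundedCurve g B) (ξ : ℝ) : 0 < ‖deriv g ξ‖ :=
  (inv_pos.2 hB.pos).trans_le (hB.speed_ge ξ)

theorem deriv_eq (hB : IsBoundedCurve g B) (ξ : ℝ) : deriv g ξ = ‖deriv g ξ‖ • tangent g ξ := by
  rw [tangent, smul_smul, mul_inv_cancel₀ (hB.speed_pos ξ).ne', one_smul]

theorem norm_tangent (hB : IsBoundedCurve g B) (ξ : ℝ) : ‖tangent g ξ‖ = 1 := by
  rw [tangent, norm_smul, norm_inv, norm_norm, inv_mul_cancel₀ (hB.speed_pos ξ).ne']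

theorem tangent_sq (hB : IsBoundedCurve g B) (ξ : ℝ) :
    tangent g ξ 0 ^ 2 + tangent g ξ 1 ^ 2 = 1 := by
  rw [← norm_sq_plane, hB.norm_tangent, one_pow]

theorem norm_normal (hB : IsBoundedCurve g B) (ξ : ℝ) : ‖normal g ξ‖ = 1 := by
  have h : ‖normal g ξ‖ ^ 2 = 1 := by
    rw [norm_sq_plane]
    simp only [normal, PiLp.toLp_apply, Matrix.cons_val_zero, Matrix.cons_val_one,
      Matrix.cons_val_fin_one]
    linarith [hB.tangent_sq ξ]
  exact (pow_eq_one_iff_of_nonneg (norm_nonneg _) two_ne_zero).1 h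

theorem inner_normal_tangent (ξ : ℝ) : inner ℝ (normal g ξ) (tangent g ξ) = 0 := by
  rw [inner_plane]
  simp only [normal, PiLp.toLp_apply, Matrix.cons_val_zero, Matrix.cons_val_one,
    Matrix.cons_val_fin_one]
  ring

theorem inner_tangent_normal (ξ : ℝ) : inner ℝ (tangent g ξ) (normal g ξ) = 0 := by
  rw [real_inner_comm, inner_normal_tangent]

theorem inner_normal_self (hB : IsBoundedCurve g B) (ξ : ℝ) :
    inner ℝ (normal g ξ) (normal g ξ) = 1 := by
  rw [real_inner_self_eq_norm_sq, hB.norm_normal, one_pow]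

theorem inner_tangent_self (hB : IsBoundedCurve g B) (ξ : ℝ) :
    inner ℝ (tangent g ξ) (tangent g ξ) = 1 := by
  rw [real_inner_self_eq_norm_sq, hB.norm_tangent, one_pow]

theorem frame_expansion (hB : IsBoundedCurve g B) (ξ : ℝ) (v : Plane) :
    inner ℝ (normal g ξ) v • normal g ξ + inner ℝ (tangent g ξ) v • tangent g ξ = v := by
  have h := hB.tangent_sq ξ
  rw [inner_plane, inner_plane]
  ext j
  fin_cases j
  · simp [normal]
    linear_combination v 0 * h
  · simp [normal]
    linear_combination v 1 * h

/-- Frenet formula: n is a rotation of τ and turns in the tangent direction only. This gives ∂_ξ P =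
(1 + ηκ) g', orthogonal to ∂_η P = n. -/
theorem hasDerivAt_normal (hB : IsBoundedCurve g B) (ξ : ℝ) :
    HasDerivAt (normal g) (curvature g ξ • deriv g ξ) ξ := by
  have hc : ∀ j : Fin 2, HasDerivAt (fun t => deriv g t j) (deriv (deriv g) ξ j) ξ := fun j =>
    ((EuclideanSpace.proj (𝕜 := ℝ) j).hasFDerivAt.comp_hasDerivAt ξ (hB.hasDerivAt_deriv ξ))
  have hN : (fun t => ‖deriv g t‖) = fun t => √(deriv g t 0 ^ 2 + deriv g t 1 ^ 2) := by
    funext t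
    rw [← norm_sq_plane, Real.sqrt_sq (norm_nonneg _)]
  have hNpos := hB.speed_pos ξ
  have hsq := norm_sq_plane (deriv g ξ)
  have hNd : HasDerivAt (fun t => ‖deriv g t‖)
      ((deriv g ξ 0 * deriv (deriv g) ξ 0 + deriv g ξ 1 * deriv (deriv g) ξ 1) / ‖deriv g ξ‖) ξ := by
    have := (((hc 0).pow 2).add ((hc 1).pow 2)).sqrt (by
      simp only [Pi.add_apply, Pi.pow_apply]
      rw [← hsq]; positivity)
    rw [hN]
    refine (this.congr_deriv ?_)
    simp only [Pi.add_apply, Pi.pow_apply]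
    rw [← hsq, Real.sqrt_sq hNpos.le]
    field_simp
    ring
  have hq : ∀ j : Fin 2, HasDerivAt (fun t => tangent g t j)
      ((deriv (deriv g) ξ j * ‖deriv g ξ‖ - deriv g ξ j *
        ((deriv g ξ 0 * deriv (deriv g) ξ 0 + deriv g ξ 1 * deriv (deriv g) ξ 1) / ‖deriv g ξ‖))
        / ‖deriv g ξ‖ ^ 2) ξ := by
    intro j
    have := (hc j).div hNd hNpos.ne'
    refine this.congr_of_eventuallyEq (Eventually.of_forall fun t => ?_)
    simp [tangent, div_eq_inv_mul]
  have key := ((hq 1).smul_const (EuclideanSpace.single 0 1 : Plane)).add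
    ((hq 0).neg.smul_const (EuclideanSpace.single 1 1 : Plane))
  have heq : normal g = fun t => tangent g t 1 • (EuclideanSpace.single 0 1 : Plane)
      + (-tangent g t 0) • (EuclideanSpace.single 1 1 : Plane) := by
    funext t
    ext j
    fin_cases j <;> simp [normal]
  rw [heq]
  refine key.congr_deriv ?_
  ext j
  fin_cases j
  · simp [curvature]
    field_simp
    rw [hsq]
    ring
  · simp [curvature]
    field_simp
    rw [hsq]
    ring

theorem norm_image_sub_le {E : Type*} [NormedAddCommGroup E] [NormedSpace ℝ E] {f f' : ℝ → E}
    {C : ℝ} (hf : ∀ ξ, HasDerivAt f (f' ξ) ξ) (hC : ∀ ξ, ‖f' ξ‖ ≤ C) (x y : ℝ) :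
    ‖f x - f y‖ ≤ C * |x - y| :=
  convex_univ.norm_image_sub_le_of_norm_hasDerivWithin_le
    (fun ξ _ => (hf ξ).hasDerivWithinAt) (fun ξ _ => hC ξ) (mem_univ y) (mem_univ x)

theorem curve_sub_le (hB : IsBoundedCurve g B) (ξ ξ' : ℝ) : ‖g ξ - g ξ'‖ ≤ B * |ξ - ξ'| :=
  norm_image_sub_le hB.hasDerivAt hB.speed_le ξ ξ'

theorem deriv_sub_le (hB : IsBoundedCurve g B) (ξ ξ' : ℝ) :
    ‖deriv g ξ - deriv g ξ'‖ ≤ B * |ξ - ξ'| :=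
  norm_image_sub_le hB.hasDerivAt_deriv hB.second_le ξ ξ'

theorem normal_sub_le (hB : IsBoundedCurve g B) (ξ ξ' : ℝ) :
    ‖normal g ξ - normal g ξ'‖ ≤ B ^ 2 * |ξ - ξ'| := by
  refine norm_image_sub_le hB.hasDerivAt_normal (fun ξ => ?_) ξ ξ'
  rw [norm_smul, sq]
  exact mul_le_mul (hB.curvature_le ξ) (hB.speed_le ξ) (norm_nonneg _) hB.pos.le

theorem curve_taylor (hB : IsBoundedCurve g B) (ξ ξ' : ℝ) :
    ‖g ξ' - g ξ - (ξ' - ξ) • deriv g ξ‖ ≤ B * |ξ' - ξ| * |ξ' - ξ| := by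
  have h := (convex_closedBall ξ |ξ' - ξ|).norm_image_sub_le_of_norm_hasDerivWithin_le
    (f := fun t => g t - (t - ξ) • deriv g ξ) (f' := fun t => deriv g t - deriv g ξ)
    (C := B * |ξ' - ξ|) (x := ξ) (y := ξ') (fun t _ => ?_) (fun t ht => ?_) ?_ ?_
  · simpa [sub_sub, add_comm] using h
  · have h1 := (((hasDerivAt_id t).sub_const ξ).smul_const (deriv g ξ))
    rw [one_smul] at h1
    exact ((hB.hasDerivAt t).sub h1).hasDerivWithinAt
  · refine (hB.deriv_sub_le t ξ).trans ?_
    have : |t - ξ| ≤ |ξ' - ξ| := by simpa [Real.dist_eq] using ht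
    exact mul_le_mul_of_nonneg_left this hB.pos.le
  · simp
  · simp [Real.dist_eq]

/-- The Frenet transformation is injective at a scale depending only on the bounds of the curve. -/
theorem frenetMap_injective_local (hB : IsBoundedCurve g B) {η ξ η' ξ' : ℝ}
    (hξ : |ξ' - ξ| ≤ 1 / (4 * B ^ 3)) (hη : |η'| ≤ 1 / (4 * B ^ 3))
    (h : frenetMap g η ξ = frenetMap g η' ξ') : η = η' ∧ ξ = ξ' := by
  have hBpos := hB.pos
  have hξξ : ξ = ξ' := by
    by_contra hne
    have hpos : 0 < |ξ' - ξ| := abs_pos.2 (sub_ne_zero.2 (Ne.symm hne))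
    set d := |ξ' - ξ| with hd
    have e1 : g ξ' - g ξ = η • normal g ξ - η' • normal g ξ' := by
      have : g ξ + η • normal g ξ = g ξ' + η' • normal g ξ' := h
      rw [sub_eq_sub_iff_add_eq_add, ← this, add_comm]
    -- Projecting on the tangent at ξ removes η n(ξ), so no smallness of η is needed; n(ξ) may be
    -- subtracted from n(ξ') for the same reason.
    have e2 : inner ℝ (tangent g ξ) (g ξ' - g ξ)
        = -(η' * inner ℝ (tangent g ξ) (normal g ξ' - normal g ξ)) := by
      rw [e1, inner_sub_right, inner_sub_right, inner_smul_right, inner_smul_right,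
        inner_tangent_normal]
      ring
    have e3 : |inner ℝ (tangent g ξ) (g ξ' - g ξ)| ≤ 1 / (4 * B ^ 3) * (B ^ 2 * d) := by
      rw [e2, abs_neg, abs_mul]
      refine mul_le_mul hη ?_ (abs_nonneg _) (by positivity)
      refine (abs_real_inner_le_norm _ _).trans ?_
      rw [hB.norm_tangent, one_mul]
      exact hB.normal_sub_le ξ' ξ
    have e4 : inner ℝ (tangent g ξ) (g ξ' - g ξ) = (ξ' - ξ) * ‖deriv g ξ‖
        + inner ℝ (tangent g ξ) (g ξ' - g ξ - (ξ' - ξ) • deriv g ξ) := by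
      have : inner ℝ (tangent g ξ) (deriv g ξ) = ‖deriv g ξ‖ := by
        conv_lhs => rw [hB.deriv_eq]
        rw [inner_smul_right, hB.inner_tangent_self, mul_one]
      rw [inner_sub_right (tangent g ξ) (g ξ' - g ξ), inner_smul_right, this]
      ring
    have e5 : |inner ℝ (tangent g ξ) (g ξ' - g ξ - (ξ' - ξ) • deriv g ξ)| ≤ B * d * d := by
      refine (abs_real_inner_le_norm _ _).trans ?_
      rw [hB.norm_tangent, one_mul]
      exact hB.curve_taylor ξ ξ'
    have e6 : d * B⁻¹ ≤ |(ξ' - ξ) * ‖deriv g ξ‖| := by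
      rw [abs_mul, abs_norm]
      exact mul_le_mul_of_nonneg_left (hB.speed_ge ξ) (abs_nonneg _)
    have e7 : |(ξ' - ξ) * ‖deriv g ξ‖| ≤ 1 / (4 * B ^ 3) * (B ^ 2 * d) + B * d * d := by
      have : (ξ' - ξ) * ‖deriv g ξ‖ = inner ℝ (tangent g ξ) (g ξ' - g ξ)
        - inner ℝ (tangent g ξ) (g ξ' - g ξ - (ξ' - ξ) • deriv g ξ) := by rw [e4]; ring
      rw [this]
      exact (abs_sub _ _).trans (add_le_add e3 e5)
    have e8 : B * d * d ≤ B ^ 2 * d * (1 / (4 * B ^ 3)) := by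
      refine mul_le_mul ?_ hξ hpos.le (by positivity)
      have := hB.one_le
      nlinarith [mul_pos hBpos hpos]
    -- Each of the two terms equals d/(4B), so a displacement of size at least d/B along the tangent
    -- would be at most half of d/B.
    have e9 : d * B⁻¹ ≤ d * B⁻¹ * (1 / 2) := by
      calc d * B⁻¹ ≤ 1 / (4 * B ^ 3) * (B ^ 2 * d) + B ^ 2 * d * (1 / (4 * B ^ 3)) := by linarith
        _ = d * B⁻¹ * (1 / 2) := by field_simp; norm_num
    have : 0 < d * B⁻¹ := by positivity
    linarith
  subst hξξ
  refine ⟨?_, rfl⟩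
  have h1 : η • normal g ξ = η' • normal g ξ := add_left_cancel (a := g ξ) h
  have hn : normal g ξ ≠ 0 := by
    rw [← norm_ne_zero_iff, hB.norm_normal]; exact one_ne_zero
  exact smul_left_injective ℝ hn h1

theorem frenetMap_sub_le (hB : IsBoundedCurve g B) {η ξ η' ξ' : ℝ} (hη' : |η'| ≤ 1) :
    ‖frenetMap g η ξ - frenetMap g η' ξ'‖ ≤ |η - η'| + 2 * B ^ 2 * |ξ - ξ'| := by
  have e : frenetMap g η ξ - frenetMap g η' ξ' =
      (η - η') • normal g ξ + ((g ξ - g ξ') + η' • (normal g ξ - normal g ξ')) := by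
    simp only [frenetMap, sub_smul, smul_sub]
    abel
  have h1 : ‖(η - η') • normal g ξ‖ = |η - η'| := by
    rw [norm_smul, hB.norm_normal, mul_one, Real.norm_eq_abs]
  have h2 : ‖η' • (normal g ξ - normal g ξ')‖ ≤ B ^ 2 * |ξ - ξ'| := by
    rw [norm_smul, Real.norm_eq_abs]
    refine (mul_le_mul hη' (hB.normal_sub_le ξ ξ') (norm_nonneg _) zero_le_one).trans (by rw [one_mul])
  have h3 : ‖g ξ - g ξ'‖ ≤ B ^ 2 * |ξ - ξ'| :=
    (hB.curve_sub_le ξ ξ').trans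
      (mul_le_mul_of_nonneg_right (by nlinarith [hB.one_le]) (abs_nonneg _))
  rw [e]
  refine (norm_add_le _ _).trans ?_
  refine (add_le_add_right (norm_add_le _ _) _).trans ?_
  linarith

theorem continuous_normal (hB : IsBoundedCurve g B) : Continuous (normal g) :=
  continuous_iff_continuousAt.2 fun ξ => (hB.hasDerivAt_normal ξ).continuousAt

theorem continuous_curve (hB : IsBoundedCurve g B) : Continuous g :=
  continuous_iff_continuousAt.2 fun ξ => (hB.hasDerivAt ξ).continuousAt

theorem continuous_deriv (hB : IsBoundedCurve g B) : Continuous (deriv g) :=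
  continuous_iff_continuousAt.2 fun ξ => (hB.hasDerivAt_deriv ξ).continuousAt

theorem continuous_tangent (hB : IsBoundedCurve g B) : Continuous (tangent g) :=
  (hB.continuous_deriv.norm.inv₀ fun ξ => (hB.speed_pos ξ).ne').smul hB.continuous_deriv

theorem continuous_frenetMap (hB : IsBoundedCurve g B) :
    Continuous fun z : ℝ × ℝ => frenetMap g z.1 z.2 :=
  (hB.continuous_curve.comp continuous_snd).add
    (continuous_fst.smul (hB.continuous_normal.comp continuous_snd))

/-- The threshold 1/(2B) keeps 1 + ηκ in [1/2, 3/2], which bounds the Jacobian from both sides. -/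
theorem abs_eta_curvature_le (hB : IsBoundedCurve g B) {η : ℝ} (hη : |η| ≤ 1 / (2 * B)) (ξ : ℝ) :
    |η * curvature g ξ| ≤ 1 / 2 := by
  have := hB.pos
  rw [abs_mul]
  calc _ ≤ 1 / (2 * B) * B := mul_le_mul hη (hB.curvature_le ξ) (abs_nonneg _) (by positivity)
    _ = 1 / 2 := by field_simp

theorem frenetJac_ge (hB : IsBoundedCurve g B) {η : ℝ} (hη : |η| ≤ 1 / (2 * B)) (ξ : ℝ) :
    (2 * B)⁻¹ ≤ frenetJac g η ξ := by
  have h := abs_le.1 (hB.abs_eta_curvature_le hη ξ)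
  rw [frenetJac, mul_inv, mul_comm]
  exact mul_le_mul (hB.speed_ge ξ) (by linarith [h.1]) (by norm_num) (norm_nonneg _)

theorem frenetJac_le (hB : IsBoundedCurve g B) {η : ℝ} (hη : |η| ≤ 1 / (2 * B)) (ξ : ℝ) :
    frenetJac g η ξ ≤ 2 * B := by
  have h := abs_le.1 (hB.abs_eta_curvature_le hη ξ)
  rw [frenetJac, mul_comm]
  exact mul_le_mul (by linarith [h.2]) (hB.speed_le ξ) (norm_nonneg _) (by norm_num)

theorem frenetJac_pos (hB : IsBoundedCurve g B) {η : ℝ} (hη : |η| ≤ 1 / (2 * B)) (ξ : ℝ) :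
    0 < frenetJac g η ξ :=
  (inv_pos.2 (mul_pos two_pos hB.pos)).trans_le (hB.frenetJac_ge hη ξ)

end IsBoundedCurve

/-! ### Differentiability and Lipschitz continuity of the inverse Frenet map -/

/-- The derivative of the Frenet transformation. -/
def frenetDeriv (g : ℝ → Plane) (η ξ : ℝ) : ℝ × ℝ →L[ℝ] Plane :=
  (ContinuousLinearMap.fst ℝ ℝ ℝ).smulRight (normal g ξ)
    + (ContinuousLinearMap.snd ℝ ℝ ℝ).smulRight (frenetJac g η ξ • tangent g ξ)

/-- The inverse of the derivative of the Frenet transformation. -/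
def frenetDerivInv (g : ℝ → Plane) (η ξ : ℝ) : Plane →L[ℝ] ℝ × ℝ :=
  (innerSL ℝ (normal g ξ)).prod ((frenetJac g η ξ)⁻¹ • innerSL ℝ (tangent g ξ))

namespace IsBoundedCurve

variable {g : ℝ → Plane} {B : ℝ}

theorem hasFDerivAt_frenetMap (hB : IsBoundedCurve g B) (z : ℝ × ℝ) :
    HasFDerivAt (fun z : ℝ × ℝ => frenetMap g z.1 z.2) (frenetDeriv g z.1 z.2) z := by
  have h1 := (hB.hasDerivAt z.2).hasFDerivAt.comp z
    (hasFDerivAt_snd (𝕜 := ℝ) (E := ℝ) (F := ℝ) (p := z))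
  have h2 := (hB.hasDerivAt_normal z.2).hasFDerivAt.comp z
    (hasFDerivAt_snd (𝕜 := ℝ) (E := ℝ) (F := ℝ) (p := z))
  have h3 := (hasFDerivAt_fst (𝕜 := ℝ) (E := ℝ) (F := ℝ) (p := z)).smul h2
  refine (h1.add h3).congr_fderiv ?_
  refine ContinuousLinearMap.ext fun v => ?_
  have e : frenetJac g z.1 z.2 • tangent g z.2 = (1 + z.1 * curvature g z.2) • deriv g z.2 := by
    conv_rhs => rw [hB.deriv_eq]
    rw [smul_smul, frenetJac, mul_comm]
  simp only [frenetDeriv, e, add_apply, ContinuousLinearMap.smulRight_apply,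
    smul_apply, ContinuousLinearMap.coe_fst', ContinuousLinearMap.coe_snd',
    Function.comp_apply, ContinuousLinearMap.comp_apply,
    ContinuousLinearMap.toSpanSingleton_apply]
  module

/-- The derivative of the Frenet transformation as an equivalence. -/
def frenetEquiv (hB : IsBoundedCurve g B) (η ξ : ℝ) (hJ : frenetJac g η ξ ≠ 0) :
    (ℝ × ℝ) ≃L[ℝ] Plane :=
  ContinuousLinearEquiv.equivOfInverse (frenetDeriv g η ξ) (frenetDerivInv g η ξ)
    (by
      intro v
      ext
      · simp [frenetDeriv, frenetDerivInv, inner_add_right, inner_smul_right,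
          hB.norm_normal, inner_normal_tangent]
      · simp [frenetDeriv, frenetDerivInv, inner_add_right, inner_smul_right,
          hB.norm_tangent, inner_tangent_normal]
        field_simp)
    (by
      intro v
      conv_rhs => rw [← hB.frame_expansion ξ v]
      simp only [frenetDeriv, frenetDerivInv, add_apply,
        ContinuousLinearMap.smulRight_apply, ContinuousLinearMap.coe_fst',
        ContinuousLinearMap.coe_snd', ContinuousLinearMap.prod_apply, innerSL_apply_apply,
        smul_apply, smul_eq_mul, smul_smul]
      congr 2
      field_simp)

theorem norm_frenetDerivInv_le (hB : IsBoundedCurve g B) {η : ℝ} (hη : |η| ≤ 1 / (2 * B)) (ξ : ℝ) :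
    ‖frenetDerivInv g η ξ‖ ≤ 2 * B := by
  have hBpos := hB.pos
  refine ContinuousLinearMap.opNorm_le_bound _ (by positivity) fun v => ?_
  rw [frenetDerivInv, ContinuousLinearMap.prod_apply, Prod.norm_def]
  have hJ := hB.frenetJac_pos hη ξ
  refine max_le ?_ ?_
  · rw [innerSL_apply_apply]
    refine (norm_inner_le_norm _ _).trans ?_
    rw [hB.norm_normal]
    nlinarith [norm_nonneg v, hB.one_le]
  · rw [smul_apply, norm_smul, innerSL_apply_apply]
    refine mul_le_mul ?_ ?_ (norm_nonneg _) (by positivity)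
    · rw [norm_inv, Real.norm_eq_abs, abs_of_pos hJ]
      exact inv_le_of_inv_le₀ (by positivity) (hB.frenetJac_ge hη ξ)
    · refine (norm_inner_le_norm _ _).trans ?_
      rw [hB.norm_tangent, one_mul]

variable {h : ℝ} {K : Set Plane} {R : Plane → ℝ × ℝ}

/-- The map R is continuous and P ∘ R is the identity near x; as the derivative of P at R(x) is
invertible, R is differentiable there with the inverse derivative. -/
theorem hasFDerivAt_inverse (hB : IsBoundedCurve g B) (hR : IsFrenetInverse g h K R)
    (hh : h ≤ 1 / (2 * B)) {x : Plane} (hx : x ∈ interior K) :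
    HasFDerivAt R (frenetDerivInv g (R x).1 (R x).2) x := by
  have hK : K ∈ 𝓝 x := mem_interior_iff_mem_nhds.1 hx
  have hJ := (hB.frenetJac_pos ((hR.abs_le x (interior_subset hx)).trans hh) (R x).2).ne'
  exact HasFDerivAt.of_local_left_inverse (f' := hB.frenetEquiv _ _ hJ)
    (hR.continuousOn.continuousAt hK) (hB.hasFDerivAt_frenetMap (R x))
    (Filter.mem_of_superset hK fun y hy => hR.right_inv y hy)

/-- Mean value inequality on the convex interior, where the derivative of R has norm at most 2B;
continuity of R carries the bound to the closure. -/
theorem inverse_sub_le (hB : IsBoundedCurve g B) (hR : IsFrenetInverse g h K R)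
    (hh : h ≤ 1 / (2 * B)) (hK : Convex ℝ K) (hcl : closure (interior K) = K) {x y : Plane}
    (hx : x ∈ K) (hy : y ∈ K) : ‖R x - R y‖ ≤ 2 * B * ‖x - y‖ := by
  have hBpos := hB.pos
  have h1 : LipschitzOnWith (Real.toNNReal (2 * B)) R (interior K) := by
    refine hK.interior.lipschitzOnWith_of_nnnorm_hasFDerivWithin_le
      (f' := fun x => frenetDerivInv g (R x).1 (R x).2)
      (fun z hz => (hB.hasFDerivAt_inverse hR hh hz).hasFDerivWithinAt) fun z hz => ?_
    rw [← NNReal.coe_le_coe, coe_nnnorm, Real.coe_toNNReal _ (by positivity)]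
    exact hB.norm_frenetDerivInv_le ((hR.abs_le z (interior_subset hz)).trans hh) _
  have h2 := h1.closure (by rw [hcl]; exact hR.continuousOn)
  rw [hcl] at h2
  have := h2.dist_le_mul x hx y hy
  rwa [Real.coe_toNNReal _ (by positivity), dist_eq_norm, dist_eq_norm] at this

/-- The gradient, in Cartesian coordinates, of a function with partial derivatives `a` and `b` in
Frenet coordinates. -/
theorem hasGradientAt_comp_inverse (hB : IsBoundedCurve g B) (hR : IsFrenetInverse g h K R)
    (hh : h ≤ 1 / (2 * B)) {x : Plane} (hx : x ∈ interior K) {φ : Plane → ℝ}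
    {p : ℝ × ℝ → ℝ} {a b : ℝ} (hp : HasFDerivAt p (a • ContinuousLinearMap.fst ℝ ℝ ℝ
      + b • ContinuousLinearMap.snd ℝ ℝ ℝ) (R x)) (hφ : φ =ᶠ[𝓝 x] fun y => p (R y)) :
    HasGradientAt φ (a • normal g (R x).2
      + (b * (frenetJac g (R x).1 (R x).2)⁻¹) • tangent g (R x).2) x := by
  rw [hasGradientAt_iff_hasFDerivAt]
  refine ((hp.comp x (hB.hasFDerivAt_inverse hR hh hx)).congr_fderiv ?_).congr_of_eventuallyEq hφ
  refine ContinuousLinearMap.ext fun v => ?_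
  simp [frenetDerivInv]
  ring

end IsBoundedCurve

/-! ### Quantitative injectivity of the curve -/

/-- Points of the curve that are close to each other have close parameters, up to a multiple of
the period. -/
theorem IsJordanParam.exists_separation {m : ℕ} {ξs ξe : ℝ} {g : ℝ → Plane}
    (hg : IsJordanParam m ξs ξe g) {δ : ℝ} (hδ : 0 < δ) : ∃ c > 0, ∀ ξ ξ', ‖g ξ - g ξ'‖ < c →
      ∃ ζ, g ζ = g ξ' ∧ |ζ - ξ| < δ := by
  set T := ξe - ξs with hT
  have hT0 : 0 < T := sub_pos.2 hg.lt
  have hcont : Continuous g := hg.contDiff.continuous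
  -- Pairs in one closed period whose parameters stay δ apart even modulo the period. Two points of
  -- one period can be close modulo T only through a shift by 0, T or -T.
  let A : Set (ℝ × ℝ) := (Icc ξs ξe ×ˢ Icc ξs ξe) ∩
    {z | δ ≤ |z.2 - z.1| ∧ δ ≤ |z.2 + T - z.1| ∧ δ ≤ |z.2 - T - z.1|}
  have hA : IsCompact A := by
    refine (isCompact_Icc.prod isCompact_Icc).inter_right ?_
    simp only [ofPred_and]
    exact (isClosed_le (by fun_prop) (by fun_prop)).inter
      ((isClosed_le (by fun_prop) (by fun_prop)).inter (isClosed_le (by fun_prop) (by fun_prop)))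
  have hper : ∀ ξ, ∃ ζ ∈ Ico ξs ξe, ∃ k : ℤ, ξ = ζ + k * T := by
    intro ξ
    refine ⟨toIcoMod hT0 ξs ξ, ?_, toIcoDiv hT0 ξs ξ, ?_⟩
    · have := toIcoMod_mem_Ico hT0 ξs ξ
      rwa [show ξs + T = ξe by rw [hT]; ring] at this
    · have := toIcoMod_add_toIcoDiv_zsmul hT0 ξs ξ
      rw [zsmul_eq_mul] at this
      exact this.symm
  have hkT : ∀ (ζ : ℝ) (k : ℤ), g (ζ + k * T) = g ζ := fun ζ k => by
    exact hg.periodic.int_mul k ζ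
  have hne : ∀ z ∈ A, 0 < ‖g z.1 - g z.2‖ := by
    rintro ⟨u, v⟩ ⟨⟨hu, hv⟩, h0, h1, h2⟩
    dsimp only at hu hv h0 h1 h2 ⊢
    rw [norm_pos_iff, sub_ne_zero]
    intro heq
    have hend : g ξe = g ξs := by
      have := hg.periodic ξs
      rwa [add_sub_cancel] at this
    -- Injectivity is available on the half-open period only: an endpoint ξe is replaced by ξs, and
    -- the shifts excluded in `A` rule out the coincidence.
    rcases hu.2.lt_or_eq with hu' | hu' <;> rcases hv.2.lt_or_eq with hv' | hv'
    · have := hg.injOn ⟨hu.1, hu'⟩ ⟨hv.1, hv'⟩ heq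
      rw [this, sub_self, abs_zero] at h0
      linarith
    · rw [hv', hend] at heq
      have := hg.injOn ⟨hu.1, hu'⟩ ⟨le_rfl, hg.lt⟩ heq
      rw [this, hv', hT, show ξe - (ξe - ξs) - ξs = 0 by ring, abs_zero] at h2
      linarith
    · rw [hu', hend] at heq
      have := hg.injOn ⟨le_rfl, hg.lt⟩ ⟨hv.1, hv'⟩ heq
      rw [← this, hu', hT, show ξs + (ξe - ξs) - ξe = 0 by ring, abs_zero] at h1
      linarith
    · rw [hu', hv', sub_self, abs_zero] at h0
      linarith
  obtain ⟨c, hc, hcA⟩ : ∃ c > 0, ∀ z ∈ A, c ≤ ‖g z.1 - g z.2‖ := by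
    -- For large δ no such pair exists and any constant works.
    rcases A.eq_empty_or_nonempty with hemp | hAne
    · exact ⟨1, one_pos, by simp [hemp]⟩
    · obtain ⟨z, hz, hmin⟩ := hA.exists_isMinOn hAne
        (f := fun z : ℝ × ℝ => ‖g z.1 - g z.2‖) (by fun_prop)
      exact ⟨_, hne z hz, fun w hw => hmin hw⟩
  refine ⟨c, hc, fun ξ ξ' hlt => ?_⟩
  obtain ⟨u, hu, k, rfl⟩ := hper ξ
  obtain ⟨v, hv, l, rfl⟩ := hper ξ'
  rw [hkT, hkT] at hlt
  have hnot : (u, v) ∉ A := fun hmem => (hcA _ hmem).not_gt hlt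
  have : |v - u| < δ ∨ |v + T - u| < δ ∨ |v - T - u| < δ := by
    by_contra hcon
    push Not at hcon
    exact hnot ⟨⟨Ico_subset_Icc_self hu, Ico_subset_Icc_self hv⟩, hcon⟩
  rcases this with h | h | h
  · exact ⟨v + k * T, by rw [hkT, hkT], by convert h using 2; ring⟩
  · refine ⟨v + ((k + 1 : ℤ) : ℝ) * T, by rw [hkT, hkT], by convert h using 2; push_cast; ring⟩
  · refine ⟨v + ((k - 1 : ℤ) : ℝ) * T, by rw [hkT, hkT], by convert h using 2; push_cast; ring⟩

/-! ### The Taylor coefficients of the Frenet Laplacian at the interface -/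

/-- The Taylor coefficients at `0` of the powers of `η ↦ (1 + η k)⁻¹`. -/
theorem exists_iteratedDeriv_inv_pow : ∃ c : ℕ → ℕ → ℝ, ∀ (n i : ℕ) (k : ℝ),
    iteratedDeriv i (fun η : ℝ => ((1 + η * k)⁻¹) ^ n) 0 = c n i * k ^ i := by
  suffices h : ∀ i, ∃ c : ℕ → ℝ, ∀ (n : ℕ) (k : ℝ),
      iteratedDeriv i (fun η : ℝ => ((1 + η * k)⁻¹) ^ n) 0 = c n * k ^ i by
    choose c hc using h
    exact ⟨fun n i => c i n, fun n i k => hc i n k⟩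
  intro i
  induction i with
  | zero => exact ⟨fun _ => 1, fun n k => by simp⟩
  | succ i ih =>
    obtain ⟨c, hc⟩ := ih
    -- The derivative of (1 + ηk)^{-n} is -nk (1 + ηk)^{-(n+1)}; the exponent grows, so the
    -- induction treats all n together.
    refine ⟨fun n => -n * c (n + 1), fun n k => ?_⟩
    rw [iteratedDeriv_succ']
    have hev : deriv (fun η : ℝ => ((1 + η * k)⁻¹) ^ n) =ᶠ[𝓝 0]
        fun η => (-n * k) * ((1 + η * k)⁻¹) ^ (n + 1) := by
      have hne : ∀ᶠ η : ℝ in 𝓝 0, 1 + η * k ≠ 0 := by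
        refine ContinuousAt.eventually_ne (by fun_prop) (by simp)
      filter_upwards [hne] with η hη
      have h1 : HasDerivAt (fun η : ℝ => 1 + η * k) k η := by
        simpa using ((hasDerivAt_id η).mul_const k).const_add 1
      have h2 := (h1.fun_inv hη).fun_pow n
      rw [h2.deriv]
      rcases n with _ | n
      · simp
      · rw [Nat.add_sub_cancel, div_eq_mul_inv, ← inv_pow]
        push_cast
        ring
    rw [hev.iteratedDeriv_eq, iteratedDeriv_const_mul_field, hc]
    ring

theorem contDiff_tens (n : ℕ) (W : ℕ → Polynomial ℝ) (ξ : ℝ) {r : WithTop ℕ∞} :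
    ContDiff ℝ r (fun η => tens n W η ξ) := by
  unfold tens
  exact ContDiff.sum fun i _ => contDiff_const.mul (contDiff_id.pow i)

theorem hasDerivAt_tens_left {m : ℕ} {P : ℕ → Polynomial ℝ} (hP : ∀ i, m < i → P i = 0)
    (η ξ : ℝ) : HasDerivAt (fun e => tens m P e ξ) (tens m (etaCoeff P) η ξ) η := by
  have h := (hasFDerivAt_tens hP (η, ξ)).comp_hasDerivAt η
    ((hasDerivAt_id η).prodMk (hasDerivAt_const η ξ))
  exact h.congr_deriv (by simp)

theorem hasDerivAt_tens_right {m : ℕ} {P : ℕ → Polynomial ℝ} (hP : ∀ i, m < i → P i = 0)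
    (η ξ : ℝ) : HasDerivAt (fun x => tens m P η x) (tens m (xiCoeff P) η ξ) ξ := by
  have h := (hasFDerivAt_tens hP (η, ξ)).comp_hasDerivAt ξ
    ((hasDerivAt_const ξ η).prodMk (hasDerivAt_id ξ))
  exact h.congr_deriv (by simp)

theorem etaCoeff_eq_zero {m : ℕ} {P : ℕ → Polynomial ℝ} (hP : ∀ i, m < i → P i = 0) :
    ∀ i, m < i → etaCoeff P i = 0 := fun i hi => by
  rw [etaCoeff, hP (i + 1) (by omega), smul_zero]

theorem xiCoeff_eq_zero {m : ℕ} {P : ℕ → Polynomial ℝ} (hP : ∀ i, m < i → P i = 0) :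
    ∀ i, m < i → xiCoeff P i = 0 := fun i hi => by
  rw [xiCoeff, hP i hi, Polynomial.derivative_zero]

theorem deriv_tens_left {m : ℕ} {P : ℕ → Polynomial ℝ} (hP : ∀ i, m < i → P i = 0) (ξ : ℝ) :
    deriv (fun e => tens m P e ξ) = fun η => tens m (etaCoeff P) η ξ :=
  funext fun η => (hasDerivAt_tens_left hP η ξ).deriv

theorem iteratedDeriv_tens_left {m : ℕ} {P : ℕ → Polynomial ℝ} (hP : ∀ i, m < i → P i = 0)
    (l : ℕ) (ξ : ℝ) : iteratedDeriv l (fun e => tens m P e ξ) 0 = l.factorial * (P l).eval ξ := by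
  induction l generalizing P with
  | zero =>
    simp only [iteratedDeriv_zero, tens, Nat.factorial_zero, Nat.cast_one, one_mul]
    rw [Finset.sum_range_succ']
    simp
  | succ l ih =>
    rw [iteratedDeriv_succ', deriv_tens_left hP, ih (etaCoeff_eq_zero hP), etaCoeff,
      Nat.factorial_succ]
    simp only [Polynomial.eval_smul, smul_eq_mul]
    push_cast
    ring

/-- Coefficients of `η` times a polynomial. -/
def shiftCoeff (P : ℕ → Polynomial ℝ) : ℕ → Polynomial ℝ
  | 0 => 0
  | i + 1 => P i

theorem tens_shiftCoeff (m : ℕ) (P : ℕ → Polynomial ℝ) (η ξ : ℝ) :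
    tens (m + 1) (shiftCoeff P) η ξ = η * tens m P η ξ := by
  rw [tens, Finset.sum_range_succ', tens, Finset.mul_sum]
  simp only [shiftCoeff, Polynomial.eval_zero, zero_mul, add_zero]
  exact Finset.sum_congr rfl fun i _ => by ring

theorem shiftCoeff_eq_zero {m : ℕ} {P : ℕ → Polynomial ℝ} (hP : ∀ i, m < i → P i = 0) :
    ∀ i, m + 1 < i → shiftCoeff P i = 0 := fun i hi => by
  obtain ⟨i, rfl⟩ : ∃ k, i = k + 1 := ⟨i - 1, by omega⟩
  exact hP i (by omega)

theorem contDiffAt_inv_pow (k : ℝ) (n : ℕ) {r : WithTop ℕ∞} :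
    ContDiffAt ℝ r (fun η : ℝ => ((1 + η * k)⁻¹) ^ n) 0 := by
  refine ContDiffAt.pow (ContDiffAt.inv ?_ (by simp)) n
  exact contDiffAt_const.add (contDiffAt_id.mul contDiffAt_const)

theorem iteratedDeriv_tens_mul_inv_pow {c : ℕ → ℕ → ℝ} (hc : ∀ (n i : ℕ) (k : ℝ),
    iteratedDeriv i (fun η : ℝ => ((1 + η * k)⁻¹) ^ n) 0 = c n i * k ^ i)
    {m : ℕ} {P : ℕ → Polynomial ℝ} (hP : ∀ i, m < i → P i = 0) (j n : ℕ) (k ξ : ℝ) :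
    iteratedDeriv j (fun η => tens m P η ξ * ((1 + η * k)⁻¹) ^ n) 0 =
      ∑ l ∈ Finset.range (j + 1),
        (j.choose l * l.factorial * (c n (j - l) * k ^ (j - l))) * (P l).eval ξ := by
  rw [iteratedDeriv_fun_mul (contDiff_tens m P ξ).contDiffAt (contDiffAt_inv_pow k n)]
  refine Finset.sum_congr rfl fun l _ => ?_
  rw [iteratedDeriv_tens_left hP, hc]
  ring

/-- The part of order at most `j + 1` in `η` of the `j`-th Taylor coefficient of the Laplacian, for
given coefficient functions. -/
def lowerPart (a b c : ℕ → ℕ → ℝ → ℝ) (P : ℕ → Polynomial ℝ) (j : ℕ) (ξ : ℝ) : ℝ :=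
  ∑ l ∈ Finset.range (j + 1), (a j l ξ * (P (l + 1)).eval ξ
    + b j l ξ * (P l).derivative.derivative.eval ξ + c j l ξ * (P l).derivative.eval ξ)

/-- With s = ‖g'‖ and u = 1 + ηκ one has J = s u and J_ξ = s' u + s η κ', so J⁻³ J_ξ = s⁻³ s' u⁻² +
s⁻² κ' η u⁻³. Thus every term is a function of ξ times a tensor polynomial times a power of u⁻¹,
which the Leibniz rule in η can handle; the explicit η goes into `shiftCoeff`. -/
theorem frenetLaplacian_tens {g : ℝ → Plane} {m : ℕ} {P : ℕ → Polynomial ℝ}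
    (hP : ∀ i, m < i → P i = 0) {η ξ s' κ' : ℝ} (hs0 : ‖deriv g ξ‖ ≠ 0)
    (hs : HasDerivAt (fun x => ‖deriv g x‖) s' ξ) (hκ : HasDerivAt (curvature g) κ' ξ)
    (hη : 1 + η * curvature g ξ ≠ 0) :
    frenetLaplacian g (tens m P) η ξ = tens m (etaCoeff (etaCoeff P)) η ξ
      + curvature g ξ * (tens m (etaCoeff P) η ξ * ((1 + η * curvature g ξ)⁻¹) ^ 1)
      + (‖deriv g ξ‖⁻¹ ^ 2) * (tens m (xiCoeff (xiCoeff P)) η ξ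
          * ((1 + η * curvature g ξ)⁻¹) ^ 2)
      + (-(‖deriv g ξ‖⁻¹ ^ 3 * s')) * (tens m (xiCoeff P) η ξ * ((1 + η * curvature g ξ)⁻¹) ^ 2)
      + (-(‖deriv g ξ‖⁻¹ ^ 2 * κ')) * (tens (m + 1) (shiftCoeff (xiCoeff P)) η ξ
          * ((1 + η * curvature g ξ)⁻¹) ^ 3) := by
  have hJ : HasDerivAt (fun x => frenetJac g η x)
      (s' * (1 + η * curvature g ξ) + ‖deriv g ξ‖ * (η * κ')) ξ := by
    exact hs.mul ((hκ.const_mul η).const_add 1)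
  have hJ0 : frenetJac g η ξ ≠ 0 := mul_ne_zero hs0 hη
  have hx : (fun x => (frenetJac g η x)⁻¹ * deriv (fun y => tens m P η y) x)
      = fun x => (frenetJac g η x)⁻¹ * tens m (xiCoeff P) η x :=
    funext fun x => by rw [(hasDerivAt_tens_right hP η x).deriv]
  rw [frenetLaplacian, hx, iteratedDeriv_succ, iteratedDeriv_one, deriv_tens_left hP,
    deriv_tens_left (etaCoeff_eq_zero hP),
    ((hJ.fun_inv hJ0).fun_mul (hasDerivAt_tens_right (xiCoeff_eq_zero hP) η ξ)).deriv,
    tens_shiftCoeff]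
  dsimp only
  rw [frenetJac] at *
  generalize tens m (etaCoeff (etaCoeff P)) η ξ = A₁
  generalize tens m (etaCoeff P) η ξ = A₂
  generalize tens m (xiCoeff (xiCoeff P)) η ξ = A₃
  generalize tens m (xiCoeff P) η ξ = A₄
  generalize ‖deriv g ξ‖ = s at *
  generalize curvature g ξ = k at *
  generalize 1 + η * k = u at *
  field_simp
  ring

/-- The `j`-th Taylor coefficient in `η` at the interface of the Frenet Laplacian of a polynomial:
its principal part is `(j + 2)! P_{j + 2}`, the coefficients of its lower order part are continuous
and bounded. -/
theorem IsJordanParam.exists_laplacian_expansion {m : ℕ} (hm : 2 ≤ m) {ξs ξe : ℝ} {g : ℝ → Plane}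
    (hg : IsJordanParam m ξs ξe g) : ∃ a b c : ℕ → ℕ → ℝ → ℝ,
    (∀ j l, Continuous (a j l) ∧ Continuous (b j l) ∧ Continuous (c j l)) ∧
    (∃ A : ℝ, 0 ≤ A ∧ ∀ j ≤ m, ∀ l ≤ m, ∀ ξ, |a j l ξ| ≤ A ∧ |b j l ξ| ≤ A ∧ |c j l ξ| ≤ A) ∧
    ∀ P : ℕ → Polynomial ℝ, (∀ i, m < i → P i = 0) → ∀ j ξ,
      iteratedDeriv j (fun η => frenetLaplacian g (tens m P) η ξ) 0 =
        (j + 2).factorial * (P (j + 2)).eval ξ + lowerPart a b c P j ξ := by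
  obtain ⟨d, hd⟩ := exists_iteratedDeriv_inv_pow
  have hreg : ∀ ξ, ‖deriv g ξ‖ ≠ 0 := fun ξ => norm_ne_zero_iff.2 (hg.regular ξ)
  -- Since κ' occurs in the Laplacian, g must be C³: this is where 2 ≤ m enters.
  have hgd : ContDiff ℝ 2 (deriv g) := hg.contDiff_deriv.of_le (by exact_mod_cast hm)
  have hgdd : ContDiff ℝ 1 (deriv (deriv g)) := by
    have : ContDiff ℝ (1 + 1) (deriv g) := by simpa [one_add_one_eq_two] using hgd
    exact (contDiff_succ_iff_deriv.1 this).2.2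
  have hsC : ContDiff ℝ 1 fun x => ‖deriv g x‖ :=
    (hgd.of_le (by norm_num)).norm ℝ hg.regular
  have hcoord : ∀ (f : ℝ → Plane), ContDiff ℝ 1 f → ∀ j : Fin 2, ContDiff ℝ 1 fun x => f x j :=
    fun f hf j => (EuclideanSpace.proj (𝕜 := ℝ) j).contDiff.comp hf
  have hκC : ContDiff ℝ 1 (curvature g) := by
    have h1 := hgd.of_le (m := 1) (by norm_num)
    unfold curvature
    refine ContDiff.div ?_ (hsC.pow 3) fun ξ => pow_ne_zero 3 (hreg ξ)
    exact ((hcoord _ h1 0).mul (hcoord _ hgdd 1)).sub ((hcoord _ h1 1).mul (hcoord _ hgdd 0))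
  set s : ℝ → ℝ := fun x => ‖deriv g x‖ with hs
  set κ : ℝ → ℝ := curvature g with hκ
  have cs : Continuous s := hsC.continuous
  have csi : Continuous fun ξ => (s ξ)⁻¹ := cs.inv₀ hreg
  have cs' : Continuous (deriv s) := hsC.continuous_deriv le_rfl
  have cκ : Continuous κ := hκC.continuous
  have cκ' : Continuous (deriv κ) := hκC.continuous_deriv le_rfl
  have ps : Function.Periodic s (ξe - ξs) := fun x => by
    simp only [hs, periodic_deriv hg.periodic x]
  have ps' := periodic_deriv ps
  have pκ : Function.Periodic κ (ξe - ξs) := hg.periodic_curvature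
  have pκ' := periodic_deriv pκ
  -- Leibniz coefficients: `a` comes from the p_η term, `b` from p_ξξ, and `c` from the two p_ξ
  -- terms, the second one with index l + 1 because of its extra factor η.
  let a : ℕ → ℕ → ℝ → ℝ := fun j l ξ =>
    κ ξ * ((j.choose l * l.factorial * (d 1 (j - l) * κ ξ ^ (j - l))) * (l + 1))
  let b : ℕ → ℕ → ℝ → ℝ := fun j l ξ =>
    (s ξ)⁻¹ ^ 2 * (j.choose l * l.factorial * (d 2 (j - l) * κ ξ ^ (j - l)))
  let c : ℕ → ℕ → ℝ → ℝ := fun j l ξ =>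
    -((s ξ)⁻¹ ^ 3 * deriv s ξ) * (j.choose l * l.factorial * (d 2 (j - l) * κ ξ ^ (j - l)))
      + -((s ξ)⁻¹ ^ 2 * deriv κ ξ) * (j.choose (l + 1) * (l + 1).factorial *
        (d 3 (j - (l + 1)) * κ ξ ^ (j - (l + 1))))
  have hcont : ∀ j l, Continuous (a j l) ∧ Continuous (b j l) ∧ Continuous (c j l) := by
    intro j l
    refine ⟨?_, ?_, ?_⟩
    · exact cκ.mul ((continuous_const.mul (continuous_const.mul (cκ.pow _))).mul continuous_const)
    · exact (csi.pow 2).mul (continuous_const.mul (continuous_const.mul (cκ.pow _)))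
    · exact (((csi.pow 3).mul cs').neg.mul
        (continuous_const.mul (continuous_const.mul (cκ.pow _)))).add
        (((csi.pow 2).mul cκ').neg.mul
        (continuous_const.mul (continuous_const.mul (cκ.pow _))))
  refine ⟨a, b, c, hcont, ?_, ?_⟩
  · have hbd : ∀ j l, ∃ A : ℝ, ∀ ξ, |a j l ξ| ≤ A ∧ |b j l ξ| ≤ A ∧ |c j l ξ| ≤ A := by
      intro j l
      obtain ⟨A₁, h₁⟩ := exists_bound_of_periodic (f := a j l) (T := ξe - ξs)
        (fun ξ => by simp only [a, pκ ξ]) hg.period_ne (hcont j l).1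
      obtain ⟨A₂, h₂⟩ := exists_bound_of_periodic (f := b j l) (T := ξe - ξs)
        (fun ξ => by simp only [b, pκ ξ, ps ξ]) hg.period_ne (hcont j l).2.1
      obtain ⟨A₃, h₃⟩ := exists_bound_of_periodic (f := c j l) (T := ξe - ξs)
        (fun ξ => by simp only [c, pκ ξ, ps ξ, pκ' ξ, ps' ξ]) hg.period_ne (hcont j l).2.2
      exact ⟨max A₁ (max A₂ A₃), fun ξ => ⟨(h₁ ξ).trans (le_max_left _ _),
        (h₂ ξ).trans ((le_max_left _ _).trans (le_max_right _ _)),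
        (h₃ ξ).trans ((le_max_right _ _).trans (le_max_right _ _))⟩⟩
    choose A hA using hbd
    have hA0 : ∀ j l, 0 ≤ A j l := fun j l => (abs_nonneg _).trans (hA j l 0).1
    refine ⟨∑ j ∈ Finset.range (m + 1), ∑ l ∈ Finset.range (m + 1), A j l,
      Finset.sum_nonneg fun j _ => Finset.sum_nonneg fun l _ => hA0 j l, fun j hj l hl ξ => ?_⟩
    have hle : A j l ≤ ∑ j ∈ Finset.range (m + 1), ∑ l ∈ Finset.range (m + 1), A j l :=
      (Finset.single_le_sum (f := fun l => A j l) (fun l _ => hA0 j l)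
        (Finset.mem_range.2 (by omega : l < m + 1))).trans
      (Finset.single_le_sum (f := fun j => ∑ l ∈ Finset.range (m + 1), A j l)
        (fun j _ => Finset.sum_nonneg fun l _ => hA0 j l)
        (Finset.mem_range.2 (by omega : j < m + 1)))
    exact ⟨(hA j l ξ).1.trans hle, (hA j l ξ).2.1.trans hle, (hA j l ξ).2.2.trans hle⟩
  · intro P hP j ξ
    have hev : (fun η => frenetLaplacian g (tens m P) η ξ) =ᶠ[𝓝 0] fun η =>
        tens m (etaCoeff (etaCoeff P)) η ξ
        + κ ξ * (tens m (etaCoeff P) η ξ * ((1 + η * κ ξ)⁻¹) ^ 1)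
        + ((s ξ)⁻¹ ^ 2) * (tens m (xiCoeff (xiCoeff P)) η ξ * ((1 + η * κ ξ)⁻¹) ^ 2)
        + (-((s ξ)⁻¹ ^ 3 * deriv s ξ)) * (tens m (xiCoeff P) η ξ * ((1 + η * κ ξ)⁻¹) ^ 2)
        + (-((s ξ)⁻¹ ^ 2 * deriv κ ξ)) * (tens (m + 1) (shiftCoeff (xiCoeff P)) η ξ
            * ((1 + η * κ ξ)⁻¹) ^ 3) := by
      have hne : ∀ᶠ η : ℝ in 𝓝 0, 1 + η * κ ξ ≠ 0 :=
        ContinuousAt.eventually_ne (by fun_prop) (by simp)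
      filter_upwards [hne] with η hη
      exact frenetLaplacian_tens hP (hreg ξ) ((hsC.differentiable (by norm_num)) ξ).hasDerivAt
        ((hκC.differentiable (by norm_num)) ξ).hasDerivAt hη
    have hsm : ∀ (n r : ℕ) (W : ℕ → Polynomial ℝ) (e : ℝ), ContDiffAt ℝ (j : WithTop ℕ∞)
        (fun η => e * (tens n W η ξ * ((1 + η * κ ξ)⁻¹) ^ r)) 0 := fun n r W e =>
      contDiffAt_const.mul ((contDiff_tens n W ξ).contDiffAt.mul (contDiffAt_inv_pow (κ ξ) r))
    have s1 : ContDiffAt ℝ (j : WithTop ℕ∞) (fun η => tens m (etaCoeff (etaCoeff P)) η ξ) 0 :=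
      (contDiff_tens m _ ξ).contDiffAt
    have s2 := s1.add (hsm m 1 (etaCoeff P) (κ ξ))
    have s3 := s2.add (hsm m 2 (xiCoeff (xiCoeff P)) ((s ξ)⁻¹ ^ 2))
    have s4 := s3.add (hsm m 2 (xiCoeff P) (-((s ξ)⁻¹ ^ 3 * deriv s ξ)))
    rw [hev.iteratedDeriv_eq, iteratedDeriv_fun_add s4 (hsm _ _ _ _),
      iteratedDeriv_fun_add s3 (hsm _ _ _ _), iteratedDeriv_fun_add s2 (hsm _ _ _ _),
      iteratedDeriv_fun_add s1 (hsm _ _ _ _)]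
    simp only [iteratedDeriv_const_mul_field]
    have hη := etaCoeff_eq_zero hP
    have hξ := xiCoeff_eq_zero hP
    rw [iteratedDeriv_tens_left (etaCoeff_eq_zero hη),
      iteratedDeriv_tens_mul_inv_pow hd hη, iteratedDeriv_tens_mul_inv_pow hd (xiCoeff_eq_zero hξ),
      iteratedDeriv_tens_mul_inv_pow hd hξ,
      iteratedDeriv_tens_mul_inv_pow hd (shiftCoeff_eq_zero hξ)]
    -- Reindexing is exact: the term l = 0 on the left vanishes by the shift, and the last term on
    -- the right has the binomial coefficient of j over j + 1, which is 0.
    have hshift : ∑ l ∈ Finset.range (j + 1), (j.choose l * l.factorial *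
        (d 3 (j - l) * κ ξ ^ (j - l))) * (shiftCoeff (xiCoeff P) l).eval ξ
        = ∑ l ∈ Finset.range (j + 1), (j.choose (l + 1) * (l + 1).factorial *
          (d 3 (j - (l + 1)) * κ ξ ^ (j - (l + 1)))) * (P l).derivative.eval ξ := by
      rw [Finset.sum_range_succ', Finset.sum_range_succ]
      simp [shiftCoeff, xiCoeff]
    rw [hshift, lowerPart, Nat.factorial_succ, Nat.factorial_succ]
    simp only [Finset.sum_add_distrib, Finset.mul_sum, a, b, c, etaCoeff, xiCoeff, add_mul,
      Polynomial.eval_smul, smul_eq_mul]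
    push_cast
    have e1 : ∀ x₁ x₂ x₃ x₄ x₅ y₁ y₂ y₃ y₄ : ℝ, x₁ = y₁ → x₂ = y₂ → x₃ = y₃ → x₄ + x₅ = y₄ →
        x₁ + x₂ + x₃ + x₄ + x₅ = y₁ + (y₂ + y₃ + y₄) := by
      intro x₁ x₂ x₃ x₄ x₅ y₁ y₂ y₃ y₄ h1 h2 h3 h4
      rw [← h1, ← h2, ← h3, ← h4]; ring
    refine e1 _ _ _ _ _ _ _ _ _ ?_ ?_ ?_ ?_
    · ring
    · exact Finset.sum_congr rfl fun l _ => by ring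
    · exact Finset.sum_congr rfl fun l _ => by ring
    · refine congrArg₂ (· + ·) ?_ ?_ <;> exact Finset.sum_congr rfl fun l _ => by ring

/-! ### Stability of the extension across the interface -/

/-- Scaled bounds for the coefficients of `∑ᵢ Pᵢ(ξ) ηⁱ` that amount to a bound of its gradient on
`[-h, h] × [x, y]`, up to order `n`. -/
def CoeffBound (P : ℕ → Polynomial ℝ) (n : ℕ) (h x y X : ℝ) : Prop :=
  (∀ ξ ∈ Icc x y, |(P 0).derivative.eval ξ| ≤ X) ∧
    ∀ k < n, ∀ ξ ∈ Icc x y, |(P (k + 1)).eval ξ| * h ^ k ≤ X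

theorem CoeffBound.mono {P : ℕ → Polynomial ℝ} {n n' : ℕ} {h x y X X' : ℝ}
    (H : CoeffBound P n h x y X) (hn : n' ≤ n) (hX : X ≤ X') : CoeffBound P n' h x y X' :=
  ⟨fun ξ hξ => (H.1 ξ hξ).trans hX, fun k hk ξ hξ => (H.2 k (hk.trans_le hn) ξ hξ).trans hX⟩

theorem CoeffBound.nonneg {P : ℕ → Polynomial ℝ} {n : ℕ} {h x y X : ℝ}
    (H : CoeffBound P n h x y X) (hxy : x ≤ y) : 0 ≤ X :=
  (abs_nonneg _).trans (H.1 x ⟨le_rfl, hxy⟩)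

/-- Inverse inequality on intervals whose length is comparable to `h`. -/
theorem exists_inverse_inequality (m : ℕ) {c₀ : ℝ} (hc₀ : 0 < c₀) : ∃ D : ℝ, 1 ≤ D ∧
    ∀ q : Polynomial ℝ, q.natDegree ≤ m → ∀ h x y Y : ℝ, 0 < h → c₀ * h ≤ y - x →
    (∀ ξ ∈ Icc x y, |q.eval ξ| ≤ Y) → ∀ ξ ∈ Icc x y, |q.derivative.eval ξ| * h ≤ D * Y := by
  obtain ⟨C, hC, H⟩ := exists_eval_bound m le_rfl
  refine ⟨1 + C * (2 / c₀), by linarith [show 0 < C * (2 / c₀) by positivity],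
    fun q hq h x y Y hh hxy hY ξ hξ => ?_⟩
  have hlen : 0 < y - x := (mul_pos hc₀ hh).trans_le hxy
  have hY0 : 0 ≤ Y := (abs_nonneg _).trans (hY ξ hξ)
  have hmem : ∀ z, |z - (x + y) / 2| ≤ (y - x) / 2 ↔ z ∈ Icc x y := by
    intro z
    rw [abs_le, mem_Icc]
    constructor <;> rintro ⟨h1, h2⟩ <;> constructor <;> linarith
  have h1 := (H q hq ((x + y) / 2) ((y - x) / 2) Y (by linarith)
    (fun z hz => hY z ((hmem z).1 hz)) ξ (by rw [one_mul]; exact (hmem ξ).2 hξ)).2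
  calc |q.derivative.eval ξ| * h ≤ C * Y / ((y - x) / 2) * h := by gcongr
    _ ≤ C * Y / ((c₀ * h) / 2) * h := by gcongr
    _ = C * (2 / c₀) * Y := by field_simp
    _ ≤ _ := by nlinarith

/-- For l ≥ 1 the bound on P_l carries the weight h^{l-1}, and the inverse inequality trades one
more h for a derivative. For l = 0 the derivative is bounded directly; P_0 itself is never
controlled, as only gradients matter. -/
theorem CoeffBound.derivative_le {m : ℕ} {D h x y X : ℝ} (hD : 1 ≤ D)
    (hinv : ∀ q : Polynomial ℝ, q.natDegree ≤ m → ∀ Y : ℝ,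
      (∀ ξ ∈ Icc x y, |q.eval ξ| ≤ Y) → ∀ ξ ∈ Icc x y, |q.derivative.eval ξ| * h ≤ D * Y)
    (hh : 0 < h) {P : ℕ → Polynomial ℝ} (hP : ∀ i, (P i).natDegree ≤ m) {n : ℕ}
    (H : CoeffBound P n h x y X) {l : ℕ} (hl : l ≤ n) {ξ : ℝ} (hξ : ξ ∈ Icc x y) :
    |(P l).derivative.eval ξ| * h ^ l ≤ D * X := by
  have hX := H.nonneg (hξ.1.trans hξ.2)
  rcases l with _ | l
  · rw [pow_zero, mul_one]
    exact (H.1 ξ hξ).trans (by nlinarith)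
  · have h1 := hinv (P (l + 1)) (hP _) (X / h ^ l) (fun ζ hζ => by
      rw [le_div_iff₀ (by positivity)]
      exact H.2 l (by omega) ζ hζ) ξ hξ
    rw [← mul_div_assoc, le_div_iff₀ (by positivity)] at h1
    rw [pow_succ']
    linarith

theorem CoeffBound.second_derivative_le {m : ℕ} {D h x y X : ℝ} (hD : 1 ≤ D)
    (hinv : ∀ q : Polynomial ℝ, q.natDegree ≤ m → ∀ Y : ℝ,
      (∀ ξ ∈ Icc x y, |q.eval ξ| ≤ Y) → ∀ ξ ∈ Icc x y, |q.derivative.eval ξ| * h ≤ D * Y)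
    (hh : 0 < h) {P : ℕ → Polynomial ℝ} (hP : ∀ i, (P i).natDegree ≤ m) {n : ℕ}
    (H : CoeffBound P n h x y X) {l : ℕ} (hl : l ≤ n) {ξ : ℝ} (hξ : ξ ∈ Icc x y) :
    |(P l).derivative.derivative.eval ξ| * h ^ (l + 1) ≤ D ^ 2 * X := by
  have h1 := hinv (P l).derivative (natDegree_xiCoeff_le hP l) (D * X / h ^ l) (fun ζ hζ => by
      rw [le_div_iff₀ (by positivity)]
      exact H.derivative_le hD hinv hh hP hl hζ) ξ hξ
  rw [← mul_div_assoc, le_div_iff₀ (by positivity)] at h1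
  rw [pow_succ']
  linarith

theorem mul_pow_le_of_le {t h Y : ℝ} {l n : ℕ} (ht : 0 ≤ t) (hh : 0 ≤ h) (hh1 : h ≤ 1) (hl : l ≤ n)
    (H : t * h ^ l ≤ Y) : t * h ^ n ≤ Y :=
  (mul_le_mul_of_nonneg_left (pow_le_pow_of_le_one hh hh1 hl) ht).trans H

/-- The terms of the lower part are controlled with weights h^l or h^{l+1} for l ≤ j. As h ≤ 1, all
of them are controlled with h^{j+1}, the weight that `CoeffBound` gives to P_{j+2}. Only
coefficients up to order j + 1 occur, which is what lets the induction proceed. -/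
theorem CoeffBound.lowerPart_le {m : ℕ} {D h x y X A : ℝ} (hD : 1 ≤ D)
    (hinv : ∀ q : Polynomial ℝ, q.natDegree ≤ m → ∀ Y : ℝ,
      (∀ ξ ∈ Icc x y, |q.eval ξ| ≤ Y) → ∀ ξ ∈ Icc x y, |q.derivative.eval ξ| * h ≤ D * Y)
    (hh : 0 < h) (hh1 : h ≤ 1) {P : ℕ → Polynomial ℝ} (hP : ∀ i, (P i).natDegree ≤ m)
    {a b c : ℕ → ℕ → ℝ → ℝ}
    (hA : ∀ j ≤ m, ∀ l ≤ m, ∀ ξ, |a j l ξ| ≤ A ∧ |b j l ξ| ≤ A ∧ |c j l ξ| ≤ A)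
    {j : ℕ} (hj : j ≤ m) (H : CoeffBound P (j + 1) h x y X) {ξ : ℝ} (hξ : ξ ∈ Icc x y) :
    |lowerPart a b c P j ξ| * h ^ (j + 1) ≤ (m + 1) * (3 * A * D ^ 2) * X := by
  have hX := H.nonneg (hξ.1.trans hξ.2)
  have hA0 : 0 ≤ A := (abs_nonneg _).trans (hA 0 (by omega) 0 (by omega) 0).1
  have hD2 : D ≤ D ^ 2 := by nlinarith
  have hterm : ∀ l ∈ Finset.range (j + 1), |a j l ξ * (P (l + 1)).eval ξ
      + b j l ξ * (P l).derivative.derivative.eval ξ + c j l ξ * (P l).derivative.eval ξ|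
      * h ^ (j + 1) ≤ 3 * A * D ^ 2 * X := by
    intro l hl
    have hlj : l ≤ j := by have := Finset.mem_range.1 hl; omega
    obtain ⟨ha, hb, hc⟩ := hA j hj l (hlj.trans hj) ξ
    have e1 : |(P (l + 1)).eval ξ| * h ^ (j + 1) ≤ D ^ 2 * X :=
      (mul_pow_le_of_le (abs_nonneg _) hh.le hh1 (by omega : l ≤ j + 1)
        (H.2 l (by omega) ξ hξ)).trans (by nlinarith)
    have e2 : |(P l).derivative.derivative.eval ξ| * h ^ (j + 1) ≤ D ^ 2 * X :=
      mul_pow_le_of_le (abs_nonneg _) hh.le hh1 (by omega : l + 1 ≤ j + 1)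
        (H.second_derivative_le hD hinv hh hP (by omega) hξ)
    have e3 : |(P l).derivative.eval ξ| * h ^ (j + 1) ≤ D ^ 2 * X :=
      (mul_pow_le_of_le (abs_nonneg _) hh.le hh1 (by omega : l ≤ j + 1)
        (H.derivative_le hD hinv hh hP (by omega) hξ)).trans (by nlinarith)
    have hp : ∀ u v : ℝ, |u| ≤ A → |v| * h ^ (j + 1) ≤ D ^ 2 * X →
        |u * v| * h ^ (j + 1) ≤ A * (D ^ 2 * X) := by
      intro u v hu hv
      rw [abs_mul, mul_assoc]
      exact mul_le_mul hu hv (by positivity) hA0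
    have f1 := hp _ _ ha e1
    have f2 := hp _ _ hb e2
    have f3 := hp _ _ hc e3
    calc _ ≤ (|a j l ξ * (P (l + 1)).eval ξ| + |b j l ξ * (P l).derivative.derivative.eval ξ|
          + |c j l ξ * (P l).derivative.eval ξ|) * h ^ (j + 1) := by
            gcongr
            exact abs_add_three _ _ _
      _ ≤ _ := by rw [add_mul, add_mul]; linarith
  calc |lowerPart a b c P j ξ| * h ^ (j + 1)
      ≤ (∑ l ∈ Finset.range (j + 1), |a j l ξ * (P (l + 1)).eval ξ
      + b j l ξ * (P l).derivative.derivative.eval ξ + c j l ξ * (P l).derivative.eval ξ|)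
      * h ^ (j + 1) := by
        gcongr
        exact Finset.abs_sum_le_sum_abs _ _
    _ ≤ ∑ l ∈ Finset.range (j + 1), 3 * A * D ^ 2 * X := by
        rw [Finset.sum_mul]
        exact Finset.sum_le_sum hterm
    _ = (j + 1) * (3 * A * D ^ 2 * X) := by simp
    _ ≤ (m + 1) * (3 * A * D ^ 2 * X) := by
        have : (j : ℝ) ≤ m := by exact_mod_cast hj
        gcongr
    _ = _ := by ring

/-- A polynomial that is, in the weak sense, equal to a bounded function is bounded. -/
theorem exists_weak_bound (m : ℕ) : ∃ E : ℝ, 1 ≤ E ∧ ∀ q : Polynomial ℝ, q.natDegree ≤ m →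
    ∀ (f : ℝ → ℝ), Continuous f → ∀ x y Y : ℝ, x < y → (∀ ξ ∈ Icc x y, |f ξ| ≤ Y) →
    (∫ ξ in x..y, (q.eval ξ + f ξ) * q.eval ξ) = 0 → ∀ ξ ∈ Icc x y, |q.eval ξ| ≤ E * Y := by
  obtain ⟨E, hE, H⟩ := exists_sq_le_integral m
  refine ⟨E, hE, fun q hq f hf x y Y hxy hY hinterior ξ hξ => ?_⟩
  have hqc : Continuous fun ξ => q.eval ξ := q.continuous
  have hY0 : 0 ≤ Y := (abs_nonneg _).trans (hY ξ hξ)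
  obtain ⟨z, hz, hmax⟩ := isCompact_Icc.exists_isMaxOn (nonempty_Icc.2 hxy.le)
    (f := fun x => |q.eval x|) (hqc.abs.continuousOn)
  set S := |q.eval z| with hS
  have hS0 : 0 ≤ S := abs_nonneg _
  -- Testing with q itself turns the hypothesis into ∫ q² = -∫ f q; one factor S then cancels
  -- against ∫ q² ≥ S² (y - x) / E.
  have h1 : ∫ ξ in x..y, q.eval ξ ^ 2 ≤ Y * S * (y - x) := by
    have hsplit : ∫ ξ in x..y, (q.eval ξ + f ξ) * q.eval ξ
        = (∫ ξ in x..y, q.eval ξ ^ 2) + ∫ ξ in x..y, f ξ * q.eval ξ := by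
      rw [← intervalIntegral.integral_add (f := fun ξ => q.eval ξ ^ 2)
        (g := fun ξ => f ξ * q.eval ξ) ((hqc.pow 2).intervalIntegrable _ _)
        ((hf.mul hqc).intervalIntegrable _ _)]
      exact intervalIntegral.integral_congr fun ξ _ => by ring
    have hb := intervalIntegral.norm_integral_le_of_norm_le_const (a := x) (b := y)
      (f := fun ξ => f ξ * q.eval ξ) (C := Y * S) (fun ζ hζ => by
        rw [uIoc_of_le hxy.le] at hζ
        have hζ' : ζ ∈ Icc x y := Ioc_subset_Icc_self hζ
        rw [norm_mul]
        exact mul_le_mul (hY ζ hζ') (hmax hζ') (norm_nonneg _) hY0)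
    rw [abs_of_pos (sub_pos.2 hxy), Real.norm_eq_abs] at hb
    have := neg_le_abs (∫ ξ in x..y, f ξ * q.eval ξ)
    linarith
  have h2 := H q hq x y hxy z hz
  have h3 : S * S ≤ E * Y * S := by
    have : S ^ 2 * (y - x) ≤ E * (Y * S * (y - x)) := by
      rw [hS, sq_abs]
      exact h2.trans (by gcongr)
    have hpos := sub_pos.2 hxy
    have : S ^ 2 * (y - x) ≤ (E * Y * S) * (y - x) := by linarith
    have := le_of_mul_le_mul_right this hpos
    linarith
  have h4 : S ≤ E * Y := by
    rcases hS0.eq_or_lt with h0 | h0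
    · rw [← h0]; positivity
    · exact le_of_mul_le_mul_right h3 h0
  exact (hmax hξ).trans h4

theorem continuous_lowerPart {a b c : ℕ → ℕ → ℝ → ℝ}
    (h : ∀ j l, Continuous (a j l) ∧ Continuous (b j l) ∧ Continuous (c j l))
    (P : ℕ → Polynomial ℝ) (j : ℕ) : Continuous (lowerPart a b c P j) := by
  unfold lowerPart
  refine continuous_finsetSum _ fun l _ => ?_
  exact (((h j l).1.mul (Polynomial.continuous _)).add
    ((h j l).2.1.mul (Polynomial.continuous _))).add ((h j l).2.2.mul (Polynomial.continuous _))

/-- Two families of coefficients that satisfy the jump conditions (with the coefficients of the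
diffusion absorbed) are bounded in terms of each other. -/
theorem exists_coeffBound_extension {m : ℕ} {a b c : ℕ → ℕ → ℝ → ℝ}
    (hcont : ∀ j l, Continuous (a j l) ∧ Continuous (b j l) ∧ Continuous (c j l)) {A : ℝ}
    (hA : ∀ j ≤ m, ∀ l ≤ m, ∀ ξ, |a j l ξ| ≤ A ∧ |b j l ξ| ≤ A ∧ |c j l ξ| ≤ A)
    {c₀ : ℝ} (hc₀ : 0 < c₀) (n : ℕ) (hn : n ≤ m) : ∃ C : ℝ, 1 ≤ C ∧ ∀ (P Q : ℕ → Polynomial ℝ)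
    (h x y X : ℝ), (∀ i, (P i).natDegree ≤ m) → (∀ i, (Q i).natDegree ≤ m) → 0 < h → h ≤ 1 →
    c₀ * h ≤ y - x → CoeffBound P m h x y X →
    (∀ ξ ∈ Icc x y, |(Q 0).derivative.eval ξ| ≤ X) →
    (∀ ξ ∈ Icc x y, (P 1).eval ξ = (Q 1).eval ξ) →
    (∀ j, j + 2 ≤ m → ∀ v : Polynomial ℝ, v.natDegree ≤ m →
      ∫ ξ in x..y, (((j + 2).factorial * (P (j + 2)).eval ξ + lowerPart a b c P j ξ)
        - ((j + 2).factorial * (Q (j + 2)).eval ξ + lowerPart a b c Q j ξ)) * v.eval ξ = 0) →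
    CoeffBound Q n h x y (C * X) := by
  obtain ⟨D, hD, hinv⟩ := exists_inverse_inequality m hc₀
  obtain ⟨E, hE, hweak⟩ := exists_weak_bound m
  have hA0 : 0 ≤ A := (abs_nonneg _).trans (hA 0 (by omega) 0 (by omega) 0).1
  -- Induction on the order in η up to which the second family is known to be bounded; order 0 is
  -- the hypothesis on the tangential derivative.
  induction n with
  | zero =>
    refine ⟨1, le_rfl, fun P Q h x y X _ _ _ _ _ _ h0 _ _ => ⟨fun ξ hξ => ?_, fun k hk => ?_⟩⟩
    · rw [one_mul]; exact h0 ξ hξ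
    · omega
  | succ n ih =>
    obtain ⟨C, hC, ih⟩ := ih (by omega)
    set F := (m + 1) * (3 * A * D ^ 2) with hF
    have hF0 : 0 ≤ F := by positivity
    have hFE : 0 ≤ E * (F + F * C) := by positivity
    -- C keeps the orders already treated, 1 accounts for the new coefficient of P, and F and F C
    -- for the lower parts of P and Q after the weak bound.
    refine ⟨C + 1 + E * (F + F * C), by linarith,
      fun P Q h x y X hP hQ hh hh1 hxy HP h0 h1 hw => ?_⟩
    have hlt : x < y := by have := mul_pos hc₀ hh; linarith
    have hX := HP.nonneg hlt.le
    have HQ := ih P Q h x y X hP hQ hh hh1 hxy HP h0 h1 hw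
    have hle : C * X ≤ (C + 1 + E * (F + F * C)) * X := by
      have : 0 ≤ (1 + E * (F + F * C)) * X := by positivity
      linarith
    have hle₂ : (1 + E * (F + F * C)) * X ≤ (C + 1 + E * (F + F * C)) * X := by
      have : 0 ≤ C * X := by positivity
      linarith
    refine ⟨(HQ.mono le_rfl hle).1, fun k hk ξ hξ => ?_⟩
    rcases Nat.lt_succ_iff_lt_or_eq.1 hk with hk | rfl
    · exact (HQ.mono le_rfl hle).2 k hk ξ hξ
    -- The coefficient of η comes from the flux condition, that of η^{j+2} from the weak Laplacian
    -- condition of order j.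
    rcases k with _ | j
    · rw [zero_add, ← h1 ξ hξ]
      refine (HP.2 0 (by omega) ξ hξ).trans (le_trans ?_ hle₂)
      have : 0 ≤ E * (F + F * C) * X := by positivity
      linarith
    · have hinv' : ∀ q : Polynomial ℝ, q.natDegree ≤ m → ∀ Y : ℝ,
          (∀ ξ ∈ Icc x y, |q.eval ξ| ≤ Y) → ∀ ξ ∈ Icc x y, |q.derivative.eval ξ| * h ≤ D * Y :=
        fun q hq Y hY => hinv q hq h x y Y hh hxy hY
      have hfac : (1 : ℝ) ≤ (j + 2).factorial := by
        exact_mod_cast Nat.one_le_iff_ne_zero.2 (Nat.factorial_ne_zero _)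
      -- The difference of the principal parts is a polynomial of degree at most m, hence an
      -- admissible test function.
      set q : Polynomial ℝ := ((j + 2).factorial : ℝ) • (P (j + 2) - Q (j + 2)) with hq
      have hqdeg : q.natDegree ≤ m := (Polynomial.natDegree_smul_le _ _).trans
        ((Polynomial.natDegree_sub_le _ _).trans (max_le (hP _) (hQ _)))
      have hqe : ∀ ζ, q.eval ζ = (j + 2).factorial * ((P (j + 2)).eval ζ - (Q (j + 2)).eval ζ) := by
        intro ζ; simp [hq]
      have hlow : ∀ ζ ∈ Icc x y, |lowerPart a b c P j ζ - lowerPart a b c Q j ζ|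
          ≤ (F + F * C) * X / h ^ (j + 1) := by
        intro ζ hζ
        rw [le_div_iff₀ (by positivity)]
        have e1 := (HP.mono (by omega : j + 1 ≤ m) le_rfl).lowerPart_le hD hinv' hh hh1 hP hA
          (by omega) hζ
        have e2 := HQ.lowerPart_le hD hinv' hh hh1 hQ hA (by omega) hζ
        calc _ ≤ (|lowerPart a b c P j ζ| + |lowerPart a b c Q j ζ|) * h ^ (j + 1) := by
              gcongr
              exact abs_sub _ _
          _ ≤ _ := by rw [add_mul]; linarith
      have hqb := hweak q hqdeg (fun ζ => lowerPart a b c P j ζ - lowerPart a b c Q j ζ)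
        ((continuous_lowerPart hcont P j).sub (continuous_lowerPart hcont Q j)) x y _ hlt hlow (by
          rw [← hw j (by omega) q hqdeg]
          refine intervalIntegral.integral_congr fun ζ _ => ?_
          simp only [hqe]
          ring) ξ hξ
      rw [← mul_div_assoc, le_div_iff₀ (by positivity), hqe, abs_mul,
        abs_of_nonneg (by positivity)] at hqb
      have hdiff : |(P (j + 2)).eval ξ - (Q (j + 2)).eval ξ| * h ^ (j + 1)
          ≤ E * ((F + F * C) * X) := by
        refine le_trans ?_ hqb
        refine mul_le_mul_of_nonneg_right ?_ (by positivity)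
        exact le_mul_of_one_le_left (abs_nonneg _) hfac
      have hPb := HP.2 (j + 1) (by omega) ξ hξ
      have htri : |(Q (j + 2)).eval ξ| ≤ |(P (j + 2)).eval ξ|
          + |(P (j + 2)).eval ξ - (Q (j + 2)).eval ξ| := by
        have := abs_sub_abs_le_abs_sub ((Q (j + 2)).eval ξ) ((P (j + 2)).eval ξ)
        rw [abs_sub_comm] at this
        linarith
      calc |(Q (j + 1 + 1)).eval ξ| * h ^ (j + 1)
          ≤ (|(P (j + 2)).eval ξ| + |(P (j + 2)).eval ξ - (Q (j + 2)).eval ξ|) * h ^ (j + 1) := by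
            gcongr
        _ ≤ (1 + E * (F + F * C)) * X := by rw [add_mul]; linarith
        _ ≤ _ := hle₂

/-- Bound of the coefficients by the gradient. -/
theorem exists_coeffBound_of_gradient (m : ℕ) : ∃ C : ℝ, 1 ≤ C ∧ ∀ (P : ℕ → Polynomial ℝ)
    (h x y S : ℝ), 0 < h →
    (∀ η ξ, |η| ≤ h → ξ ∈ Icc x y → |tens m (etaCoeff P) η ξ| ≤ S ∧ |tens m (xiCoeff P) η ξ| ≤ S) →
    0 ≤ S → CoeffBound P m h x y (C * S) := by
  obtain ⟨C, hC, H⟩ := exists_scaled_coeff_bound m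
  refine ⟨C, hC, fun P h x y S hh hS hS0 => ⟨fun ξ hξ => ?_, fun k hk ξ hξ => ?_⟩⟩
  · have h1 := (hS 0 ξ (by simpa using hh.le) hξ).2
    have h2 : tens m (xiCoeff P) 0 ξ = (P 0).derivative.eval ξ := by
      rw [tens, Finset.sum_range_succ']
      simp [xiCoeff]
    rw [← h2]
    exact h1.trans (le_mul_of_one_le_left hS0 hC)
  · obtain ⟨q, hq, hqe, hqc⟩ := tens_eq_eval_left m (etaCoeff P) ξ
    have h1 := H q hq h S hh (fun η hη => by rw [← hqe]; exact (hS η ξ hη hξ).1) k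
    rw [hqc k hk.le, etaCoeff, Polynomial.eval_smul, smul_eq_mul, abs_mul,
      abs_of_nonneg (by positivity)] at h1
    refine le_trans ?_ h1
    refine mul_le_mul_of_nonneg_right (le_mul_of_one_le_left (abs_nonneg _) ?_) (by positivity)
    linarith [Nat.cast_nonneg (α := ℝ) k]

/-- Bound of the gradient by the coefficients. -/
theorem exists_gradient_bound (m : ℕ) {c₀ : ℝ} (hc₀ : 0 < c₀) : ∃ C : ℝ, 1 ≤ C ∧
    ∀ (P : ℕ → Polynomial ℝ) (h x y X : ℝ), (∀ i, (P i).natDegree ≤ m) → (∀ i, m < i → P i = 0) →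
    0 < h → c₀ * h ≤ y - x → CoeffBound P m h x y X → ∀ η ξ, |η| ≤ h → ξ ∈ Icc x y →
    |tens m (etaCoeff P) η ξ| ≤ C * X ∧ |tens m (xiCoeff P) η ξ| ≤ C * X := by
  obtain ⟨D, hD, hinv⟩ := exists_inverse_inequality m hc₀
  have hm1 : (1 : ℝ) ≤ m + 1 := by simp
  refine ⟨(m + 1) * ((m + 1) * D), one_le_mul_of_one_le_of_one_le hm1
    (one_le_mul_of_one_le_of_one_le hm1 hD), fun P h x y X hP hP0 hh hxy H η ξ hη hξ => ?_⟩
  have hX := H.nonneg (hξ.1.trans hξ.2)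
  have hsum : ∀ W : ℕ → Polynomial ℝ, (∀ i ≤ m, |(W i).eval ξ| * h ^ i ≤ (m + 1) * D * X) →
      |tens m W η ξ| ≤ (m + 1) * ((m + 1) * D) * X := by
    intro W hW
    rw [tens]
    refine (Finset.abs_sum_le_sum_abs _ _).trans ?_
    calc _ ≤ ∑ _i ∈ Finset.range (m + 1), (m + 1) * D * X := by
          refine Finset.sum_le_sum fun i hi => ?_
          rw [abs_mul, abs_pow]
          refine le_trans ?_ (hW i (by have := Finset.mem_range.1 hi; omega))
          gcongr
      _ = _ := by simp; ring
  constructor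
  · refine hsum _ fun i hi => ?_
    rw [etaCoeff, Polynomial.eval_smul, smul_eq_mul, abs_mul, abs_of_nonneg (by positivity)]
    rcases hi.lt_or_eq with hi' | rfl
    · have h1 := H.2 i hi' ξ hξ
      have h2 : (i : ℝ) + 1 ≤ m + 1 := by
        have : (i : ℝ) ≤ m := by exact_mod_cast hi
        linarith
      calc _ = (i + 1 : ℝ) * (|(P (i + 1)).eval ξ| * h ^ i) := by ring
        _ ≤ (m + 1) * X := by gcongr
        _ ≤ (m + 1) * D * X := by
          gcongr
          exact le_mul_of_one_le_right (by positivity) hD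
    -- The top index involves P_{m+1}, which `CoeffBound` does not cover but which is zero.
    · rw [hP0 _ (Nat.lt_succ_self _), Polynomial.eval_zero, abs_zero, mul_zero, zero_mul]
      positivity
  · refine hsum _ fun i hi => ?_
    refine (H.derivative_le hD (fun q hq Y hY => hinv q hq h x y Y hh hxy hY) hh hP hi hξ).trans ?_
    have : 0 ≤ D * X := by positivity
    nlinarith

theorem lowerPart_smul (a b c : ℕ → ℕ → ℝ → ℝ) (P : ℕ → Polynomial ℝ) (β : ℝ) (j : ℕ) (ξ : ℝ) :
    lowerPart a b c (fun i => β • P i) j ξ = β * lowerPart a b c P j ξ := by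
  simp only [lowerPart, Finset.mul_sum, Polynomial.derivative_smul, Polynomial.eval_smul,
    smul_eq_mul]
  exact Finset.sum_congr rfl fun l _ => by ring

theorem etaCoeff_smul (P : ℕ → Polynomial ℝ) (β : ℝ) :
    etaCoeff (fun i => β • P i) = fun i => β • etaCoeff P i :=
  funext fun i => by simp only [etaCoeff]; rw [smul_comm]

theorem xiCoeff_smul (P : ℕ → Polynomial ℝ) (β : ℝ) :
    xiCoeff (fun i => β • P i) = fun i => β • xiCoeff P i :=
  funext fun i => by simp only [xiCoeff, Polynomial.derivative_smul]

theorem tens_smul (m : ℕ) (P : ℕ → Polynomial ℝ) (β η ξ : ℝ) :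
    tens m (fun i => β • P i) η ξ = β * tens m P η ξ := by
  simp only [tens, Finset.mul_sum, Polynomial.eval_smul, smul_eq_mul, mul_assoc]

/-- It is not known in advance which side contains the large square, so the extension bound is
needed in both directions. -/
theorem IsIFEPair.symm {g : ℝ → Plane} {m : ℕ} {β₁ β₂ x y : ℝ} {p q : ℝ → ℝ → ℝ}
    (H : IsIFEPair g m β₁ β₂ x y p q) : IsIFEPair g m β₂ β₁ x y q p where
  poly_pos := H.poly_neg
  poly_neg := H.poly_pos
  jump_value ξ hξ := by linarith [H.jump_value ξ hξ]
  jump_flux ξ hξ := by linarith [H.jump_flux ξ hξ]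
  jump_laplacian j hj v hv := by
    rw [← neg_eq_zero, ← intervalIntegral.integral_neg]
    refine Eq.trans ?_ (H.jump_laplacian j hj v hv)
    exact intervalIntegral.integral_congr fun ξ _ => by ring

/-- The gradient of one of the polynomial pieces of a function in the Frenet IFE space controls the
gradient of the other one. -/
theorem IsJordanParam.exists_extension_bound {m : ℕ} (hm : 1 ≤ m) {ξs ξe : ℝ} {g : ℝ → Plane}
    (hg : IsJordanParam m ξs ξe g) {c₀ : ℝ} (hc₀ : 0 < c₀) : ∃ C : ℝ, 1 ≤ C ∧
    ∀ (β₁ β₂ βM h x y S : ℝ) (P Q : ℕ → Polynomial ℝ), 0 < β₁ → 0 < β₂ → β₁ ≤ βM → β₂ ≤ βM →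
    0 < h → h ≤ 1 → c₀ * h ≤ y - x → (∀ i, (P i).natDegree ≤ m) → (∀ i, m < i → P i = 0) →
    (∀ i, (Q i).natDegree ≤ m) → (∀ i, m < i → Q i = 0) →
    IsIFEPair g m β₁ β₂ x y (tens m P) (tens m Q) →
    (∀ η ξ, |η| ≤ h → ξ ∈ Icc x y → |tens m (etaCoeff P) η ξ| ≤ S ∧ |tens m (xiCoeff P) η ξ| ≤ S) →
    ∀ η ξ, |η| ≤ h → ξ ∈ Icc x y →
      β₂ * |tens m (etaCoeff Q) η ξ| ≤ C * (βM * S) ∧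
      β₂ * |tens m (xiCoeff Q) η ξ| ≤ C * (βM * S) := by
  -- For m = 1 there are no Laplacian conditions, and zero coefficient functions serve.
  obtain ⟨a, b, c, hcont, ⟨A, hA⟩, hexp⟩ : ∃ a b c : ℕ → ℕ → ℝ → ℝ,
      (∀ j l, Continuous (a j l) ∧ Continuous (b j l) ∧ Continuous (c j l)) ∧
      (∃ A : ℝ, ∀ j ≤ m, ∀ l ≤ m, ∀ ξ, |a j l ξ| ≤ A ∧ |b j l ξ| ≤ A ∧ |c j l ξ| ≤ A) ∧
      ∀ P : ℕ → Polynomial ℝ, (∀ i, m < i → P i = 0) → ∀ j, j + 2 ≤ m → ∀ ξ,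
      iteratedDeriv j (fun η => frenetLaplacian g (tens m P) η ξ) 0 =
        (j + 2).factorial * (P (j + 2)).eval ξ + lowerPart a b c P j ξ := by
    by_cases hm2 : 2 ≤ m
    · obtain ⟨a, b, c, h1, ⟨A, -, h2⟩, h3⟩ := hg.exists_laplacian_expansion hm2
      exact ⟨a, b, c, h1, ⟨A, h2⟩, fun P hP j _ => h3 P hP j⟩
    · exact ⟨fun _ _ _ => 0, fun _ _ _ => 0, fun _ _ _ => 0,
        fun _ _ => ⟨continuous_const, continuous_const, continuous_const⟩, ⟨0, by simp⟩,
        fun P hP j hj => by omega⟩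
  obtain ⟨C₁, hC₁, H₁⟩ := exists_coeffBound_of_gradient m
  obtain ⟨C₂, hC₂, H₂⟩ := exists_coeffBound_extension hcont hA hc₀ m le_rfl
  obtain ⟨C₃, hC₃, H₃⟩ := exists_gradient_bound m hc₀
  refine ⟨C₃ * (C₂ * C₁), one_le_mul_of_one_le_of_one_le hC₃
    (one_le_mul_of_one_le_of_one_le hC₂ hC₁), ?_⟩
  intro β₁ β₂ βM h x y S P Q hβ₁ hβ₂ h1M h2M hh hh1 hxy hP hP0 hQ hQ0 HI hS η ξ hη hξ
  have hlt : x < y := by have := mul_pos hc₀ hh; linarith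
  have hS0 : 0 ≤ S := (abs_nonneg _).trans (hS 0 ξ (by simpa using hh.le) hξ).1
  have hsm : ∀ β : ℝ, ∀ W : ℕ → Polynomial ℝ, (∀ i, (W i).natDegree ≤ m) →
      ∀ i, (β • W i).natDegree ≤ m := fun β W hW i => (Polynomial.natDegree_smul_le _ _).trans (hW i)
  have hscale : ∀ β : ℝ, 0 ≤ β → β ≤ βM → ∀ t : ℝ, |t| ≤ S → |β * t| ≤ βM * S := by
    intro β hβ hβM t ht
    rw [abs_mul, abs_of_nonneg hβ]
    exact mul_le_mul hβM ht (abs_nonneg _) (hβ.trans hβM)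
  have hbound : ∀ β : ℝ, 0 ≤ β → β ≤ βM →
      CoeffBound (fun i => β • P i) m h x y (C₁ * (βM * S)) := by
    intro β hβ hβM
    refine H₁ _ h x y (βM * S) hh (fun η ξ hη hξ => ?_) (mul_nonneg (hβ.trans hβM) hS0)
    rw [etaCoeff_smul, xiCoeff_smul, tens_smul, tens_smul]
    exact ⟨hscale β hβ hβM _ (hS η ξ hη hξ).1, hscale β hβ hβM _ (hS η ξ hη hξ).2⟩
  -- The value condition holds on a nondegenerate interval, so it is an identity of polynomials and
  -- can be differentiated in ξ.
  have hPQ : P 0 = Q 0 := by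
    refine Polynomial.eq_of_infinite_eval_eq _ _ ((Icc_infinite hlt).mono fun ζ hζ => ?_)
    have h1 := HI.jump_value ζ hζ
    have h2 : ∀ W : ℕ → Polynomial ℝ, tens m W 0 ζ = (W 0).eval ζ := fun W => by
      rw [tens, Finset.sum_range_succ']; simp
    rw [h2, h2, sub_eq_zero] at h1
    exact h1
  -- For the families β₁ P_i and β₂ Q_i the flux and Laplacian conditions contain no coefficients,
  -- so the constants do not see β. The value condition becomes β₂ Q_0 = β₂ P_0, which is bounded
  -- through β₂ ≤ βM.
  have key := H₂ (fun i => β₁ • P i) (fun i => β₂ • Q i) h x y (C₁ * (βM * S))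
    (hsm β₁ P hP) (hsm β₂ Q hQ) hh hh1 hxy (hbound β₁ hβ₁.le h1M) (fun ζ hζ => by
      have := (hbound β₂ hβ₂.le h2M).1 ζ hζ
      simpa only [hPQ] using this) (fun ζ hζ => by
      have h1 := HI.jump_flux ζ hζ
      have h2 : ∀ W : ℕ → Polynomial ℝ, (∀ i, m < i → W i = 0) →
          deriv (fun η => tens m W η ζ) 0 = (W 1).eval ζ := fun W hW => by
        have := iteratedDeriv_tens_left hW 1 ζ
        rw [iteratedDeriv_one] at this
        simpa using this
      rw [h2 P hP0, h2 Q hQ0] at h1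
      simp only [Polynomial.eval_smul, smul_eq_mul]
      linarith) (fun j hj v hv => by
      rw [← HI.jump_laplacian j hj v hv]
      refine intervalIntegral.integral_congr fun ζ _ => ?_
      simp only [hexp P hP0 j hj, hexp Q hQ0 j hj, lowerPart_smul, Polynomial.eval_smul,
        smul_eq_mul]
      ring)
  have hfin := H₃ (fun i => β₂ • Q i) h x y _ (hsm β₂ Q hQ)
    (fun i hi => by rw [hQ0 i hi, smul_zero]) hh hxy key η ξ hη hξ
  rw [etaCoeff_smul, xiCoeff_smul, tens_smul, tens_smul, abs_mul, abs_mul, abs_of_pos hβ₂] at hfin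
  have e : C₃ * (C₂ * (C₁ * (βM * S))) = C₃ * (C₂ * C₁) * (βM * S) := by ring
  rw [e] at hfin
  exact hfin

/-! ### Lower bounds for the energy and upper bounds on the boundary -/

/-- If a polynomial in the coordinates `R` is controlled by the field `F` on `U`, and `R(U)`
contains, with some room, a square of size comparable to `h`, then the polynomial is controlled on
an enlarged square by the mean square of `F`. -/
theorem exists_lintegral_lower_bound (m : ℕ) {r M L : ℝ} (hr : 0 < r) (hM : 1 ≤ M) (hL : 0 < L) :
    ∃ c > 0, ∀ (W : ℕ → Polynomial ℝ) (U : Set Plane) (R : Plane → ℝ × ℝ) (F : Plane → Plane)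
    (D h η₁ ξ₁ : ℝ), (∀ i, (W i).natDegree ≤ m) → 0 < D → 0 < h →
    (∀ η ξ, |η - η₁| ≤ r * h → |ξ - ξ₁| ≤ r * h → ∃ x, R x = (η, ξ) ∧
      ∀ y ∈ Metric.ball x (r * h), y ∈ U ∧ ‖R y - R x‖ ≤ L * ‖y - x‖) →
    (∀ y ∈ U, |tens m W (R y).1 (R y).2| ≤ D * ‖F y‖) →
    ∀ η ξ, |η - η₁| ≤ M * (r * h) → |ξ - ξ₁| ≤ M * (r * h) →
      ENNReal.ofReal (c * h ^ 2 * tens m W η ξ ^ 2)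
        ≤ ENNReal.ofReal (D ^ 2) * ∫⁻ y in U, ‖F y‖ₑ ^ 2 := by
  -- The 2 makes room for points within ρ of a point of the original square.
  obtain ⟨C, hC, H⟩ := exists_tens_bound m (le_max_of_le_left hM : 1 ≤ max M 2)
  set v := (volume (Metric.ball (0 : Plane) 1)).toReal with hv
  have hvfin : volume (Metric.ball (0 : Plane) 1) ≠ ∞ := measure_ball_lt_top.ne
  have hv0 : 0 < v := ENNReal.toReal_pos (Metric.measure_ball_pos _ _ one_pos).ne' hvfin
  -- Radius, relative to ρ, of a ball around a maximum point on which the polynomial stays above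
  -- S/2: its oscillation there is at most 2 S C L ε ≤ S/2.
  set ε := 1 / (4 * C * (L + 1)) with hε
  have hε0 : 0 < ε := by positivity
  have hCL : 1 ≤ C * (L + 1) := one_le_mul_of_one_le_of_one_le hC (by linarith)
  have hε1 : ε ≤ 1 := by
    rw [hε, div_le_one (by positivity)]
    linarith
  have hLε : C * (L * ε) ≤ 1 / 4 := by
    have h1 : C * ((L + 1) * ε) = 1 / 4 := by rw [hε]; field_simp
    have h2 : C * (L * ε) ≤ C * ((L + 1) * ε) := by gcongr; linarith
    linarith
  have hLε' : L * ε ≤ 1 := by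
    have : L * ε ≤ C * (L * ε) := le_mul_of_one_le_left (by positivity) hC
    linarith
  -- The square (S/2)² times the area v (ε r h)² of the ball, divided by C² for the passage from S
  -- to the enlarged square.
  refine ⟨v * ε ^ 2 * r ^ 2 / (4 * C ^ 2), by positivity, ?_⟩
  intro W U R F D h η₁ ξ₁ hW hD hh hR hF η ξ hη hξ
  set ρ := r * h with hρ
  have hρ0 : 0 < ρ := by positivity
  have hmem : ∀ (t s : ℝ), t ∈ Metric.closedBall s ρ ↔ |t - s| ≤ ρ := fun t s => by
    rw [Metric.mem_closedBall, Real.dist_eq]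
  obtain ⟨z, hz, hmax⟩ := ((isCompact_closedBall η₁ ρ).prod
    (isCompact_closedBall ξ₁ ρ)).exists_isMaxOn
    ⟨(η₁, ξ₁), Metric.mem_closedBall_self hρ0.le, Metric.mem_closedBall_self hρ0.le⟩
    (continuous_tens m W).abs.continuousOn
  obtain ⟨hz1, hz2⟩ := hz
  rw [hmem] at hz1 hz2
  set S := |tens m W z.1 z.2| with hS
  have hS0 : 0 ≤ S := abs_nonneg _
  obtain ⟨Hb, Hl⟩ := H W hW η₁ ξ₁ ρ S hρ0 (fun e x he hx =>
    hmax (show (e, x) ∈ _ from ⟨(hmem _ _).2 he, (hmem _ _).2 hx⟩))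
  obtain ⟨x, hx, hball⟩ := hR z.1 z.2 hz1 hz2
  have hxz : R x = z := hx
  have hlow : ∀ y ∈ Metric.ball x (ε * ρ), y ∈ U ∧ (S / 2) ^ 2 ≤ D ^ 2 * ‖F y‖ ^ 2 := by
    intro y hy
    rw [Metric.mem_ball, dist_eq_norm] at hy
    obtain ⟨hyU, hyR⟩ := hball y (by
      rw [Metric.mem_ball, dist_eq_norm]
      exact hy.trans_le (mul_le_of_le_one_left hρ0.le hε1))
    refine ⟨hyU, ?_⟩
    have h1 : ‖R y - z‖ ≤ L * ε * ρ := by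
      rw [hxz] at hyR
      refine hyR.trans ?_
      rw [mul_assoc]
      gcongr
    have h2 : |(R y).1 - z.1| ≤ L * ε * ρ := (norm_fst_le (R y - z)).trans h1
    have h3 : |(R y).2 - z.2| ≤ L * ε * ρ := (norm_snd_le (R y - z)).trans h1
    have h4 : L * ε * ρ ≤ ρ := mul_le_of_le_one_left hρ0.le hLε'
    have hbox : ∀ t t' s : ℝ, |t - t'| ≤ L * ε * ρ → |t' - s| ≤ ρ → |t - s| ≤ max M 2 * ρ := by
      intro t t' s ha hb
      have h6 : 2 * ρ ≤ max M 2 * ρ := by gcongr; exact le_max_right _ _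
      have h7 := abs_sub_le t t' s
      linarith
    have hself : ∀ t s : ℝ, |t - s| ≤ ρ → |t - s| ≤ max M 2 * ρ := fun t s ha =>
      hbox t t s (by simp; positivity) ha
    have h5 := Hl (R y).1 (R y).2 z.1 z.2 (hbox _ _ _ h2 hz1) (hbox _ _ _ h3 hz2)
      (hself _ _ hz1) (hself _ _ hz2)
    have h6 : C * S / ρ * (|(R y).1 - z.1| + |(R y).2 - z.2|) ≤ S / 2 := by
      calc _ ≤ C * S / ρ * (L * ε * ρ + L * ε * ρ) := by gcongr
        _ = 2 * S * (C * (L * ε)) := by field_simp; ring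
        _ ≤ 2 * S * (1 / 4) := by gcongr
        _ = S / 2 := by ring
    have h7 : S / 2 ≤ |tens m W (R y).1 (R y).2| := by
      have := abs_sub_abs_le_abs_sub (tens m W z.1 z.2) (tens m W (R y).1 (R y).2)
      rw [abs_sub_comm] at this
      linarith
    rw [← mul_pow]
    exact pow_le_pow_left₀ (by positivity) (h7.trans (hF y hyU)) 2
  have hw : tens m W η ξ ^ 2 ≤ C ^ 2 * S ^ 2 := by
    have hMM : M * ρ ≤ max M 2 * ρ := by gcongr; exact le_max_left _ _
    rw [← sq_abs, ← mul_pow]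
    exact pow_le_pow_left₀ (abs_nonneg _) (Hb η ξ (hη.trans hMM) (hξ.trans hMM)) 2
  have hvol : volume (Metric.ball x (ε * ρ)) = ENNReal.ofReal ((ε * ρ) ^ 2 * v) := by
    rw [Measure.addHaar_ball _ _ (by positivity), finrank_euclideanSpace, Fintype.card_fin,
      ENNReal.ofReal_mul (by positivity), hv, ENNReal.ofReal_toReal hvfin]
  calc ENNReal.ofReal (v * ε ^ 2 * r ^ 2 / (4 * C ^ 2) * h ^ 2 * tens m W η ξ ^ 2)
      ≤ ENNReal.ofReal (v * ε ^ 2 * r ^ 2 / (4 * C ^ 2) * h ^ 2 * (C ^ 2 * S ^ 2)) := by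
        gcongr
    _ = ENNReal.ofReal ((S / 2) ^ 2) * volume (Metric.ball x (ε * ρ)) := by
        rw [hvol, ← ENNReal.ofReal_mul (by positivity)]
        congr 1
        rw [hρ]
        field_simp
        ring
    _ = ∫⁻ _ in Metric.ball x (ε * ρ), ENNReal.ofReal ((S / 2) ^ 2) := by
        rw [setLIntegral_const]
    _ ≤ ∫⁻ y in Metric.ball x (ε * ρ), ENNReal.ofReal (D ^ 2) * ‖F y‖ₑ ^ 2 := by
        refine setLIntegral_mono' measurableSet_ball fun y hy => ?_
        rw [← ofReal_norm, ← ENNReal.ofReal_pow (norm_nonneg _),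
          ← ENNReal.ofReal_mul (by positivity)]
        exact ENNReal.ofReal_le_ofReal (hlow y hy).2
    _ ≤ ∫⁻ y in U, ENNReal.ofReal (D ^ 2) * ‖F y‖ₑ ^ 2 :=
        lintegral_mono_set fun y hy => (hlow y hy).1
    _ = _ := lintegral_const_mul' _ _ ENNReal.ofReal_ne_top

/-- The maximum over a rectangle of the partial derivatives of a polynomial is controlled by the
mean square of a field `F` that dominates them. -/
theorem exists_gradient_sup_bound (m : ℕ) {r M L : ℝ} (hr : 0 < r) (hM : 1 ≤ M) (hL : 0 < L) :
    ∃ c > 0, ∀ (P : ℕ → Polynomial ℝ) (U : Set Plane) (R : Plane → ℝ × ℝ) (F : Plane → Plane)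
    (D h η₁ ξ₁ α α' γ γ' : ℝ), (∀ i, (P i).natDegree ≤ m) → 0 < D → 0 < h →
    (∀ η ξ, |η - η₁| ≤ r * h → |ξ - ξ₁| ≤ r * h → ∃ x, R x = (η, ξ) ∧
      ∀ y ∈ Metric.ball x (r * h), y ∈ U ∧ ‖R y - R x‖ ≤ L * ‖y - x‖) →
    (∀ y ∈ U, |tens m (etaCoeff P) (R y).1 (R y).2| ≤ D * ‖F y‖ ∧
      |tens m (xiCoeff P) (R y).1 (R y).2| ≤ D * ‖F y‖) → α ≤ α' → γ ≤ γ' →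
    (∀ η ∈ Icc α α', |η - η₁| ≤ M * (r * h)) → (∀ ξ ∈ Icc γ γ', |ξ - ξ₁| ≤ M * (r * h)) →
    ∃ S : ℝ, 0 ≤ S ∧ (∀ η ∈ Icc α α', ∀ ξ ∈ Icc γ γ', |tens m (etaCoeff P) η ξ| ≤ S ∧
      |tens m (xiCoeff P) η ξ| ≤ S) ∧
      ENNReal.ofReal (c * h ^ 2 * S ^ 2) ≤ ENNReal.ofReal (D ^ 2) * ∫⁻ y in U, ‖F y‖ₑ ^ 2 := by
  obtain ⟨c, hc, H⟩ := exists_lintegral_lower_bound m hr hM hL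
  refine ⟨c, hc, ?_⟩
  intro P U R F D h η₁ ξ₁ α α' γ γ' hP hD hh hR hF hα hγ hbη hbξ
  obtain ⟨z, hz, hmax⟩ := (isCompact_Icc.prod isCompact_Icc).exists_isMaxOn
    ((nonempty_Icc.2 hα).prod (nonempty_Icc.2 hγ))
    (((continuous_tens m (etaCoeff P)).abs.max (continuous_tens m (xiCoeff P)).abs).continuousOn)
  refine ⟨max |tens m (etaCoeff P) z.1 z.2| |tens m (xiCoeff P) z.1 z.2|,
    le_max_of_le_left (abs_nonneg _), fun η hη ξ hξ => ?_, ?_⟩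
  · exact max_le_iff.1 (hmax (show (η, ξ) ∈ Icc α α' ×ˢ Icc γ γ' from ⟨hη, hξ⟩))
  · rcases max_choice (|tens m (etaCoeff P) z.1 z.2|) (|tens m (xiCoeff P) z.1 z.2|) with h1 | h1
    · rw [h1, sq_abs]
      exact H _ U R F D h η₁ ξ₁ (natDegree_etaCoeff_le hP) hD hh hR (fun y hy => (hF y hy).1)
        z.1 z.2 (hbη _ hz.1) (hbξ _ hz.2)
    · rw [h1, sq_abs]
      exact H _ U R F D h η₁ ξ₁ (natDegree_xiCoeff_le hP) hD hh hR (fun y hy => (hF y hy).2)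
        z.1 z.2 (hbη _ hz.1) (hbξ _ hz.2)

/-! ### Traces on the boundary and the scaling of the inequality -/

/-- The gradient on U agrees with a field that is continuous up to the boundary of K, so its
extension by continuity is that field, and a pointwise bound times the boundary length remains. -/
theorem boundaryGradSq_le {U K : Set Plane} {φ : Plane → ℝ} {V : Plane → Plane} {G : ℝ}
    (hK : IsClosed K) (hUK : U ⊆ K) (hV : ContinuousOn V K) (hφ : ∀ x ∈ U, gradient φ x = V x)
    (hG : ∀ x ∈ K, ‖V x‖ ≤ G) :
    boundaryGradSq U K φ ≤ ENNReal.ofReal (G ^ 2) * Measure.hausdorffMeasure 1 (frontier K) := by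
  have hmeas : MeasurableSet (frontier K ∩ closure U) :=
    (isClosed_frontier.inter isClosed_closure).measurableSet
  calc boundaryGradSq U K φ
      ≤ ∫⁻ _ in frontier K ∩ closure U, ENNReal.ofReal (G ^ 2) ∂(Measure.hausdorffMeasure 1) := by
        refine setLIntegral_mono' hmeas fun x hx => ?_
        have hxK : x ∈ K := hK.frontier_subset hx.1
        have hlim : Tendsto (gradient φ) (𝓝[U] x) (𝓝 (V x)) :=
          (((hV x hxK).mono hUK).tendsto).congr'
            (eventually_nhdsWithin_of_forall fun y hy => (hφ y hy).symm)
        rw [extendFrom_eq hx.2 hlim, ← ofReal_norm, ← ENNReal.ofReal_pow (norm_nonneg _)]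
        exact ENNReal.ofReal_le_ofReal (pow_le_pow_left₀ (norm_nonneg _) (hG x hxK) 2)
    _ = ENNReal.ofReal (G ^ 2) * Measure.hausdorffMeasure 1 (frontier K ∩ closure U) := by
        rw [setLIntegral_const]
    _ ≤ _ := by gcongr; exact inter_subset_left

/-- Scaling only: a boundary term A (β⁺)² S² h against an energy of at least β⁻ c h² S². The
quotient (A/c) (β⁺)² / (β⁻ h) is the square of the asserted factor. -/
theorem traceInequality_of_bounds {A c βp βm h S : ℝ} {Ωp Ωm K : Set Plane} {φ : Plane → ℝ}
    {I : ℝ≥0∞} (hA : 0 ≤ A) (hc : 0 < c) (hβm : 0 < βm) (hβ : βm ≤ βp) (hh : 0 < h)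
    (hb : ENNReal.ofReal βp ^ 2 * boundaryGradSq (interior K ∩ Ωp) K φ
      + ENNReal.ofReal βm ^ 2 * boundaryGradSq (interior K ∩ Ωm) K φ
      ≤ ENNReal.ofReal (A * (βp ^ 2 * S ^ 2 * h)))
    (hI : ENNReal.ofReal (c * h ^ 2 * S ^ 2) ≤ I)
    (hIE : ENNReal.ofReal βm * I ≤
      ENNReal.ofReal βp * (∫⁻ x in interior K ∩ Ωp, ‖gradient φ x‖ₑ ^ 2)
      + ENNReal.ofReal βm * (∫⁻ x in interior K ∩ Ωm, ‖gradient φ x‖ₑ ^ 2)) :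
    TraceInequality √(A / c) βp βm Ωp Ωm h K φ := by
  have hβp : 0 < βp := hβm.trans_le hβ
  set t := √(A / c) * (βp / √βm) * h ^ (-(1 / 2) : ℝ) with ht
  have ht0 : 0 ≤ t := by positivity
  have htsq : t ^ 2 = A / c * (βp ^ 2 / βm) * h⁻¹ := by
    rw [ht, mul_pow, mul_pow, div_pow, Real.sq_sqrt (by positivity), Real.sq_sqrt hβm.le]
    congr 1
    rw [← Real.rpow_natCast, ← Real.rpow_mul hh.le, ← Real.rpow_neg_one]
    norm_num
  have key : ENNReal.ofReal (A * (βp ^ 2 * S ^ 2 * h)) ≤ ENNReal.ofReal t ^ 2 *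
      (ENNReal.ofReal βp * (∫⁻ x in interior K ∩ Ωp, ‖gradient φ x‖ₑ ^ 2)
      + ENNReal.ofReal βm * (∫⁻ x in interior K ∩ Ωm, ‖gradient φ x‖ₑ ^ 2)) := by
    calc ENNReal.ofReal (A * (βp ^ 2 * S ^ 2 * h))
        = ENNReal.ofReal (t ^ 2) * (ENNReal.ofReal βm * ENNReal.ofReal (c * h ^ 2 * S ^ 2)) := by
          rw [← ENNReal.ofReal_mul hβm.le, ← ENNReal.ofReal_mul (by positivity), htsq]
          congr 1
          field_simp
      _ ≤ ENNReal.ofReal (t ^ 2) * (ENNReal.ofReal βm * I) := by gcongr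
      _ ≤ _ := by
          rw [ENNReal.ofReal_pow ht0]
          gcongr
  rw [TraceInequality, fluxBoundaryNorm, energyNorm]
  refine (ENNReal.rpow_le_rpow (hb.trans key) (by norm_num)).trans (le_of_eq ?_)
  rw [ENNReal.mul_rpow_of_nonneg _ _ (by norm_num), ← ENNReal.rpow_natCast, ← ENNReal.rpow_mul]
  norm_num
  rfl

theorem TraceInequality.mono {C C' βp βm h : ℝ} {Ωp Ωm K : Set Plane} {φ : Plane → ℝ}
    (H : TraceInequality C βp βm Ωp Ωm h K φ) (hC : C ≤ C') (hβp : 0 ≤ βp) (hh : 0 ≤ h) :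
    TraceInequality C' βp βm Ωp Ωm h K φ := by
  unfold TraceInequality at *
  refine H.trans ?_
  gcongr

/-! ### Rectangular elements -/

/-- The closed rectangle with lower left corner `lo` and upper right corner `hi`. -/
def closedRect (lo hi : Fin 2 → ℝ) : Set Plane := {x | ∀ j, lo j ≤ x j ∧ x j ≤ hi j}

theorem closedRect_eq_preimage (lo hi : Fin 2 → ℝ) : closedRect lo hi =
    (EuclideanSpace.equiv (Fin 2) ℝ).toHomeomorph ⁻¹' (Set.pi univ fun j => Icc (lo j) (hi j)) := by
  ext x
  exact ⟨fun h j _ => h j, fun h j => h j (mem_univ j)⟩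

theorem isClosed_closedRect (lo hi : Fin 2 → ℝ) : IsClosed (closedRect lo hi) := by
  rw [closedRect_eq_preimage]
  exact (isClosed_set_pi fun j _ => isClosed_Icc).preimage (Homeomorph.continuous _)

theorem interior_closedRect (lo hi : Fin 2 → ℝ) : interior (closedRect lo hi) = openRect lo hi := by
  rw [closedRect_eq_preimage, ← Homeomorph.preimage_interior, interior_pi_set finite_univ]
  ext x
  simp [openRect, interior_Icc]

theorem isCompact_closedRect (lo hi : Fin 2 → ℝ) : IsCompact (closedRect lo hi) := by
  rw [closedRect_eq_preimage, Homeomorph.isCompact_preimage]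
  exact isCompact_univ_pi fun j => isCompact_Icc

theorem convex_closedRect (lo hi : Fin 2 → ℝ) : Convex ℝ (closedRect lo hi) := by
  rw [closedRect_eq_preimage]
  exact (convex_pi fun j _ => convex_Icc _ _).linear_preimage
    (EuclideanSpace.equiv (Fin 2) ℝ).toLinearMap

theorem closure_interior_closedRect {lo hi : Fin 2 → ℝ} (h : ∀ j, lo j < hi j) :
    closure (interior (closedRect lo hi)) = closedRect lo hi := by
  have hne : (interior (closedRect lo hi)).Nonempty := by
    rw [interior_closedRect]
    refine ⟨WithLp.toLp 2 fun j => (lo j + hi j) / 2, fun j => ?_⟩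
    have := h j
    constructor <;> simp <;> linarith
  rw [(convex_closedRect lo hi).closure_interior_eq_closure_of_nonempty_interior hne,
    (isClosed_closedRect lo hi).closure_eq]

theorem norm_sub_le_of_mem_closedRect {lo hi : Fin 2 → ℝ} {x y : Plane} (hx : x ∈ closedRect lo hi)
    (hy : y ∈ closedRect lo hi) : ‖x - y‖ ≤ √((hi 0 - lo 0) ^ 2 + (hi 1 - lo 1) ^ 2) := by
  refine Real.le_sqrt_of_sq_le ?_
  rw [norm_sq_plane]
  have h : ∀ j, (x j - y j) ^ 2 ≤ (hi j - lo j) ^ 2 := fun j => by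
    refine sq_le_sq' ?_ ?_ <;> linarith [(hx j).1, (hx j).2, (hy j).1, (hy j).2]
  simp only [PiLp.sub_apply]
  exact add_le_add (h 0) (h 1)

theorem abs_coord_le_norm (x : Plane) (j : Fin 2) : |x j| ≤ ‖x‖ := by
  simpa using PiLp.norm_apply_le x j

theorem hausdorffMeasure_side_le {u v : Plane} {s : ℝ} (hs : ‖u - v‖ ≤ s) (A : Set Plane)
    (hA : A ⊆ segment ℝ u v) : Measure.hausdorffMeasure 1 A ≤ ENNReal.ofReal s := by
  refine (measure_mono hA).trans ?_
  rw [hausdorffMeasure_segment, edist_dist, dist_eq_norm]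
  exact ENNReal.ofReal_le_ofReal hs

/-- The frontier is covered by four segments, none longer than the diagonal. -/
theorem hausdorffMeasure_frontier_closedRect_le {lo hi : Fin 2 → ℝ} (h : ∀ j, lo j < hi j) :
    Measure.hausdorffMeasure 1 (frontier (closedRect lo hi))
      ≤ ENNReal.ofReal (4 * √((hi 0 - lo 0) ^ 2 + (hi 1 - lo 1) ^ 2)) := by
  set d := √((hi 0 - lo 0) ^ 2 + (hi 1 - lo 1) ^ 2) with hd
  have hd0 : 0 ≤ d := Real.sqrt_nonneg _
  have hmem : ∀ u v : ℝ, u ∈ Icc (lo 0) (hi 0) → v ∈ Icc (lo 1) (hi 1) →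
      (!₂[u, v] : Plane) ∈ closedRect lo hi := by
    intro u v hu hv j
    fin_cases j
    · exact hu
    · exact hv
  have l0 := left_mem_Icc.2 (h 0).le
  have r0 := right_mem_Icc.2 (h 0).le
  have l1 := left_mem_Icc.2 (h 1).le
  have r1 := right_mem_Icc.2 (h 1).le
  have hv : ∀ c : ℝ, {x : Plane | x 0 = c ∧ x 1 ∈ Icc (lo 1) (hi 1)} ⊆
      segment ℝ (!₂[c, lo 1] : Plane) !₂[c, hi 1] := by
    rintro c x ⟨h0, h1⟩
    rw [segment_eq_image]
    have hpos : 0 < hi 1 - lo 1 := sub_pos.2 (h 1)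
    refine ⟨(x 1 - lo 1) / (hi 1 - lo 1), ⟨div_nonneg (sub_nonneg.2 h1.1) hpos.le, ?_⟩, ?_⟩
    · rw [div_le_one hpos]; linarith [h1.2]
    · ext j
      fin_cases j
      · simp [h0]; ring
      · simp; field_simp; ring
  have hu : ∀ c : ℝ, {x : Plane | x 1 = c ∧ x 0 ∈ Icc (lo 0) (hi 0)} ⊆
      segment ℝ (!₂[lo 0, c] : Plane) !₂[hi 0, c] := by
    rintro c x ⟨h0, h1⟩
    rw [segment_eq_image]
    have hpos : 0 < hi 0 - lo 0 := sub_pos.2 (h 0)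
    refine ⟨(x 0 - lo 0) / (hi 0 - lo 0), ⟨div_nonneg (sub_nonneg.2 h1.1) hpos.le, ?_⟩, ?_⟩
    · rw [div_le_one hpos]; linarith [h1.2]
    · ext j
      fin_cases j
      · simp; field_simp; ring
      · simp [h0]; ring
  have hsub : frontier (closedRect lo hi) ⊆
      ({x : Plane | x 0 = lo 0 ∧ x 1 ∈ Icc (lo 1) (hi 1)} ∪
        {x : Plane | x 0 = hi 0 ∧ x 1 ∈ Icc (lo 1) (hi 1)}) ∪
      ({x : Plane | x 1 = lo 1 ∧ x 0 ∈ Icc (lo 0) (hi 0)} ∪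
        {x : Plane | x 1 = hi 1 ∧ x 0 ∈ Icc (lo 0) (hi 0)}) := by
    intro x hx
    rw [(isClosed_closedRect lo hi).frontier_eq, interior_closedRect] at hx
    obtain ⟨hxK, hxo⟩ := hx
    have hnot : ¬ ((lo 0 < x 0 ∧ x 0 < hi 0) ∧ (lo 1 < x 1 ∧ x 1 < hi 1)) := by
      rintro ⟨h0, h1⟩
      refine hxo fun j => ?_
      fin_cases j
      · exact h0
      · exact h1
    by_contra hcon
    simp only [mem_union, mem_ofPred_eq, not_or, not_and] at hcon
    obtain ⟨⟨c1, c2⟩, c3, c4⟩ := hcon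
    exact hnot ⟨⟨lt_of_le_of_ne (hxK 0).1 fun e => c1 e.symm (hxK 1),
      lt_of_le_of_ne (hxK 0).2 fun e => c2 e (hxK 1)⟩,
      ⟨lt_of_le_of_ne (hxK 1).1 fun e => c3 e.symm (hxK 0),
      lt_of_le_of_ne (hxK 1).2 fun e => c4 e (hxK 0)⟩⟩
  refine (measure_mono hsub).trans ?_
  refine (measure_union_le _ _).trans ?_
  refine (add_le_add (measure_union_le _ _) (measure_union_le _ _)).trans ?_
  refine (add_le_add (add_le_add (hausdorffMeasure_side_le (s := d) ?_ _ (hv (lo 0)))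
    (hausdorffMeasure_side_le (s := d) ?_ _ (hv (hi 0)))) (add_le_add (hausdorffMeasure_side_le (s := d) ?_ _
    (hu (lo 1))) (hausdorffMeasure_side_le (s := d) ?_ _ (hu (hi 1))))).trans (le_of_eq ?_)
  · exact norm_sub_le_of_mem_closedRect (hmem _ _ l0 l1) (hmem _ _ l0 r1)
  · exact norm_sub_le_of_mem_closedRect (hmem _ _ r0 l1) (hmem _ _ r0 r1)
  · exact norm_sub_le_of_mem_closedRect (hmem _ _ l0 l1) (hmem _ _ r0 l1)
  · exact norm_sub_le_of_mem_closedRect (hmem _ _ l0 r1) (hmem _ _ r0 r1)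
  · rw [← ENNReal.ofReal_add hd0 hd0, ← ENNReal.ofReal_add (by linarith) (by linarith)]
    congr 1
    ring

/-! ### Interface elements -/

theorem frenetMap_zero (g : ℝ → Plane) (ξ : ℝ) : frenetMap g 0 ξ = g ξ := by
  simp [frenetMap]

/-- The Frenet coordinates of an interface element of size `h` contain, away from the interface and
with some room, a square of size comparable to `h`. -/
theorem IsJordanParam.exists_frenet_square {m : ℕ} {ξs ξe : ℝ} {g : ℝ → Plane}
    (hg : IsJordanParam m ξs ξe g) {B : ℝ} (hB : IsBoundedCurve g B) {ρ : ℝ} (hρ : 0 < ρ)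
    (hρ1 : ρ ≤ 1) : ∃ h₀ > 0, ∃ r > 0, ∃ M : ℝ, 1 ≤ M ∧ ∃ c₀ > 0, h₀ ≤ 1 ∧ h₀ ≤ 1 / (2 * B) ∧
    ∀ (h : ℝ) (K : Set Plane) (R : Plane → ℝ × ℝ) (x₀ : Plane) (Ωp Ωm : Set Plane), 0 < h → h < h₀ →
    Convex ℝ K → IsCompact K → closure (interior K) = K → (∀ x ∈ K, ∀ y ∈ K, ‖x - y‖ ≤ h) →
    Metric.ball x₀ (ρ * h) ⊆ K → IsFrenetInverse g h K R → IsOpen Ωp → IsOpen Ωm →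
    Disjoint Ωp Ωm → interior K \ range g ⊆ Ωp ∪ Ωm →
    (∃ η₁ ξ₁ : ℝ, (∀ η ∈ Icc (-h) h, |η - η₁| ≤ M * (r * h)) ∧
      (∀ ξ ∈ Icc (xiLeft K R) (xiRight K R), |ξ - ξ₁| ≤ M * (r * h)) ∧
      ∃ U : Set Plane, (U = Ωp ∨ U = Ωm) ∧ ∀ η ξ, |η - η₁| ≤ r * h → |ξ - ξ₁| ≤ r * h →
        ∃ x, R x = (η, ξ) ∧ ∀ y ∈ Metric.ball x (r * h),
          y ∈ interior K ∩ U ∧ ‖R y - R x‖ ≤ 2 * B * ‖y - x‖) ∧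
    c₀ * h ≤ xiRight K R - xiLeft K R ∧ ∀ x ∈ K, (R x).2 ∈ Icc (xiLeft K R) (xiRight K R) := by
  have hB1 := hB.one_le
  have hB0 := hB.pos
  set δ := 1 / (4 * B ^ 3) with hδ
  have hδ0 : 0 < δ := by positivity
  obtain ⟨s, hs, hsep⟩ := hg.exists_separation hδ0
  -- The Frenet map stretches by at most 1 + 2B², so the square of half width c h about R(x₀) is
  -- mapped into the ball of radius ρ h / 2.
  set c := ρ / (4 * (1 + 2 * B ^ 2)) with hc
  have hc0 : 0 < c := by positivity
  have hcρ : (1 + 2 * B ^ 2) * c = ρ / 4 := by rw [hc]; field_simp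
  have hc1 : c ≤ ρ / 4 := by nlinarith [mul_pos (pow_pos hB0 2) hc0]
  -- R is 2B-Lipschitz, so on balls of radius r h it moves by at most c h / 4.
  set r := c / (8 * B) with hr
  have hr0 : 0 < r := by positivity
  have hrB : 2 * B * r = c / 4 := by rw [hr]; field_simp; norm_num
  have hrc : r ≤ c / 8 := by rw [hr]; gcongr; linarith
  have hMr : (3 + 2 * B) / r * r = 3 + 2 * B := by field_simp
  -- The four thresholds serve crude estimates, the Jacobian bounds, the separation of the curve,
  -- and local injectivity at distances up to (2B + 1) h. With M = (3 + 2B)/r the enlarged square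
  -- has half width (3 + 2B) h and covers all Frenet coordinates of K.
  refine ⟨min (min 1 (1 / (2 * B))) (min s (δ / (2 * B + 1))), by positivity, r, hr0,
    (3 + 2 * B) / r, ?_, c, hc0, (min_le_left _ _).trans (min_le_left _ _),
    (min_le_left _ _).trans (min_le_right _ _), ?_⟩
  · rw [le_div_iff₀ hr0]; linarith
  intro h K R x₀ Ωp Ωm hh hh₀ hconv hcomp hcl hdiam hball hR hΩp hΩm hdisj hcover
  have hh1 : h ≤ 1 := hh₀.le.trans ((min_le_left _ _).trans (min_le_left _ _))
  have hhB : h ≤ 1 / (2 * B) := hh₀.le.trans ((min_le_left _ _).trans (min_le_right _ _))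
  have hhs : h < s := hh₀.trans_le ((min_le_right _ _).trans (min_le_left _ _))
  have hhδ : (2 * B + 1) * h ≤ δ := by
    have : h ≤ δ / (2 * B + 1) := hh₀.le.trans ((min_le_right _ _).trans (min_le_right _ _))
    rwa [le_div_iff₀ (by positivity), mul_comm] at this
  have hhδ' : h ≤ δ := by nlinarith [mul_pos hB0 hh]
  have hballint : Metric.ball x₀ (ρ * h) ⊆ interior K := interior_maximal hball Metric.isOpen_ball
  have hρh : 0 < ρ * h := by positivity
  have hx₀ : x₀ ∈ K := hball (Metric.mem_ball_self hρh)
  have hlip : ∀ x ∈ K, ∀ y ∈ K, ‖R x - R y‖ ≤ 2 * B * ‖x - y‖ := fun x hx y hy =>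
    hB.inverse_sub_le hR hhB hconv hcl hx hy
  have hch : 0 < c * h := by positivity
  set η₀ := (R x₀).1 with hη₀
  set ξ₀ := (R x₀).2 with hξ₀
  have hη₀h : |η₀| ≤ h := hR.abs_le x₀ hx₀
  -- the square of half width `c h` around `R x₀` is mapped into the element
  have hbox : ∀ η ξ : ℝ, |η - η₀| ≤ c * h → |ξ - ξ₀| ≤ c * h →
      frenetMap g η ξ ∈ Metric.ball x₀ (ρ * h / 2) ∧ R (frenetMap g η ξ) = (η, ξ) := by
    intro η ξ hη hξ
    have h1 : ‖frenetMap g η ξ - x₀‖ ≤ ρ / 4 * h := by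
      have e1 := hB.frenetMap_sub_le (η := η) (ξ := ξ) (ξ' := ξ₀) (hη₀h.trans hh1)
      have e2 : frenetMap g η₀ ξ₀ = x₀ := hR.right_inv x₀ hx₀
      rw [e2] at e1
      calc _ ≤ _ := e1
        _ ≤ c * h + 2 * B ^ 2 * (c * h) := by gcongr
        _ = (1 + 2 * B ^ 2) * c * h := by ring
        _ = ρ / 4 * h := by rw [hcρ]
    have h2 : frenetMap g η ξ ∈ Metric.ball x₀ (ρ * h / 2) := by
      rw [Metric.mem_ball, dist_eq_norm]; linarith
    refine ⟨h2, ?_⟩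
    have h3 : frenetMap g η ξ ∈ K :=
      hball (Metric.ball_subset_ball (by linarith) h2)
    have h4 := hlip _ h3 _ hx₀
    have h5 : |(R (frenetMap g η ξ)).2 - ξ₀| ≤ 2 * B * h :=
      (norm_snd_le (R (frenetMap g η ξ) - R x₀)).trans
        (h4.trans (by gcongr; exact hdiam _ h3 _ hx₀))
    -- R(P(η, ξ)) and (η, ξ) are Frenet coordinates of the same point; both are near ξ₀, so local
    -- injectivity excludes another branch.
    have h6 : |(R (frenetMap g η ξ)).2 - ξ| ≤ δ := by
      have e1 := abs_sub_le (R (frenetMap g η ξ)).2 ξ₀ ξ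
      rw [abs_sub_comm ξ₀ ξ] at e1
      have e2 : c * h ≤ h := mul_le_of_le_one_left hh.le (by linarith)
      linarith
    obtain ⟨e1, e2⟩ := hB.frenetMap_injective_local (η := η) (ξ := ξ) h6
      ((hR.abs_le _ h3).trans hhδ') (hR.right_inv _ h3).symm
    exact Prod.ext e1.symm e2.symm
  -- points off the coordinate line `η = 0` are off the curve
  have hoff : ∀ y ∈ K, (R y).1 ≠ 0 → y ∉ range g := by
    rintro y hy hne ⟨ξ', rfl⟩
    have h1 := hR.right_inv _ hy
    have h2 : ‖g (R (g ξ')).2 - g ξ'‖ ≤ h := by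
      have : g (R (g ξ')).2 - g ξ' = -((R (g ξ')).1 • normal g (R (g ξ')).2) := by
        rw [frenetMap] at h1
        nth_rewrite 2 [← h1]
        abel
      rw [this, norm_neg, norm_smul, hB.norm_normal, mul_one]
      exact hR.abs_le _ hy
    -- The point of Γ is at distance |η| ≤ h from its foot point, so it has a parameter ζ close to
    -- that of the foot. Local injectivity for the coordinates (0, ζ) then forces η = 0.
    obtain ⟨ζ, hζ, hζδ⟩ := hsep _ _ (h2.trans_lt hhs)
    refine hne (hB.frenetMap_injective_local (η := (R (g ξ')).1) (ξ := (R (g ξ')).2) (η' := 0)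
      (ξ' := ζ) hζδ.le (by rw [abs_zero]; exact hδ0.le) ?_).1
    rw [h1, frenetMap_zero, hζ]
  -- The centre is moved by half the width away from η = 0, so that the open square of half width c
  -- h / 2 misses this line.
  obtain ⟨η₁, hη₁, hsign⟩ : ∃ η₁, |η₁ - η₀| ≤ c * h / 2 ∧ ∀ η, |η - η₁| < c * h / 2 → η ≠ 0 := by
    rcases le_or_gt 0 η₀ with h0 | h0
    · refine ⟨η₀ + c * h / 2, ?_, fun η hη => ?_⟩
      · rw [add_sub_cancel_left, abs_of_pos (by linarith)]
      · have := (abs_lt.1 hη).1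
        intro h; linarith
    · refine ⟨η₀ - c * h / 2, ?_, fun η hη => ?_⟩
      · rw [sub_sub_cancel_left, abs_neg, abs_of_pos (by linarith)]
      · have := (abs_lt.1 hη).2
        intro h; linarith
  have hnear : ∀ η, |η - η₁| ≤ c * h / 2 → |η - η₀| ≤ c * h := fun η hη => by
    have := abs_sub_le η η₁ η₀
    linarith
  set E : Set (ℝ × ℝ) := Metric.ball η₁ (c * h / 2) ×ˢ Metric.ball ξ₀ (c * h / 2) with hE
  have hEmem : ∀ z : ℝ × ℝ, z ∈ E ↔ |z.1 - η₁| < c * h / 2 ∧ |z.2 - ξ₀| < c * h / 2 := fun z => by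
    rw [hE, mem_prod, Metric.mem_ball, Metric.mem_ball, Real.dist_eq, Real.dist_eq]
  have hEP : ∀ z ∈ E, frenetMap g z.1 z.2 ∈ Metric.ball x₀ (ρ * h / 2) ∧
      R (frenetMap g z.1 z.2) = z := fun z hz => by
    obtain ⟨h1, h2⟩ := (hEmem z).1 hz
    exact hbox z.1 z.2 (hnear _ h1.le) (by linarith)
  have hhalf : Metric.ball x₀ (ρ * h / 2) ⊆ interior K :=
    (Metric.ball_subset_ball (by linarith)).trans hballint
  -- A connected set off Γ lies in one of the two subdomains.
  have hconn : IsPreconnected ((fun z : ℝ × ℝ => frenetMap g z.1 z.2) '' E) :=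
    (((convex_ball _ _).prod (convex_ball _ _)).isPreconnected).image _
      hB.continuous_frenetMap.continuousOn
  have hsub : (fun z : ℝ × ℝ => frenetMap g z.1 z.2) '' E ⊆ Ωp ∪ Ωm := by
    rintro _ ⟨z, hz, rfl⟩
    obtain ⟨h1, h2⟩ := hEP z hz
    refine hcover ⟨hhalf h1, hoff _ (interior_subset (hhalf h1)) ?_⟩
    dsimp only
    rw [h2]
    exact hsign _ ((hEmem z).1 hz).1
  obtain ⟨U, hU, hUE⟩ : ∃ U : Set Plane, (U = Ωp ∨ U = Ωm) ∧
      (fun z : ℝ × ℝ => frenetMap g z.1 z.2) '' E ⊆ U := by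
    rcases hconn.subset_or_subset hΩp hΩm hdisj hsub with h1 | h1
    · exact ⟨Ωp, Or.inl rfl, h1⟩
    · exact ⟨Ωm, Or.inr rfl, h1⟩
  set A := (fun x => (R x).2) '' K with hA
  have hAcomp : IsCompact A := hcomp.image_of_continuousOn hR.continuousOn.snd
  have hAne : A.Nonempty := ⟨_, x₀, hx₀, rfl⟩
  have hmemI : ∀ x ∈ K, (R x).2 ∈ Icc (xiLeft K R) (xiRight K R) := fun x hx =>
    ⟨csInf_le hAcomp.bddBelow ⟨x, hx, rfl⟩, le_csSup hAcomp.bddAbove ⟨x, hx, rfl⟩⟩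
  have hAdist : ∀ x ∈ K, |(R x).2 - ξ₀| ≤ 2 * B * h := fun x hx =>
    (norm_snd_le (R x - R x₀)).trans
      ((hlip x hx _ hx₀).trans (by gcongr; exact hdiam _ hx _ hx₀))
  refine ⟨⟨η₁, ξ₀, ?_, ?_, U, hU, ?_⟩, ?_, hmemI⟩
  · intro η hη
    rw [← mul_assoc, hMr]
    have h1 := abs_sub_le η η₀ η₁
    rw [abs_sub_comm η₀ η₁] at h1
    have h2 := abs_sub η η₀
    have h3 : |η| ≤ h := abs_le.2 hη
    have h4 : c * h ≤ h := mul_le_of_le_one_left hh.le (by linarith)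
    nlinarith [mul_pos hB0 hh]
  · intro ξ hξ
    rw [← mul_assoc, hMr]
    obtain ⟨x, hx, hxe⟩ := hAcomp.sInf_mem hAne
    obtain ⟨y, hy, hye⟩ := hAcomp.sSup_mem hAne
    have h1 := (abs_le.1 (hAdist x hx)).1
    have h2 := (abs_le.1 (hAdist y hy)).2
    dsimp only at hxe hye
    rw [hxe] at h1
    rw [hye] at h2
    have h3 : sInf A ≤ ξ := hξ.1
    have h4 : ξ ≤ sSup A := hξ.2
    rw [abs_le]
    constructor <;> linarith
  · intro η ξ hη hξ
    have hrh : r * h ≤ c * h / 8 := by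
      have := mul_le_mul_of_nonneg_right hrc hh.le
      linarith
    have hz : (η, ξ) ∈ E := (hEmem _).2 ⟨by dsimp only; linarith, by dsimp only; linarith⟩
    obtain ⟨h1, h2⟩ := hEP _ hz
    refine ⟨frenetMap g η ξ, h2, fun y hy => ?_⟩
    have hch4 : c * h ≤ ρ / 4 * h := mul_le_mul_of_nonneg_right hc1 hh.le
    have hyint : y ∈ interior K := by
      refine hballint ?_
      rw [Metric.mem_ball] at hy h1 ⊢
      have := dist_triangle y (frenetMap g η ξ) x₀
      linarith
    have hyK := interior_subset hyint
    have hl := hlip y hyK _ (interior_subset (hhalf h1))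
    refine ⟨⟨hyint, ?_⟩, hl⟩
    rw [Metric.mem_ball, dist_eq_norm] at hy
    have h3 : ‖R y - (η, ξ)‖ ≤ c * h / 4 := by
      dsimp only at h2
      rw [h2] at hl
      calc _ ≤ _ := hl
        _ ≤ 2 * B * (r * h) := by gcongr
        _ = 2 * B * r * h := by ring
        _ = c * h / 4 := by rw [hrB]; ring
    have h4 : |(R y).1 - η| ≤ c * h / 4 := (norm_fst_le (R y - (η, ξ))).trans h3
    have h5 : |(R y).2 - ξ| ≤ c * h / 4 := (norm_snd_le (R y - (η, ξ))).trans h3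
    have h6 : R y ∈ E := by
      rw [hEmem]
      have e1 := abs_sub_le (R y).1 η η₁
      have e2 := abs_sub_le (R y).2 ξ ξ₀
      constructor <;> linarith
    have := hUE ⟨R y, h6, rfl⟩
    dsimp only at this
    rwa [hR.right_inv y hyK] at this
  -- Both ξ₀ and ξ₀ + c h are coordinates of points of K, so the interval has length at least c h.
  · have hcc : |η₀ - η₀| ≤ c * h := by rw [sub_self, abs_zero]; exact hch.le
    obtain ⟨h1, h2⟩ := hbox η₀ (ξ₀ + c * h) hcc (by rw [add_sub_cancel_left, abs_of_pos hch])
    have h3 := (hmemI _ (interior_subset (hhalf h1))).2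
    rw [h2] at h3
    have h4 := (hmemI _ hx₀).1
    dsimp only at h3
    linarith

/-! ### Gradients of the pieces in Cartesian and Frenet coordinates -/

/-- The gradient in Cartesian coordinates of `∑ᵢ Pᵢ(ξ) ηⁱ` at the point with Frenet coordinates
`z`. -/
def frenetGradient (g : ℝ → Plane) (m : ℕ) (P : ℕ → Polynomial ℝ) (z : ℝ × ℝ) : Plane :=
  tens m (etaCoeff P) z.1 z.2 • normal g z.2
    + (tens m (xiCoeff P) z.1 z.2 * (frenetJac g z.1 z.2)⁻¹) • tangent g z.2

namespace IsBoundedCurve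

variable {g : ℝ → Plane} {B h : ℝ} {K : Set Plane} {R : Plane → ℝ × ℝ}

theorem gradient_eq (hB : IsBoundedCurve g B) (hR : IsFrenetInverse g h K R)
    (hh : h ≤ 1 / (2 * B)) {m : ℕ} {P : ℕ → Polynomial ℝ} (hP : ∀ i, m < i → P i = 0)
    {U : Set Plane} (hU : IsOpen U) (hUK : U ⊆ interior K) {φ : Plane → ℝ}
    (hφ : ∀ x ∈ U, φ x = tens m P (R x).1 (R x).2) {x : Plane} (hx : x ∈ U) :
    gradient φ x = frenetGradient g m P (R x) :=
  (hB.hasGradientAt_comp_inverse hR hh (hUK hx) (hasFDerivAt_tens hP (R x))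
    (Filter.mem_of_superset (hU.mem_nhds hx) hφ)).gradient

/-- The frame is orthonormal: the normal component of the gradient is p_η and the tangential one is
p_ξ / J, with J ≤ 2B. -/
theorem abs_partial_le_norm_frenetGradient (hB : IsBoundedCurve g B) {m : ℕ}
    {P : ℕ → Polynomial ℝ} {z : ℝ × ℝ} (hz : |z.1| ≤ 1 / (2 * B)) :
    |tens m (etaCoeff P) z.1 z.2| ≤ 2 * B * ‖frenetGradient g m P z‖ ∧
      |tens m (xiCoeff P) z.1 z.2| ≤ 2 * B * ‖frenetGradient g m P z‖ := by
  have hJ := hB.frenetJac_pos hz z.2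
  have hJ2 := hB.frenetJac_le hz z.2
  have h1 : inner ℝ (normal g z.2) (frenetGradient g m P z) = tens m (etaCoeff P) z.1 z.2 := by
    rw [frenetGradient, inner_add_right, inner_smul_right, inner_smul_right,
      hB.inner_normal_self, inner_normal_tangent]
    ring
  have h2 : frenetJac g z.1 z.2 * inner ℝ (tangent g z.2) (frenetGradient g m P z)
      = tens m (xiCoeff P) z.1 z.2 := by
    rw [frenetGradient, inner_add_right, inner_smul_right, inner_smul_right,
      hB.inner_tangent_self, inner_tangent_normal]
    field_simp
    ring
  constructor
  · rw [← h1]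
    refine (abs_real_inner_le_norm _ _).trans ?_
    rw [hB.norm_normal]
    nlinarith [norm_nonneg (frenetGradient g m P z), hB.one_le]
  · rw [← h2, abs_mul, abs_of_pos hJ]
    refine mul_le_mul hJ2 ?_ (abs_nonneg _) (by linarith [hB.pos])
    refine (abs_real_inner_le_norm _ _).trans ?_
    rw [hB.norm_tangent, one_mul]

theorem norm_frenetGradient_le (hB : IsBoundedCurve g B) {m : ℕ} {P : ℕ → Polynomial ℝ}
    {z : ℝ × ℝ} (hz : |z.1| ≤ 1 / (2 * B)) {S : ℝ} (h1 : |tens m (etaCoeff P) z.1 z.2| ≤ S)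
    (h2 : |tens m (xiCoeff P) z.1 z.2| ≤ S) : ‖frenetGradient g m P z‖ ≤ (1 + 2 * B) * S := by
  have hJ := hB.frenetJac_pos hz z.2
  have hS : 0 ≤ S := (abs_nonneg _).trans h1
  have h3 : (frenetJac g z.1 z.2)⁻¹ ≤ 2 * B :=
    inv_le_of_inv_le₀ (by linarith [hB.pos]) (hB.frenetJac_ge hz z.2)
  refine (norm_add_le _ _).trans ?_
  rw [norm_smul, norm_smul, hB.norm_normal, hB.norm_tangent, norm_mul, Real.norm_eq_abs,
    Real.norm_eq_abs, Real.norm_eq_abs, abs_of_pos (inv_pos.2 hJ)]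
  have h4 := mul_le_mul h2 h3 (inv_pos.2 hJ).le hS
  linarith

theorem continuousOn_frenetGradient (hB : IsBoundedCurve g B) (hκ : Continuous (curvature g))
    (hR : IsFrenetInverse g h K R) (hh : h ≤ 1 / (2 * B)) (m : ℕ) (P : ℕ → Polynomial ℝ) :
    ContinuousOn (fun x => frenetGradient g m P (R x)) K := by
  have hf : ContinuousOn (frenetGradient g m P) {z | |z.1| ≤ 1 / (2 * B)} := by
    have hJc : Continuous fun z : ℝ × ℝ => frenetJac g z.1 z.2 := by
      unfold frenetJac
      exact (hB.continuous_deriv.norm.comp continuous_snd).mul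
        (continuous_const.add (continuous_fst.mul (hκ.comp continuous_snd)))
    refine ((continuous_tens m _).smul (hB.continuous_normal.comp continuous_snd)).continuousOn.add
      (ContinuousOn.smul ((continuous_tens m _).continuousOn.mul
        (hJc.continuousOn.inv₀ fun z hz => (hB.frenetJac_pos hz z.2).ne'))
        (hB.continuous_tangent.comp continuous_snd).continuousOn)
  exact hf.comp hR.continuousOn fun x hx => (hR.abs_le x hx).trans hh

/-- The factor β stays with the partial derivatives, because only the product is bounded
independently of the ratio of the diffusion coefficients. -/
theorem boundary_flux_le (hB : IsBoundedCurve g B) (hκ : Continuous (curvature g))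
    (hR : IsFrenetInverse g h K R) (hh : h ≤ 1 / (2 * B)) (hK : IsClosed K) {m : ℕ}
    {P : ℕ → Polynomial ℝ} (hP : ∀ i, m < i → P i = 0) {U : Set Plane} (hU : IsOpen U)
    (hUK : U ⊆ interior K) {φ : Plane → ℝ} (hφ : ∀ x ∈ U, φ x = tens m P (R x).1 (R x).2)
    {β T : ℝ} (hβ : 0 < β) (hT : ∀ x ∈ K, β * |tens m (etaCoeff P) (R x).1 (R x).2| ≤ T ∧
      β * |tens m (xiCoeff P) (R x).1 (R x).2| ≤ T) :
    ENNReal.ofReal β ^ 2 * boundaryGradSq U K φ ≤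
      ENNReal.ofReal (((1 + 2 * B) * T) ^ 2) * Measure.hausdorffMeasure 1 (frontier K) := by
  have h1 := boundaryGradSq_le (G := (1 + 2 * B) * (T / β)) hK (hUK.trans interior_subset)
    (hB.continuousOn_frenetGradient hκ hR hh m P)
    (fun x hx => hB.gradient_eq hR hh hP hU hUK hφ hx) (fun x hx => by
      refine hB.norm_frenetGradient_le ((hR.abs_le x hx).trans hh) ?_ ?_
      · rw [le_div_iff₀ hβ, mul_comm]; exact (hT x hx).1
      · rw [le_div_iff₀ hβ, mul_comm]; exact (hT x hx).2)
  calc _ ≤ ENNReal.ofReal β ^ 2 * (ENNReal.ofReal (((1 + 2 * B) * (T / β)) ^ 2) *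
        Measure.hausdorffMeasure 1 (frontier K)) := by gcongr
    _ = _ := by
      rw [← ENNReal.ofReal_pow hβ.le, ← mul_assoc, ← ENNReal.ofReal_mul (by positivity)]
      congr 2
      field_simp

end IsBoundedCurve

theorem ofReal_div_le_of_le_mul {c D t : ℝ} {I : ℝ≥0∞} (hD : 0 < D)
    (h : ENNReal.ofReal (c * t) ≤ ENNReal.ofReal D * I) : ENNReal.ofReal (c / D * t) ≤ I := by
  calc ENNReal.ofReal (c / D * t) = ENNReal.ofReal D⁻¹ * ENNReal.ofReal (c * t) := by
        rw [← ENNReal.ofReal_mul (by positivity)]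
        congr 1
        ring
    _ ≤ ENNReal.ofReal D⁻¹ * (ENNReal.ofReal D * I) := by gcongr
    _ = I := by
        rw [← mul_assoc, ← ENNReal.ofReal_mul (by positivity), inv_mul_cancel₀ hD.ne',
          ENNReal.ofReal_one, one_mul]

/-- The midpoint of a rectangle. -/
def midpointRect (lo hi : Fin 2 → ℝ) : Plane := WithLp.toLp 2 fun j => (lo j + hi j) / 2

theorem mem_openRect_of_near {lo hi : Fin 2 → ℝ} {s : ℝ} (hs : ∀ j, s ≤ (hi j - lo j) / 2)
    {x : Plane} (hx : ∀ j, |x j - (lo j + hi j) / 2| < s) : x ∈ openRect lo hi := fun j => by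
  have h1 := abs_lt.1 (hx j)
  have h2 := hs j
  constructor <;> linarith [h1.1, h1.2]

theorem ball_midpointRect_subset {lo hi : Fin 2 → ℝ} {s : ℝ} (hs : ∀ j, s ≤ (hi j - lo j) / 2) :
    Metric.ball (midpointRect lo hi) s ⊆ openRect lo hi := fun x hx => by
  rw [Metric.mem_ball, dist_eq_norm] at hx
  refine mem_openRect_of_near hs fun j => ?_
  exact (abs_coord_le_norm (x - midpointRect lo hi) j).trans_lt hx

theorem openRect_subset_closedRect (lo hi : Fin 2 → ℝ) : openRect lo hi ⊆ closedRect lo hi :=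
  fun _ hx j => ⟨(hx j).1.le, (hx j).2.le⟩

/-- The trace inequality on interface elements. -/
theorem IsJordanParam.exists_trace_interface {m : ℕ} (hm : 1 ≤ m) {ξs ξe : ℝ} {g : ℝ → Plane}
    (hg : IsJordanParam m ξs ξe g) {ρ : ℝ} (hρ : 0 < ρ) (hρ1 : ρ ≤ 1) : ∃ C > 0, ∃ h₀ > 0,
    ∀ (lo hi : Fin 2 → ℝ) (h : ℝ) (Ωp Ωm : Set Plane) (βp βm : ℝ), (∀ j, lo j < hi j) →
    h = √((hi 0 - lo 0) ^ 2 + (hi 1 - lo 1) ^ 2) → 0 < h → h < h₀ →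
    (∀ j, ρ * h ≤ (hi j - lo j) / 2) → IsOpen Ωp → IsOpen Ωm → Disjoint Ωp Ωm →
    openRect lo hi \ range g ⊆ Ωp ∪ Ωm → 0 < βm → βm ≤ βp →
    ∀ φ ∈ localSpace g m βp βm Ωp Ωm h (closedRect lo hi),
      TraceInequality C βp βm Ωp Ωm h (closedRect lo hi) φ := by
  obtain ⟨B, hB⟩ := hg.exists_isBoundedCurve hm
  have hB0 := hB.pos
  obtain ⟨h₀, hh₀, r, hr, M, hM, c₀, hc₀, hh₀1, hh₀B, Hgeom⟩ := hg.exists_frenet_square hB hρ hρ1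
  obtain ⟨c, hc, Hlow⟩ := exists_gradient_sup_bound m hr hM (L := 2 * B) (by positivity)
  obtain ⟨C, hC, Hext⟩ := hg.exists_extension_bound hm hc₀
  -- The 8 is two pieces times a perimeter of at most 4h; (2B)² is the cost of passing from the
  -- gradient to the Frenet partial derivatives in the energy.
  refine ⟨√(8 * ((1 + 2 * B) * C) ^ 2 / (c / (2 * B) ^ 2)), by positivity, h₀, hh₀, ?_⟩
  intro lo hi h Ωp Ωm βp βm hlohi hhdef hh hlt hside hΩp hΩm hdisj hcover hβm hβ φ hφ
  obtain ⟨R, hR, pp, pm, hpair, hφp, hφm⟩ := hφ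
  set K := closedRect lo hi with hKdef
  have hβp : 0 < βp := hβm.trans_le hβ
  have hhB : h ≤ 1 / (2 * B) := hlt.le.trans hh₀B
  have hinterior : interior K = openRect lo hi := interior_closedRect lo hi
  obtain ⟨⟨η₁, ξ₁, hbη, hbξ, U, hU, hbox⟩, hlen, hmemI⟩ := Hgeom h K R (midpointRect lo hi) Ωp Ωm hh
    hlt (convex_closedRect lo hi) (isCompact_closedRect lo hi) (closure_interior_closedRect hlohi)
    (fun x hx y hy => hhdef ▸ norm_sub_le_of_mem_closedRect hx hy)
    ((ball_midpointRect_subset hside).trans (openRect_subset_closedRect lo hi)) hR hΩp hΩm hdisj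
    (by rw [hinterior]; exact hcover)
  obtain ⟨P, hP, hP0, hPe⟩ := hpair.poly_pos.exists_eq_tens
  obtain ⟨Q, hQ, hQ0, hQe⟩ := hpair.poly_neg.exists_eq_tens
  obtain rfl : pp = tens m P := funext fun η => funext fun ξ => hPe η ξ
  obtain rfl : pm = tens m Q := funext fun η => funext fun ξ => hQe η ξ
  set x := xiLeft K R with hx
  set y := xiRight K R with hy
  have hxy : x ≤ y := by have := mul_pos hc₀ hh; linarith
  have hUp : IsOpen (interior K ∩ Ωp) := isOpen_interior.inter hΩp
  have hUm : IsOpen (interior K ∩ Ωm) := isOpen_interior.inter hΩm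
  have hφp' : ∀ z ∈ interior K ∩ Ωp, φ z = tens m P (R z).1 (R z).2 := fun z hz =>
    hφp z ⟨hz.1, Or.inl hz.2⟩
  have hφm' : ∀ z ∈ interior K ∩ Ωm, φ z = tens m Q (R z).1 (R z).2 := fun z hz =>
    hφm z ⟨hz.1, Or.inl hz.2⟩
  have hD : ∀ (W : ℕ → Polynomial ℝ) (V : Set Plane), (∀ i, m < i → W i = 0) → IsOpen V →
      V ⊆ interior K → (∀ z ∈ V, φ z = tens m W (R z).1 (R z).2) → ∀ z ∈ V,
      |tens m (etaCoeff W) (R z).1 (R z).2| ≤ 2 * B * ‖gradient φ z‖ ∧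
      |tens m (xiCoeff W) (R z).1 (R z).2| ≤ 2 * B * ‖gradient φ z‖ := by
    intro W V hW hV hVK hVφ z hz
    rw [hB.gradient_eq hR hhB hW hV hVK hVφ hz]
    exact hB.abs_partial_le_norm_frenetGradient
      ((hR.abs_le z (interior_subset (hVK hz))).trans hhB)
  have h2B : 0 < 2 * B := by positivity
  -- the polynomial piece on the side of the square controls both pieces
  obtain ⟨S, hS0, hSp, hSm, hI⟩ : ∃ S : ℝ, 0 ≤ S ∧
      (∀ η ∈ Icc (-h) h, ∀ ξ ∈ Icc x y, βp * |tens m (etaCoeff P) η ξ| ≤ C * (βp * S) ∧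
        βp * |tens m (xiCoeff P) η ξ| ≤ C * (βp * S)) ∧
      (∀ η ∈ Icc (-h) h, ∀ ξ ∈ Icc x y, βm * |tens m (etaCoeff Q) η ξ| ≤ C * (βp * S) ∧
        βm * |tens m (xiCoeff Q) η ξ| ≤ C * (βp * S)) ∧
      ENNReal.ofReal (c * h ^ 2 * S ^ 2) ≤ ENNReal.ofReal ((2 * B) ^ 2) *
        ∫⁻ z in interior K ∩ U, ‖gradient φ z‖ₑ ^ 2 := by
    have hself : ∀ β : ℝ, 0 < β → β ≤ βp → ∀ S t : ℝ, 0 ≤ S → |t| ≤ S →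
        β * |t| ≤ C * (βp * S) := by
      intro β hβ0 hβ1 S t hS ht
      calc β * |t| ≤ βp * S := mul_le_mul hβ1 ht (abs_nonneg _) hβp.le
        _ ≤ C * (βp * S) := le_mul_of_one_le_left (by positivity) hC
    rcases hU with rfl | rfl
    · obtain ⟨S, hS0, hS, hI⟩ := Hlow P _ R (gradient φ) (2 * B) h η₁ ξ₁ (-h) h x y hP h2B hh hbox
        (hD P _ hP0 hUp inter_subset_left hφp') (by linarith) hxy hbη hbξ
      refine ⟨S, hS0, fun η hη ξ hξ => ?_, fun η hη ξ hξ => ?_, hI⟩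
      · exact ⟨hself _ hβp le_rfl _ _ hS0 (hS η hη ξ hξ).1,
          hself _ hβp le_rfl _ _ hS0 (hS η hη ξ hξ).2⟩
      · exact Hext βp βm βp h x y S P Q hβp hβm le_rfl hβ hh (hlt.le.trans hh₀1) hlen hP hP0 hQ hQ0
          hpair (fun η ξ hη hξ => hS η (abs_le.1 hη) ξ hξ) η ξ (abs_le.2 hη) hξ
    -- The square lies in Ω⁻: the roles of the pieces are exchanged.
    · obtain ⟨S, hS0, hS, hI⟩ := Hlow Q _ R (gradient φ) (2 * B) h η₁ ξ₁ (-h) h x y hQ h2B hh hbox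
        (hD Q _ hQ0 hUm inter_subset_left hφm') (by linarith) hxy hbη hbξ
      refine ⟨S, hS0, fun η hη ξ hξ => ?_, fun η hη ξ hξ => ?_, hI⟩
      · exact Hext βm βp βp h x y S Q P hβm hβp hβ le_rfl hh (hlt.le.trans hh₀1) hlen hQ hQ0 hP hP0
          hpair.symm (fun η ξ hη hξ => hS η (abs_le.1 hη) ξ hξ) η ξ (abs_le.2 hη) hξ
      · exact ⟨hself _ hβm hβ _ _ hS0 (hS η hη ξ hξ).1, hself _ hβm hβ _ _ hS0 (hS η hη ξ hξ).2⟩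
  have hRK : ∀ z ∈ K, (R z).1 ∈ Icc (-h) h := fun z hz => abs_le.1 (hR.abs_le z hz)
  have hκ := hg.continuous_curvature hm
  have hKc : IsClosed K := isClosed_closedRect lo hi
  have hfp := hB.boundary_flux_le hκ hR hhB hKc hP0 hUp inter_subset_left hφp' hβp
    fun z hz => hSp _ (hRK z hz) _ (hmemI z hz)
  have hfm := hB.boundary_flux_le hκ hR hhB hKc hQ0 hUm inter_subset_left hφm' hβm
    fun z hz => hSm _ (hRK z hz) _ (hmemI z hz)
  have hH : Measure.hausdorffMeasure 1 (frontier K) ≤ ENNReal.ofReal (4 * h) := by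
    rw [hhdef]
    exact hausdorffMeasure_frontier_closedRect_le hlohi
  refine traceInequality_of_bounds (S := S) (by positivity) (by positivity) hβm hβ hh ?_ ?_
    (I := ∫⁻ z in interior K ∩ U, ‖gradient φ z‖ₑ ^ 2) ?_
  · refine (add_le_add hfp hfm).trans ?_
    calc _ ≤ ENNReal.ofReal (((1 + 2 * B) * (C * (βp * S))) ^ 2) * ENNReal.ofReal (4 * h)
          + ENNReal.ofReal (((1 + 2 * B) * (C * (βp * S))) ^ 2) * ENNReal.ofReal (4 * h) := by
            gcongr
      _ = _ := by
        rw [← ENNReal.ofReal_mul (by positivity), ← ENNReal.ofReal_add (by positivity)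
          (by positivity)]
        congr 1
        ring
  · have := ofReal_div_le_of_le_mul (c := c) (D := (2 * B) ^ 2) (t := h ^ 2 * S ^ 2) (by positivity)
      (by rw [← mul_assoc]; exact hI)
    rwa [← mul_assoc] at this
  -- Only the energy on the side U is kept; its weight is at least β⁻ in either case.
  · rcases hU with rfl | rfl
    · refine le_trans ?_ (self_le_add_right _ _)
      gcongr
    · exact self_le_add_left _ _

/-! ### Non-interface elements -/

/-- The pair of Cartesian coordinates. -/
def coordPair (x : Plane) : ℝ × ℝ := (x 0, x 1)

theorem hasGradientAt_comp_coordPair {p : ℝ × ℝ → ℝ} {a b : ℝ} {x : Plane}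
    (hp : HasFDerivAt p (a • ContinuousLinearMap.fst ℝ ℝ ℝ
      + b • ContinuousLinearMap.snd ℝ ℝ ℝ) (coordPair x)) :
    HasGradientAt (fun y => p (coordPair y)) (!₂[a, b] : Plane) x := by
  rw [hasGradientAt_iff_hasFDerivAt]
  have h1 : HasFDerivAt coordPair ((EuclideanSpace.proj (𝕜 := ℝ) (0 : Fin 2)).prod
      (EuclideanSpace.proj (𝕜 := ℝ) (1 : Fin 2)) : Plane →L[ℝ] ℝ × ℝ) x :=
    ((EuclideanSpace.proj (𝕜 := ℝ) (0 : Fin 2)).prod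
      (EuclideanSpace.proj (𝕜 := ℝ) (1 : Fin 2)) : Plane →L[ℝ] ℝ × ℝ).hasFDerivAt
  refine (hp.comp x h1).congr_fderiv (ContinuousLinearMap.ext fun v => ?_)
  simp [inner_plane]

/-- The trace inequality on elements that do not meet the interface. -/
theorem exists_trace_polynomial (m : ℕ) {ρ : ℝ} (hρ : 0 < ρ) (hρ1 : ρ ≤ 1) : ∃ C > 0,
    ∀ (lo hi : Fin 2 → ℝ) (h : ℝ) (Ωp Ωm : Set Plane) (βp βm : ℝ), (∀ j, lo j < hi j) →
    h = √((hi 0 - lo 0) ^ 2 + (hi 1 - lo 1) ^ 2) → 0 < h →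
    (∀ j, ρ * h ≤ (hi j - lo j) / 2) → Disjoint Ωp Ωm →
    (openRect lo hi ⊆ Ωp ∨ openRect lo hi ⊆ Ωm) → 0 < βm → βm ≤ βp →
    ∀ φ ∈ polySpace m (closedRect lo hi),
      TraceInequality C βp βm Ωp Ωm h (closedRect lo hi) φ := by
  -- Squares and balls of size ρ h / 4 about the midpoint add up to ρ h / 2, within the element. M =
  -- 1/r makes the enlarged square cover the element, and L = 1 because the coordinate map is a
  -- contraction into the sup norm.
  set r := ρ / 4 with hr
  have hr0 : 0 < r := by positivity
  obtain ⟨c, hc, Hlow⟩ := exists_gradient_sup_bound m hr0 (M := 1 / r) (L := 1)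
    (by rw [le_div_iff₀ hr0]; linarith) one_pos
  -- The bound 2S for the norm of a gradient with components at most S, squared, times the perimeter
  -- 4h.
  refine ⟨√(16 / (c / 1 ^ 2)), by positivity, ?_⟩
  intro lo hi h Ωp Ωm βp βm hlohi hhdef hh hside hdisj hsub hβm hβ φ hφ
  obtain ⟨q, hq, hφq⟩ := hφ
  obtain ⟨P, hP, hP0, hPe⟩ := hq.exists_eq_tens
  set K := closedRect lo hi with hK
  have hβp : 0 < βp := hβm.trans_le hβ
  have hinterior : interior K = openRect lo hi := interior_closedRect lo hi
  let V : Plane → Plane := fun x =>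
    !₂[tens m (etaCoeff P) (x 0) (x 1), tens m (xiCoeff P) (x 0) (x 1)]
  have hgrad : ∀ x ∈ interior K, gradient φ x = V x := by
    intro x hx
    have h1 := hasGradientAt_comp_coordPair (hasFDerivAt_tens hP0 (coordPair x))
    refine (HasGradientAt.congr_of_eventuallyEq h1 ?_).gradient
    filter_upwards [isOpen_interior.mem_nhds hx] with y hy
    rw [hφq y hy, hPe]
    rfl
  have hcoord : Continuous coordPair := by unfold coordPair; fun_prop
  have hVc : Continuous V := by
    have h1 : Continuous fun x : Plane => tens m (etaCoeff P) (x 0) (x 1) :=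
      (continuous_tens m _).comp hcoord
    have h2 : Continuous fun x : Plane => tens m (xiCoeff P) (x 0) (x 1) :=
      (continuous_tens m _).comp hcoord
    refine (PiLp.continuous_toLp 2 _).comp (continuous_pi fun j => ?_)
    fin_cases j
    · exact h1
    · exact h2
  have hsideh : ∀ j, hi j - lo j ≤ h := by
    intro j
    rw [hhdef]
    refine Real.le_sqrt_of_sq_le ?_
    fin_cases j
    · simp only [Fin.zero_eta]; nlinarith [sq_nonneg (hi 1 - lo 1)]
    · simp only [Fin.mk_one]; nlinarith [sq_nonneg (hi 0 - lo 0)]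
  have hrange : ∀ j, ∀ t ∈ Icc (lo j) (hi j), |t - (lo j + hi j) / 2| ≤ 1 / r * (r * h) := by
    intro j t ht
    rw [← mul_assoc, one_div_mul_cancel hr0.ne', one_mul, abs_le]
    have := hsideh j
    have := hlohi j
    constructor <;> linarith [ht.1, ht.2]
  obtain ⟨S, hS0, hS, hI⟩ := Hlow P (interior K) coordPair (gradient φ) 1 h ((lo 0 + hi 0) / 2)
    ((lo 1 + hi 1) / 2) (lo 0) (hi 0) (lo 1) (hi 1) hP one_pos hh (fun η ξ hη hξ => by
      refine ⟨!₂[η, ξ], rfl, fun y hy => ⟨?_, ?_⟩⟩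
      · rw [hinterior]
        refine mem_openRect_of_near hside fun j => ?_
        rw [Metric.mem_ball, dist_eq_norm] at hy
        have h1 := (abs_coord_le_norm (y - !₂[η, ξ]) j).trans_lt hy
        have hrh : 0 < ρ * h := by positivity
        have hrr : r * h = ρ * h / 4 := by rw [hr]; ring
        fin_cases j
        · have h2 : |y 0 - η| < r * h := h1
          have h3 := abs_sub_le (y 0) η ((lo 0 + hi 0) / 2)
          simp only [Fin.zero_eta]; linarith
        · have h2 : |y 1 - ξ| < r * h := h1
          have h3 := abs_sub_le (y 1) ξ ((lo 1 + hi 1) / 2)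
          simp only [Fin.mk_one]; linarith
      · rw [one_mul, Prod.norm_def]
        exact max_le (abs_coord_le_norm (y - !₂[η, ξ]) 0) (abs_coord_le_norm (y - !₂[η, ξ]) 1))
    (fun y hy => by
      rw [hgrad y hy, one_mul]
      exact ⟨abs_coord_le_norm (V y) 0, abs_coord_le_norm (V y) 1⟩)
    (hlohi 0).le (hlohi 1).le (hrange 0) (hrange 1)
  have hKc : IsClosed K := isClosed_closedRect lo hi
  have hbd : ∀ U ⊆ interior K, boundaryGradSq U K φ ≤ ENNReal.ofReal (16 * S ^ 2 * h) := by
    intro U hU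
    have h1 := boundaryGradSq_le (G := 2 * S) hKc (hU.trans interior_subset) hVc.continuousOn
      (fun x hx => hgrad x (hU hx)) (fun x hx => by
        have h2 := hS (x 0) (hx 0) (x 1) (hx 1)
        refine abs_le_of_sq_le_sq' ?_ (by positivity) |>.2
        rw [norm_sq_plane]
        have e1 : V x 0 ^ 2 ≤ S ^ 2 := by
          rw [← sq_abs]; exact pow_le_pow_left₀ (abs_nonneg _) h2.1 2
        have e2 : V x 1 ^ 2 ≤ S ^ 2 := by
          rw [← sq_abs]; exact pow_le_pow_left₀ (abs_nonneg _) h2.2 2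
        nlinarith [sq_nonneg S])
    refine h1.trans ?_
    have hH : Measure.hausdorffMeasure 1 (frontier K) ≤ ENNReal.ofReal (4 * h) := by
      rw [hhdef]
      exact hausdorffMeasure_frontier_closedRect_le hlohi
    calc _ ≤ ENNReal.ofReal ((2 * S) ^ 2) * ENNReal.ofReal (4 * h) := by gcongr
      _ = _ := by
        rw [← ENNReal.ofReal_mul (by positivity)]
        congr 1
        ring
  have hempty : ∀ U V : Set Plane, Disjoint U V → interior K ⊆ U →
      boundaryGradSq (interior K ∩ V) K φ = 0 := by
    intro U V hUV hKU
    have : interior K ∩ V = ∅ := (hUV.mono_left hKU).inter_eq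
    simp [boundaryGradSq, this]
  have hI' := ofReal_div_le_of_le_mul (c := c) (D := 1 ^ 2) (t := h ^ 2 * S ^ 2) (by positivity)
    (by rw [← mul_assoc]; exact hI)
  rw [← mul_assoc] at hI'
  refine traceInequality_of_bounds (S := S) (by positivity) (by positivity) hβm hβ hh ?_ hI' ?_
  · have hle : ∀ β : ℝ, 0 < β → β ≤ βp → ∀ U ⊆ interior K,
        ENNReal.ofReal β ^ 2 * boundaryGradSq U K φ ≤
          ENNReal.ofReal (16 * (βp ^ 2 * S ^ 2 * h)) := by
      intro β hβ0 hβ1 U hU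
      calc _ ≤ ENNReal.ofReal βp ^ 2 * ENNReal.ofReal (16 * S ^ 2 * h) := by
            gcongr
            exact hbd U hU
        _ = _ := by
          rw [← ENNReal.ofReal_pow hβp.le, ← ENNReal.ofReal_mul (by positivity)]
          congr 1
          ring
    rcases hsub with hs | hs
    · rw [hempty Ωp Ωm hdisj (hinterior ▸ hs), mul_zero, add_zero]
      exact hle βp hβp le_rfl _ inter_subset_left
    · rw [hempty Ωm Ωp hdisj.symm (hinterior ▸ hs), mul_zero, zero_add]
      exact hle βm hβm hβ _ inter_subset_left
  · rcases hsub with hs | hs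
    · refine le_trans ?_ (self_le_add_right _ _)
      rw [inter_eq_left.2 (hinterior ▸ hs)]
      gcongr
    · refine le_trans ?_ (self_le_add_left _ _)
      rw [inter_eq_left.2 (hinterior ▸ hs)]

/-! ### Mesh geometry and the main theorem -/

theorem meshStep_pos {a b : Fin 2 → ℝ} {N : Fin 2 → ℕ} (hab : ∀ j, a j < b j) (hN : ∀ j, 0 < N j)
    (j : Fin 2) : 0 < meshStep a b N j :=
  div_pos (sub_pos.2 (hab j)) (by exact_mod_cast hN j)

/-- The diagonal is at most the sum of the two sides, and each side is at most σ times the other. -/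
theorem meshSize_le {a b : Fin 2 → ℝ} {N : Fin 2 → ℕ} {σ : ℝ} (hab : ∀ j, a j < b j)
    (hN : ∀ j, 0 < N j) (hσ : ShapeRegular a b N σ) (j : Fin 2) :
    meshSize a b N ≤ (1 + max σ 1) * meshStep a b N j := by
  have h0 := meshStep_pos hab hN 0
  have h1 := meshStep_pos hab hN 1
  have hs : meshSize a b N ≤ meshStep a b N 0 + meshStep a b N 1 := by
    refine Real.sqrt_le_iff.2 ⟨by positivity, ?_⟩
    nlinarith [mul_pos h0 h1]
  have e0 := mul_le_mul_of_nonneg_right (le_max_left σ 1) h0.le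
  have e1 := mul_le_mul_of_nonneg_right (le_max_left σ 1) h1.le
  obtain ⟨s0, s1⟩ := hσ
  fin_cases j
  · simp only [Fin.zero_eta]; linarith
  · simp only [Fin.mk_one]; linarith

end FrenetIFE
end

open FrenetIFE in
theorem theorem4 (m : ℕ) (hm : 1 ≤ m) (ξs ξe : ℝ) (g : ℝ → Plane)
    (hg : IsJordanParam m ξs ξe g) (σ : ℝ) :
    ∃ C > 0, ∃ h₀ > 0,
      ∀ (a b : Fin 2 → ℝ), (∀ j, a j < b j) →
      ∀ (Ωp Ωm : Set Plane), IsSplitting g (openRect a b) Ωp Ωm →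
      ∀ (βp βm : ℝ), 0 < βm → βm ≤ βp →
      ∀ N : Fin 2 → ℕ, (∀ j, 0 < N j) → ShapeRegular a b N σ → meshSize a b N < h₀ →
        (∀ i : Fin 2 → ℕ, (∀ j, i j < N j) →
          IsInterfaceElement g (meshElement a b N i) →
          ∀ φ ∈ localSpace g m βp βm Ωp Ωm (meshSize a b N) (meshElement a b N i),
            TraceInequality C βp βm Ωp Ωm (meshSize a b N) (meshElement a b N i) φ) ∧
        (∀ φ ∈ globalSpace g m βp βm Ωp Ωm a b N,
          ∀ i : Fin 2 → ℕ, (∀ j, i j < N j) →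
            TraceInequality C βp βm Ωp Ωm (meshSize a b N) (meshElement a b N i) φ) := by
  -- Every side is at least h/τ, so a ball of radius h/(2τ) about the midpoint lies in the element.
  set τ := 1 + max σ 1 with hτ
  have hτ2 : 2 ≤ τ := by have := le_max_right σ 1; linarith
  have hρ : 0 < 1 / (2 * τ) := by positivity
  have hρ1 : 1 / (2 * τ) ≤ 1 := by rw [div_le_one (by positivity)]; linarith
  obtain ⟨C₁, hC₁, h₀, hh₀, H₁⟩ := hg.exists_trace_interface hm hρ hρ1
  obtain ⟨C₂, hC₂, H₂⟩ := exists_trace_polynomial m hρ hρ1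
  refine ⟨max C₁ C₂, lt_max_of_lt_left hC₁, h₀, hh₀, ?_⟩
  intro a b hab Ωp Ωm hΩ βp βm hβm hβ N hN hσ hlt
  have hstep := meshStep_pos hab hN
  have hβp : 0 ≤ βp := hβm.le.trans hβ
  have hh : 0 < meshSize a b N := by
    have := hstep 0
    have := hstep 1
    exact Real.sqrt_pos.2 (by positivity)
  have hdata : ∀ i : Fin 2 → ℕ, (∀ j, i j < N j) → ∃ lo hi : Fin 2 → ℝ,
      meshElement a b N i = closedRect lo hi ∧ (∀ j, lo j < hi j) ∧
      meshSize a b N = √((hi 0 - lo 0) ^ 2 + (hi 1 - lo 1) ^ 2) ∧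
      (∀ j, 1 / (2 * τ) * meshSize a b N ≤ (hi j - lo j) / 2) ∧
      openRect lo hi ⊆ openRect a b := by
    intro i hi
    have hd : ∀ j, a j + (i j + 1) * meshStep a b N j - (a j + i j * meshStep a b N j)
        = meshStep a b N j := fun j => by ring
    refine ⟨fun j => a j + i j * meshStep a b N j, fun j => a j + (i j + 1) * meshStep a b N j,
      rfl, fun j => ?_, ?_, fun j => ?_, fun x hx j => ?_⟩
    · have := hstep j
      nlinarith
    · dsimp only
      rw [hd, hd, meshSize]
    · dsimp only
      rw [hd]
      have := meshSize_le hab hN hσ j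
      rw [one_div_mul_eq_div, div_le_iff₀ (by positivity)]
      linarith
    · obtain ⟨h1, h2⟩ := hx j
      have hs := hstep j
      have hb : (N j : ℝ) * meshStep a b N j = b j - a j := by
        rw [meshStep, mul_div_cancel₀]
        exact_mod_cast (hN j).ne'
      have hi1 : (i j : ℝ) + 1 ≤ N j := by exact_mod_cast hi j
      constructor
      · have : 0 ≤ (i j : ℝ) * meshStep a b N j := by positivity
        linarith
      · have := mul_le_mul_of_nonneg_right hi1 hs.le
        linarith
  have hlocal : ∀ i : Fin 2 → ℕ, (∀ j, i j < N j) →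
      ∀ φ ∈ localSpace g m βp βm Ωp Ωm (meshSize a b N) (meshElement a b N i),
        TraceInequality (max C₁ C₂) βp βm Ωp Ωm (meshSize a b N) (meshElement a b N i) φ := by
    intro i hi φ hφ
    obtain ⟨lo, hi', hK, hlohi, hsize, hside, hsub⟩ := hdata i hi
    rw [hK] at hφ ⊢
    refine (H₁ lo hi' _ Ωp Ωm βp βm hlohi hsize hh hlt hside hΩ.isOpen_pos hΩ.isOpen_neg hΩ.disjoint
      ?_ hβm hβ φ hφ).mono (le_max_left _ _) hβp hh.le
    rw [hΩ.union_eq]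
    exact sdiff_subset_sdiff_left hsub
  refine ⟨fun i hi _ => hlocal i hi, fun φ hφ i hi => ?_⟩
  by_cases hinterior : IsInterfaceElement g (meshElement a b N i)
  · exact hlocal i hi φ ((hφ i hi).1 hinterior)
  · have hpoly := (hφ i hi).2 hinterior
    obtain ⟨lo, hi', hK, hlohi, hsize, hside, hsub⟩ := hdata i hi
    rw [hK] at hpoly hinterior ⊢
    refine (H₂ lo hi' _ Ωp Ωm βp βm hlohi hsize hh hside hΩ.disjoint ?_ hβm hβ φ hpoly).mono
      (le_max_right _ _) hβp hh.le
    rw [IsInterfaceElement, interior_closedRect] at hinterior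
    -- The open rectangle is convex and misses Γ, so it lies in a single subdomain and β is constant
    -- on it.
    refine IsPreconnected.subset_or_subset hΩ.isOpen_pos hΩ.isOpen_neg hΩ.disjoint ?_ ?_
    · rw [hΩ.union_eq]
      exact fun x hx => ⟨hsub hx, fun hxg => hinterior ⟨x, hx, hxg⟩⟩
    · rw [← interior_closedRect]
      exact (convex_closedRect lo hi').interior.isPreconnected
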